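/- **Setting.** A *right tensor $C^*$-precategory* $\mathcal T$ consists of complex Banach spaces $\mathcal T(m,n)$ ($m,n\in\mathbb N=\{0,1,2,\dots\}$; morphisms from $m$ to $n$), an associative bilinear composition $\mathcal T(m,n)\times\mathcal T(l,m)\to\mathcal T(l,n)$, $(a,b)\mapsto ab$, with $\|ab\|\le\|a\|\|b\|$, an antilinear involution $\mathcal T(m,n)\to\mathcal T(n,m)$, $a\mapsto a^*$, with $(ab)^*=b^*a^*$, $\|a^*a\|=\|a\|^2$ and such that $a^*a$ is a positive element of the $C^*$-algebra $\mathcal T(m,m)$, and linear maps $\otimes 1:\mathcal T(m,n)\to\mathcal T(m+1,n+1)$ that preserve composition and involution. An *ideal* $\mathcal K$ in $\mathcal T$ is a family of closed subspaces $\mathcal K(m,n)\subset\mathcal T(m,n)$ absorbing composition on both sides (it is then self-adjoint). An ideal $\mathcal N$ is *invariant* if $\mathcal N\otimes 1\subset\mathcal N$, and then it is itself a right tensor $C^*$-precategory; it is *$\mathcal J$-saturated*, for an ideal $\mathcal J$, if $\mathcal J\cap(\otimes1)^{-1}(\mathcal N)\subset\mathcal N$. Put $J(\mathcal K)=\mathcal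 K\cap(\otimes 1)^{-1}(\mathcal K)$. A *right tensor representation* of an ideal $\mathcal K$ in a $C^*$-algebra $B$ is a family of linear maps $\pi_{nm}:\mathcal K(m,n)\to B$ with $\pi_{nm}(a)^*=\pi_{mn}(a^*)$, $\pi_{nm}(a)\pi_{ml}(b)=\pi_{nl}(ab)$ and $\pi_{nm}(a)\pi_{m+k,l}(b)=\pi_{n+k,l}((a\otimes1^k)b)$. It is *coisometric* on an ideal $\mathcal J\subset J(\mathcal K)$ if $\pi_{nm}(a)=\pi_{n+1,m+1}(a\otimes1)$ for all $a\in\mathcal J(m,n)$. Its kernel is $(\ker\pi)(m,n)=\ker\pi_{nm}$. It *admits a gauge action* if for every $z\in S^1$ there is a $*$-homomorphism $\beta_z$ of the $C^*$-algebra $C^*(\pi)$ generated by the ranges of all $\pi_{nm}$ into itself with $\beta_z(\pi_{nm}(a))=z^{n-m}\pi_{nm}(a)$. The *Doplicher–Roberts algebra* $\mathcal{DR}(\mathcal T)$ is the completion of the $\mathbb Z$-graded $*$-algebra $\bigoplus_{k\in\mathbb Z}\varinjlim_r\mathcal T(r,r+k)$ (limits along $\otimes 1$) in the unique $C^*$-norm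 for which the circle action defined by the grading is isometric. Let $i_{(n,m)}:\mathcal T(m,n)\to\mathcal{DR}(\mathcal T)$ be the canonical maps and $\gamma$ the *gauge action*, $\gamma_z(i_{(n,m)}(a))=z^{m-n}i_{(n,m)}(a)$. For an ideal $\mathcal N$ in $\mathcal T$ let $\mathcal O(\mathcal N)=\overline{\mathrm{span}}\{i_{(n,m)}(a):a\in\mathcal N(m,n),\ m,n\in\mathbb N\}$. A *gauge-invariant ideal* of $\mathcal{DR}(\mathcal T)$ is a closed two-sided ideal $P$ with $\gamma_z(P)\subset P$ for all $z\in S^1$. Let $\mathcal K,\mathcal J$ be ideals in $\mathcal T$ with $\mathcal J\subset J(\mathcal K)$. For $m,n\in\mathbb N$ let $\mathcal M(m,n)$ be the space of families $a=(a_{ij})$ with $a_{ij}\in\mathcal K(j,i)$ and $a_{ij}=0$ unless $i-j=n-m$ and $i\le n$. Families $a=(a_{ij})$ with finitely many nonzero entries are multiplied by $a\star b=a\cdot\sum_{k\ge0}\Lambda^k(b)+\sum_{k\ge1}\Lambda^k(a)\cdot b$, where $\cdot$ is the product of matrices, $\Lambda(a)_{i+1,j+1}=a_{ij}\otimes1$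 and the first row and column of $\Lambda(a)$ vanish; the involution is $(a^*)_{ij}=(a_{ji})^*$. On $\mathcal M(m,n)$ put $$\|a\|^{\mathcal J}=\max\Big\{\max_{s<n}\ \Big\|q_{\mathcal J}\Big(\sum_{i\le s}a_{i,i+m-n}\otimes1^{s-i}\Big)\Big\|,\ \Big\|\sum_{i\le n}a_{i,i+m-n}\otimes1^{n-i}\Big\|\Big\}$$ (indices with $i+m-n<0$ are omitted), $q_{\mathcal J}:\mathcal T\to\mathcal T/\mathcal J$ being the quotient map. The spaces $\mathcal K_{\mathcal J}(m,n)=\mathcal M(m,n)/\|\cdot\|^{\mathcal J}$ form a right tensor $C^*$-precategory $\mathcal K_{\mathcal J}$, whose right tensoring $\otimes_{\mathcal J}1$ is induced by the inclusions $\mathcal M(m,n)\subset\mathcal M(m+1,n+1)$. Put $\mathcal O_{\mathcal T}(\mathcal K,\mathcal J)=\mathcal{DR}(\mathcal K_{\mathcal J})$. **Theorem (lattice structure of gauge-invariant ideals in $\mathcal O_{\mathcal T}(\mathcal K,\mathcal J)$).** Let $\mathcal K,\mathcal J$ be ideals in a right tensor $C^*$-precategory $\mathcal T$ with $\mathcal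 J\subset J(\mathcal K)$. The canonical maps $\mathcal K(m,n)\to\mathcal K_{\mathcal J}(m,n)\to\mathcal{DR}(\mathcal K_{\mathcal J})$ make $\mathcal O_{\mathcal T}(\mathcal K,\mathcal J)=\mathcal{DR}(\mathcal K_{\mathcal J})$ the universal $C^*$-algebra for right tensor representations of $\mathcal K$ coisometric on $\mathcal J$ (they form such a representation, their ranges generate the algebra, and every such representation factors through them), and $i=\{i_{(n,m)}\}$ is likewise the universal right tensor representation of $\mathcal K_{\mathcal J}$ coisometric on $\mathcal K_{\mathcal J}$; let $\Psi_{\widetilde\pi}$ be the unique $*$-homomorphism on $\mathcal{DR}(\mathcal K_{\mathcal J})$ with $\Psi_{\widetilde\pi}\circ i_{(n,m)}=\widetilde\pi_{nm}$. There are inclusion-preserving one-to-one correspondences between 1. kernels of right tensor representations $\widetilde\pi$ of $\mathcal K_{\mathcal J}$ coisometric on $\mathcal K_{\mathcal J}$; 2. invariant and $\mathcal K_{\mathcal J}$-saturated ideals $\mathcal N_{\mathcal J}$ in $\mathcal K_{\mathcal J}$, that is, ideals with $\mathcal N_{\mathcal J}\otimes_{\mathcal J}1\subset\mathcal N_{\mathcal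 J}$ and $(\otimes_{\mathcal J}1)^{-1}(\mathcal N_{\mathcal J})\subset\mathcal N_{\mathcal J}$; 3. gauge-invariant ideals $P$ in $\mathcal O_{\mathcal T}(\mathcal K,\mathcal J)=\mathcal{DR}(\mathcal K_{\mathcal J})$. The families 1 and 2 coincide ($\mathcal N_{\mathcal J}=\ker\widetilde\pi$), and the correspondence between 2 and 3 is given by $$P=\mathcal O(\mathcal N_{\mathcal J}),\qquad \mathcal N_{\mathcal J}(m,n)=i_{(n,m)}^{-1}(P).$$ For every $\widetilde\pi$ as in 1, $\mathcal O(\ker\widetilde\pi)\subset\ker\Psi_{\widetilde\pi}$, with equality if and only if $\widetilde\pi$ admits a gauge action; and every $\mathcal N_{\mathcal J}$ as in 2 is the kernel of some $\widetilde\pi$ as in 1 that admits a gauge action, so that $\ker\Psi_{\widetilde\pi}=\mathcal O(\mathcal N_{\mathcal J})=P$. Moreover the maps $i_{(n,m)}(a)\mapsto i_{(n,m)}(a)$, $a\in\mathcal N_{\mathcal J}(m,n)$, define an isomorphism $\mathcal{DR}(\mathcal N_{\mathcal J})\cong P$. The families 2 and 3, ordered by inclusion, are lattices, and the correspondence is a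 lattice isomorphism. -/

import Mathlib

universe u v w

/-- A right tensor `C*`-precategory. The objects are the natural numbers, `Hom m n = T(m, n)` is the
Banach space of morphisms from `m` to `n` (no identities are required), `comp a b = ab`,
`adj a = a*`, and `tensor a = a ⊗ 1`. The axiom `adj_comp_self_pos` says that `a* a` is a positive
element of the `C*`-algebra `T(m, m)`; it is part of the usual definition of a `C*`-category, and
it holds as soon as there is a faithful representation on a Hilbert space. -/
structure RightTensorCStarPrecategory where
  Hom : ℕ → ℕ → Type u
  [normedAddCommGroup : ∀ n m, NormedAddCommGroup (Hom n m)]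
  [normedSpace : ∀ n m, NormedSpace ℂ (Hom n m)]
  [completeSpace : ∀ n m, CompleteSpace (Hom n m)]
  comp : ∀ {l m n : ℕ}, Hom m n →ₗ[ℂ] Hom l m →ₗ[ℂ] Hom l n
  comp_assoc : ∀ {k l m n : ℕ} (a : Hom m n) (b : Hom l m) (c : Hom k l),
    comp (comp a b) c = comp a (comp b c)
  norm_comp_le : ∀ {l m n : ℕ} (a : Hom m n) (b : Hom l m), ‖comp a b‖ ≤ ‖a‖ * ‖b‖
  adj : ∀ {m n : ℕ}, Hom m n →ₗ⋆[ℂ] Hom n m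
  adj_adj : ∀ {m n : ℕ} (a : Hom m n), adj (adj a) = a
  adj_comp : ∀ {l m n : ℕ} (a : Hom m n) (b : Hom l m), adj (comp a b) = comp (adj b) (adj a)
  norm_adj_comp_self : ∀ {m n : ℕ} (a : Hom m n), ‖comp (adj a) a‖ = ‖a‖ ^ 2
  adj_comp_self_pos : ∀ {m n : ℕ} (a : Hom m n), ∃ c : Hom m m, comp (adj a) a = comp (adj c) c
  tensor : ∀ {m n : ℕ}, Hom m n →ₗ[ℂ] Hom (m + 1) (n + 1)
  tensor_comp : ∀ {l m n : ℕ} (a : Hom m n) (b : Hom l m),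
    tensor (comp a b) = comp (tensor a) (tensor b)
  tensor_adj : ∀ {m n : ℕ} (a : Hom m n), tensor (adj a) = adj (tensor a)

namespace RightTensorCStarPrecategory

attribute [instance] normedAddCommGroup normedSpace completeSpace

noncomputable section

theorem norm_eq_of_cstar {E F G G' : Type*} [NormedAddCommGroup E]
    [NormedAddCommGroup F] [NormedAddCommGroup G] [NormedAddCommGroup G'] {a : E} {b : F} {c : G}
    {d : G'} (h1 : ‖a‖ ^ 2 ≤ ‖c‖) (h2 : ‖c‖ ≤ ‖b‖ * ‖a‖)
    (h3 : ‖b‖ ^ 2 ≤ ‖d‖) (h4 : ‖d‖ ≤ ‖a‖ * ‖b‖) : ‖b‖ = ‖a‖ ∧ ‖c‖ = ‖a‖ ^ 2 := by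
  have ha := norm_nonneg a
  have hb := norm_nonneg b
  have h : ‖b‖ = ‖a‖ := by
    rcases eq_or_lt_of_le ha with h | h
    · rw [← h] at h4 ⊢; nlinarith
    · have : ‖a‖ ≤ ‖b‖ := by nlinarith
      nlinarith
  refine ⟨h, le_antisymm ?_ h1⟩
  rw [h] at h2; nlinarith

/-- A Banach space with a `C*`-multiplication and involution, as a `C*`-algebra. -/
@[reducible] def mkCStarAlgebra {A : Type*} [NormedAddCommGroup A] [NormedSpace ℂ A]
    [CompleteSpace A] (mul : A →ₗ[ℂ] A →ₗ[ℂ] A) (adj : A →ₗ⋆[ℂ] A)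
    (assoc : ∀ a b c, mul (mul a b) c = mul a (mul b c)) (norm_mul : ∀ a b, ‖mul a b‖ ≤ ‖a‖ * ‖b‖)
    (adj_adj : ∀ a, adj (adj a) = a) (adj_mul : ∀ a b, adj (mul a b) = mul (adj b) (adj a))
    (norm_sq_le : ∀ a, ‖a‖ ^ 2 ≤ ‖mul (adj a) a‖) : NonUnitalCStarAlgebra A where
  mul a b := mul a b
  left_distrib a b c := map_add _ _ _
  right_distrib a b c := by
    change mul (a + b) c = mul a c + mul b c
    simp
  zero_mul a := by
    change mul 0 a = 0
    simp
  mul_zero a := map_zero _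
  mul_assoc a b c := assoc a b c
  norm_mul_le a b := norm_mul a b
  dist_eq := dist_eq_norm_neg_add
  star a := adj a
  star_involutive a := adj_adj a
  star_mul a b := adj_mul a b
  star_add a b := map_add _ _ _
  norm_mul_self_le a := by
    rw [← sq]
    exact norm_sq_le a
  smul_assoc c a b := by
    change mul (c • a) b = c • mul a b
    simp
  smul_comm c a b := by
    change c • mul a b = mul a (c • b)
    simp
  norm_smul_le := norm_smul_le
  smul_zero := smul_zero
  smul_add := smul_add
  add_smul := add_smul
  zero_smul := zero_smul ℂ
  star_smul c a := by
    change adj (c • a) = star c • adj a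
    simp
  complete := CompleteSpace.complete

theorem eq_zero_of_star_mul_self_add {A : Type*} [NonUnitalCStarAlgebra A] {c d : A}
    (h : star d * d = -(star c * c)) : star d * d = 0 := by
  let _ := CStarAlgebra.spectralOrder A
  let _ := CStarAlgebra.spectralOrderedRing A
  have h1 := star_mul_self_nonneg c
  have h2 := star_mul_self_nonneg d
  exact le_antisymm (by rw [h]; simp [h1]) h2

/-- A criterion for positivity of a self-adjoint element. -/
theorem exists_eq_star_mul_self {A : Type*} [NonUnitalCStarAlgebra A] {h : A}
    (hsa : IsSelfAdjoint h)
    (H : ∀ g c : A, star g * h * g = -(star c * c) → star g * h * g = 0) :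
    ∃ c, h = star c * c := by
  let _ := CStarAlgebra.spectralOrder A
  let _ := CStarAlgebra.spectralOrderedRing A
  have hn := CFC.negPart_nonneg h
  have hnsa : star h⁻ = h⁻ := hn.isSelfAdjoint
  obtain ⟨d, hd⟩ := CStarAlgebra.nonneg_iff_eq_star_mul_self.1 hn
  obtain ⟨c, hc⟩ := CStarAlgebra.nonneg_iff_eq_star_mul_self.1 (CFC.posPart_nonneg h)
  have e1 : star h⁻ * h * h⁻ = -(h⁻ * h⁻ * h⁻) := by
    nth_rewrite 2 [← CFC.posPart_sub_negPart h hsa]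
    rw [hnsa, mul_sub, sub_mul, mul_assoc, CFC.posPart_mul_negPart]
    simp
  have e2 : h⁻ * h⁻ * h⁻ = star (d * h⁻) * (d * h⁻) := by
    rw [star_mul, hnsa, mul_assoc, mul_assoc, ← mul_assoc (star d), ← hd]
  have e3 : h⁻ * h⁻ * h⁻ = 0 := by
    have := H h⁻ (d * h⁻) (by rw [e1, e2])
    rwa [e1, neg_eq_zero] at this
  have e4 : h⁻ = 0 := by
    have h5 : h⁻ * h⁻ = 0 := by
      rw [← CStarRing.star_mul_self_eq_zero_iff, star_mul, hnsa, ← mul_assoc, e3, zero_mul]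
    rw [← CStarRing.star_mul_self_eq_zero_iff, hnsa, h5]
  refine ⟨c, ?_⟩
  calc h = h⁺ - h⁻ := (CFC.posPart_sub_negPart h hsa).symm
    _ = star c * c := by rw [e4, sub_zero, hc]

section basic
variable (T : RightTensorCStarPrecategory.{u})

theorem norm_adj {m n : ℕ} (a : T.Hom m n) : ‖T.adj a‖ = ‖a‖ :=
  (norm_eq_of_cstar (T.norm_adj_comp_self a).ge (T.norm_comp_le _ _)
    (T.norm_adj_comp_self (T.adj a)).ge
    ((T.norm_comp_le _ _).trans_eq (by rw [T.adj_adj]))).1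

/-- Each `T(n, n)` is a `C*`-algebra. -/
@[reducible] def endCStarAlgebra (n : ℕ) : NonUnitalCStarAlgebra (T.Hom n n) :=
  mkCStarAlgebra T.comp T.adj T.comp_assoc T.norm_comp_le T.adj_adj T.adj_comp
    (fun a => (T.norm_adj_comp_self a).ge)

theorem norm_tensor_le {m n : ℕ} (a : T.Hom m n) : ‖T.tensor a‖ ≤ ‖a‖ := by
  let _ := T.endCStarAlgebra m
  let _ := T.endCStarAlgebra (m + 1)
  let φ : T.Hom m m →⋆ₙₐ[ℂ] T.Hom (m + 1) (m + 1) :=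
    { toFun := T.tensor
      map_smul' := fun c x => map_smul _ _ _
      map_zero' := map_zero _
      map_add' := map_add _
      map_mul' := fun x y => T.tensor_comp x y
      map_star' := fun x => T.tensor_adj x }
  have h := NonUnitalStarAlgHom.norm_apply_le φ (T.comp (T.adj a) a)
  have h' : ‖T.tensor a‖ ^ 2 ≤ ‖a‖ ^ 2 := by
    rw [← T.norm_adj_comp_self, ← T.norm_adj_comp_self a, ← T.tensor_adj, ← T.tensor_comp]
    exact h
  exact (sq_le_sq₀ (norm_nonneg _) (norm_nonneg _)).1 h'

end basic

/-- An approximate local unit in the ideal generated by `y* y`. -/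
theorem exists_approx {A : Type*} [NonUnitalCStarAlgebra A] (y : A) {ε : ℝ} (hε : 0 < ε) :
    ∃ (e g : A) (c : ℂ), star e = e ∧ e = c • (star y * y) + (star y * y) * g ∧
      (∀ z : A, ‖z - e * z‖ ≤ ‖z‖) ∧ (∀ z : A, ‖z - z * e‖ ≤ ‖z‖) ∧
      ‖(star y * y - e * (star y * y)) - (star y * y - e * (star y * y)) * e‖ ≤ ε := by
  let H : Unitization ℂ A := star (y : Unitization ℂ A) * y
  have hH : IsSelfAdjoint H := IsSelfAdjoint.star_mul_self _
  have hs : ∀ t ∈ spectrum ℝ H, 0 ≤ t := spectrum_star_mul_self_nonneg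
  let f : ℝ → ℝ := fun t => (t + ε)⁻¹
  have hf : ContinuousOn f (spectrum ℝ H) := by
    apply ContinuousOn.inv₀ (by fun_prop)
    intro t ht; have := hs t ht; positivity
  let F := cfc f H
  let e' : Unitization ℂ A := H * F
  have hFsa : IsSelfAdjoint F := cfc_predicate f H
  have hHF : H * F = F * H := by
    have := (cfc_commute_cfc (id : ℝ → ℝ) f H)
    rwa [cfc_id ℝ H] at this
  have he' : e' = cfc (fun t => t * f t) H := by
    have := cfc_mul (id : ℝ → ℝ) f H (by fun_prop) hf
    rw [cfc_id ℝ H] at this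
    exact this.symm
  have h1e : 1 - e' = cfc (fun t => ε * f t) H := by
    rw [he', ← cfc_one ℝ H, ← cfc_sub (1 : ℝ → ℝ) _ H (by fun_prop) (by fun_prop)]
    apply cfc_congr
    intro t ht
    have := hs t ht
    have h0 : t + ε ≠ 0 := by positivity
    simp only [f, Pi.one_apply]
    field_simp
    ring
  have hn1 : ‖1 - e'‖ ≤ 1 := by
    rw [h1e]
    apply norm_cfc_le (by norm_num)
    intro t ht
    have := hs t ht
    have h0 : 0 < t + ε := by positivity
    simp only [f]
    rw [Real.norm_of_nonneg (by positivity), ← div_eq_mul_inv, div_le_one h0]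
    linarith
  have hn2 : ‖(1 - e') * H‖ ≤ ε := by
    have : (1 - e') * H = cfc (fun t => ε * f t * t) H := by
      have := cfc_mul (fun t => ε * f t) (id : ℝ → ℝ) H (by fun_prop) (by fun_prop)
      rw [cfc_id ℝ H, ← h1e] at this
      exact this.symm
    rw [this]
    apply norm_cfc_le hε.le
    intro t ht
    have := hs t ht
    have h0 : 0 < t + ε := by positivity
    simp only [f]
    rw [Real.norm_of_nonneg (by positivity), mul_assoc]
    have : (t + ε)⁻¹ * t ≤ 1 := by
      rw [inv_mul_le_iff₀ h0]; linarith
    nlinarith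
  have he'sa : star e' = e' := by
    rw [he']; exact cfc_predicate (R := ℝ) (p := IsSelfAdjoint) _ H
  set h : A := star y * y with hh
  have hHh : H = (h : Unitization ℂ A) := by simp [H, hh]
  let e : A := F.fst • h + h * F.snd
  have hee : (e : Unitization ℂ A) = e' := by
    have hF : F = Unitization.inl F.fst + (F.snd : Unitization ℂ A) :=
      (Unitization.inl_fst_add_inr_snd_eq F).symm
    change _ = H * F
    rw [hHh, hF, mul_add, Unitization.inr_mul_inl, ← Unitization.inr_mul]
    simp [e]
  have key1 : ∀ z : A, ((z - e * z : A) : Unitization ℂ A) = (1 - e') * z := by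
    intro z; rw [sub_mul, one_mul, ← hee]; simp
  have key2 : ∀ z : A, ((z - z * e : A) : Unitization ℂ A) = z * (1 - e') := by
    intro z; rw [mul_sub, mul_one, ← hee]; simp
  have b1 : ∀ z : A, ‖z - e * z‖ ≤ ‖z‖ := fun z => by
    rw [← Unitization.norm_inr (𝕜 := ℂ), key1]
    refine (norm_mul_le _ _).trans ?_
    rw [Unitization.norm_inr]
    nlinarith [norm_nonneg z]
  have b2 : ∀ z : A, ‖z - z * e‖ ≤ ‖z‖ := fun z => by
    rw [← Unitization.norm_inr (𝕜 := ℂ), key2]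
    refine (norm_mul_le _ _).trans ?_
    rw [Unitization.norm_inr]
    nlinarith [norm_nonneg z]
  refine ⟨e, F.snd, F.fst, ?_, rfl, b1, b2, ?_⟩
  · apply Unitization.inr_injective (R := ℂ)
    rw [Unitization.inr_star, hee, he'sa]
  · refine (b2 _).trans ?_
    rw [← Unitization.norm_inr (𝕜 := ℂ), key1, ← hHh]
    exact hn2

/-- A closed two-sided ideal in a `C*`-precategory: a family of closed subspaces
`N(m, n) ⊆ T(m, n)` which absorbs composition on both sides. Closure under the involution is
automatic, see `adj_mem`. -/
@[ext] structure Ideal (T : RightTensorCStarPrecategory.{u}) where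
  carrier : ∀ m n : ℕ, Submodule ℂ (T.Hom m n)
  isClosed : ∀ m n : ℕ, IsClosed (carrier m n : Set (T.Hom m n))
  comp_left : ∀ {l m n : ℕ} (a : T.Hom m n) {b : T.Hom l m},
    b ∈ carrier l m → T.comp a b ∈ carrier l n
  comp_right : ∀ {l m n : ℕ} {a : T.Hom m n} (b : T.Hom l m),
    a ∈ carrier m n → T.comp a b ∈ carrier l n

namespace Ideal

variable {T : RightTensorCStarPrecategory.{u}}

/-- Inclusion of ideals. -/
instance : PartialOrder T.Ideal where
  le N N' := ∀ m n, N.carrier m n ≤ N'.carrier m n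
  le_refl N m n := le_rfl
  le_trans N N' N'' h h' m n := (h m n).trans (h' m n)
  le_antisymm N N' h h' := Ideal.ext (funext fun m => funext fun n => le_antisymm (h m n) (h' m n))

/-- The improper ideal `T` of `T`. -/
instance : Top T.Ideal where
  top := ⟨fun _ _ => ⊤, fun _ _ => isClosed_univ, fun _ _ _ => trivial, fun _ _ => trivial⟩

theorem exists_approx (N : T.Ideal) {m : ℕ} {y : T.Hom m m}
    (hy : T.comp (T.adj y) y ∈ N.carrier m m) {ε : ℝ} (hε : 0 < ε) :
    ∃ e ∈ N.carrier m m, (∀ (n : ℕ) (a : T.Hom m n), ‖a - T.comp a e‖ ^ 2 ≤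
      ‖(T.comp (T.adj a) a - T.comp e (T.comp (T.adj a) a)) -
        T.comp (T.comp (T.adj a) a - T.comp e (T.comp (T.adj a) a)) e‖) ∧
      (∀ z : T.Hom m m, ‖z - T.comp e z‖ ≤ ‖z‖) ∧ (∀ z : T.Hom m m, ‖z - T.comp z e‖ ≤ ‖z‖) ∧
      ‖(T.comp (T.adj y) y - T.comp e (T.comp (T.adj y) y)) -
        T.comp (T.comp (T.adj y) y - T.comp e (T.comp (T.adj y) y)) e‖ ≤ ε := by
  let _ := T.endCStarAlgebra m
  obtain ⟨e, g, c, he, heq, h1, h2, h3⟩ := RightTensorCStarPrecategory.exists_approx y hε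
  refine ⟨e, ?_, ?_, h1, h2, h3⟩
  · rw [heq]
    exact add_mem (Submodule.smul_mem _ _ hy) (N.comp_right _ hy)
  · intro n a
    have he' : T.adj e = e := he
    rw [← T.norm_adj_comp_self]
    apply le_of_eq
    congr 1
    simp only [map_sub, T.adj_comp, he', LinearMap.sub_apply, T.comp_assoc]

theorem mem_of_adj_comp_self (N : T.Ideal) {m n : ℕ} {a : T.Hom m n}
    (ha : T.comp (T.adj a) a ∈ N.carrier m m) : a ∈ N.carrier m n := by
  obtain ⟨c, hc⟩ := T.adj_comp_self_pos a
  have hcl := N.isClosed m n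
  rw [← SetLike.mem_coe, ← hcl.closure_eq, Metric.mem_closure_iff]
  intro ε hε
  obtain ⟨e, heN, h1, -, -, h2⟩ := N.exists_approx (y := c) (hc ▸ ha) (ε := ε ^ 2 / 2) (by positivity)
  refine ⟨T.comp a e, N.comp_left _ heN, ?_⟩
  rw [dist_eq_norm]
  have h3 : _ ≤ ε ^ 2 / 2 := (h1 n a).trans (by rw [hc]; exact h2)
  have : ‖a - T.comp a e‖ ^ 2 < ε ^ 2 := by nlinarith
  exact lt_of_pow_lt_pow_left₀ 2 hε.le this

/-- Ideals are self-adjoint. -/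
theorem adj_mem (N : T.Ideal) {m n : ℕ} {a : T.Hom m n} (ha : a ∈ N.carrier m n) :
    T.adj a ∈ N.carrier n m :=
  N.mem_of_adj_comp_self (N.comp_right _ (by rwa [T.adj_adj]))

/-- `N` is invariant: `N ⊗ 1 ⊆ N`. -/
def Invariant (N : T.Ideal) : Prop :=
  ∀ ⦃m n : ℕ⦄ ⦃a : T.Hom m n⦄, a ∈ N.carrier m n → T.tensor a ∈ N.carrier (m + 1) (n + 1)

/-- `N` is `J`-saturated: `J ∩ (⊗ 1)⁻¹(N) ⊆ N`. -/
def Saturated (N J : T.Ideal) : Prop :=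
  ∀ ⦃m n : ℕ⦄ ⦃a : T.Hom m n⦄, a ∈ J.carrier m n → T.tensor a ∈ N.carrier (m + 1) (n + 1) →
    a ∈ N.carrier m n

/-- An invariant ideal, as a right tensor `C*`-precategory in its own right. -/
def toPrecategory (N : T.Ideal) (hN : N.Invariant) : RightTensorCStarPrecategory.{u} where
  Hom m n := N.carrier m n
  completeSpace m n := (N.isClosed m n).completeSpace_coe
  comp {l m n} := LinearMap.mk₂ ℂ
    (fun a b => ⟨T.comp (a : T.Hom m n) (b : T.Hom l m), N.comp_left _ b.2⟩)
    (fun _ _ _ => Subtype.ext (by simp)) (fun _ _ _ => Subtype.ext (by simp))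
    (fun _ _ _ => Subtype.ext (by simp)) (fun _ _ _ => Subtype.ext (by simp))
  comp_assoc a b c := Subtype.ext (T.comp_assoc _ _ _)
  norm_comp_le a b := T.norm_comp_le _ _
  adj {m n} :=
    { toFun := fun a => ⟨T.adj (a : T.Hom m n), N.adj_mem a.2⟩
      map_add' := fun _ _ => Subtype.ext (by simp)
      map_smul' := fun _ _ => Subtype.ext (by simp) }
  adj_adj a := Subtype.ext (T.adj_adj _)
  adj_comp a b := Subtype.ext (T.adj_comp _ _)
  norm_adj_comp_self a := T.norm_adj_comp_self _
  adj_comp_self_pos {m n} a := by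
    obtain ⟨c, hc⟩ := T.adj_comp_self_pos (a : T.Hom m n)
    exact ⟨⟨c, N.mem_of_adj_comp_self (hc ▸ N.comp_left _ a.2)⟩, Subtype.ext hc⟩
  tensor {m n} :=
    { toFun := fun a => ⟨T.tensor (a : T.Hom m n), hN a.2⟩
      map_add' := fun _ _ => Subtype.ext (by simp)
      map_smul' := fun _ _ => Subtype.ext (by simp) }
  tensor_comp a b := Subtype.ext (T.tensor_comp _ _)
  tensor_adj a := Subtype.ext (T.tensor_adj _)

instance (N : T.Ideal) (m n : ℕ) : IsClosed (N.carrier m n : Set (T.Hom m n)) := N.isClosed m n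

/-- Composition in the quotient. -/
def quotComp (N : T.Ideal) {l m n : ℕ} : (T.Hom m n ⧸ N.carrier m n) →ₗ[ℂ]
    (T.Hom l m ⧸ N.carrier l m) →ₗ[ℂ] (T.Hom l n ⧸ N.carrier l n) :=
  (N.carrier m n).liftQ
    { toFun := fun a => (N.carrier l m).mapQ (N.carrier l n) (T.comp a)
        (fun _ hb => N.comp_left a hb)
      map_add' := fun a a' => by
        ext b
        simp
      map_smul' := fun c a => by
        ext b
        simp }
    (fun a ha => by
      rw [LinearMap.mem_ker]
      ext b
      simpa using N.comp_right b ha)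

/-- Involution in the quotient. -/
def quotAdj (N : T.Ideal) {m n : ℕ} :
    (T.Hom m n ⧸ N.carrier m n) →ₗ⋆[ℂ] (T.Hom n m ⧸ N.carrier n m) :=
  (N.carrier m n).mapQ (N.carrier n m) T.adj (fun _ ha => N.adj_mem ha)

theorem quot_norm_sq_le (N : T.Ideal) {m n : ℕ} (a : T.Hom m n) :
    ‖(Submodule.Quotient.mk a : T.Hom m n ⧸ N.carrier m n)‖ ^ 2 ≤
      ‖(Submodule.Quotient.mk (T.comp (T.adj a) a) : T.Hom m m ⧸ N.carrier m m)‖ := by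
  apply le_of_forall_pos_le_add
  intro ε hε
  obtain ⟨w, hw, hwn⟩ := Submodule.Quotient.norm_mk_lt
    (Submodule.Quotient.mk (T.comp (T.adj a) a) : T.Hom m m ⧸ N.carrier m m) (half_pos hε)
  set z := T.comp (T.adj a) a with hz
  have hy : z - w ∈ N.carrier m m := by
    rw [← Submodule.Quotient.mk_eq_zero, Submodule.Quotient.mk_sub, hw, sub_self]
  set y := z - w with hydef
  obtain ⟨e, heN, h1, h2, h3, h4⟩ := N.exists_approx (y := y) (N.comp_left _ hy)
    (ε := (ε / 2) ^ 2) (by positivity)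
  have hye : ‖y - T.comp y e‖ ≤ ε / 2 :=
    (sq_le_sq₀ (norm_nonneg _) (by positivity)).1 ((h1 m y).trans h4)
  have hd : (z - T.comp e z) - T.comp (z - T.comp e z) e =
      ((w - T.comp e w) - T.comp (w - T.comp e w) e) +
        ((y - T.comp y e) - T.comp e (y - T.comp y e)) := by
    have : z = w + y := by rw [hydef]; abel
    rw [this]
    simp only [map_add, map_sub, LinearMap.add_apply, LinearMap.sub_apply, T.comp_assoc]
    abel
  have hq : (Submodule.Quotient.mk a : T.Hom m n ⧸ N.carrier m n) =
      Submodule.Quotient.mk (a - T.comp a e) := by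
    rw [Submodule.Quotient.eq]
    simpa using N.comp_left a heN
  calc ‖(Submodule.Quotient.mk a : T.Hom m n ⧸ N.carrier m n)‖ ^ 2
      ≤ ‖a - T.comp a e‖ ^ 2 := by
        rw [hq]; gcongr; exact Submodule.Quotient.norm_mk_le _ _
    _ ≤ ‖((w - T.comp e w) - T.comp (w - T.comp e w) e) +
        ((y - T.comp y e) - T.comp e (y - T.comp y e))‖ := by rw [← hd]; exact h1 n a
    _ ≤ ‖w‖ + ‖y - T.comp y e‖ :=
        (norm_add_le _ _).trans (add_le_add ((h3 _).trans (h2 _)) (h2 _))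
    _ ≤ _ := by linarith

theorem quot_norm_comp_le (N : T.Ideal) {l m n : ℕ} (a : T.Hom m n ⧸ N.carrier m n)
    (b : T.Hom l m ⧸ N.carrier l m) : ‖N.quotComp a b‖ ≤ ‖a‖ * ‖b‖ := by
  apply le_of_forall_pos_le_add
  intro ε hε
  have : Filter.Tendsto (fun δ : ℝ => (‖a‖ + δ) * (‖b‖ + δ)) (nhdsWithin 0 (Set.Ioi 0))
      (nhds (‖a‖ * ‖b‖)) := by
    have : Continuous (fun δ : ℝ => (‖a‖ + δ) * (‖b‖ + δ)) := by fun_prop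
    simpa using (this.tendsto 0).mono_left nhdsWithin_le_nhds
  obtain ⟨δ, h1, h2⟩ := ((this.eventually_lt_const
    (show ‖a‖ * ‖b‖ < ‖a‖ * ‖b‖ + ε by linarith)).and self_mem_nhdsWithin).exists
  obtain ⟨x, rfl, hx⟩ := Submodule.Quotient.norm_mk_lt a h2
  obtain ⟨y, rfl, hy⟩ := Submodule.Quotient.norm_mk_lt b h2
  calc _ ≤ ‖T.comp x y‖ := Submodule.Quotient.norm_mk_le _ _
    _ ≤ ‖x‖ * ‖y‖ := T.norm_comp_le _ _
    _ ≤ _ := by gcongr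
    _ ≤ _ := h1.le

/-- The quotient right tensor `C*`-precategory `T / N` by an invariant ideal, with quotient norms. -/
def quotient (N : T.Ideal) (hN : N.Invariant) : RightTensorCStarPrecategory.{u} where
  Hom m n := T.Hom m n ⧸ N.carrier m n
  comp := N.quotComp
  comp_assoc a b c := by
    induction a using Submodule.Quotient.induction_on
    induction b using Submodule.Quotient.induction_on
    induction c using Submodule.Quotient.induction_on
    exact congrArg Submodule.Quotient.mk (T.comp_assoc _ _ _)
  norm_comp_le := N.quot_norm_comp_le
  adj := N.quotAdj
  adj_adj a := by
    induction a using Submodule.Quotient.induction_on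
    exact congrArg Submodule.Quotient.mk (T.adj_adj _)
  adj_comp a b := by
    induction a using Submodule.Quotient.induction_on
    induction b using Submodule.Quotient.induction_on
    exact congrArg Submodule.Quotient.mk (T.adj_comp _ _)
  norm_adj_comp_self {m n} a := by
    induction a using Submodule.Quotient.induction_on with
    | H a =>
    have h2 := N.quot_norm_sq_le (T.adj a)
    have h4 := N.quot_norm_comp_le (Submodule.Quotient.mk (T.adj (T.adj a)))
      (Submodule.Quotient.mk (T.adj a))
    rw [T.adj_adj] at h2 h4
    exact (norm_eq_of_cstar (N.quot_norm_sq_le a) (N.quot_norm_comp_le (Submodule.Quotient.mk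
      (T.adj a)) (Submodule.Quotient.mk a)) h2 h4).2
  adj_comp_self_pos a := by
    induction a using Submodule.Quotient.induction_on with
    | H a =>
    obtain ⟨c, hc⟩ := T.adj_comp_self_pos a
    exact ⟨Submodule.Quotient.mk c, congrArg Submodule.Quotient.mk hc⟩
  tensor {m n} := (N.carrier m n).mapQ (N.carrier (m + 1) (n + 1)) T.tensor (fun _ ha => hN ha)
  tensor_comp a b := by
    induction a using Submodule.Quotient.induction_on
    induction b using Submodule.Quotient.induction_on
    exact congrArg Submodule.Quotient.mk (T.tensor_comp _ _)
  tensor_adj a := by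
    induction a using Submodule.Quotient.induction_on
    exact congrArg Submodule.Quotient.mk (T.tensor_adj _)

end Ideal

section matrices
variable {T : RightTensorCStarPrecategory.{u}}

open scoped ENNReal

variable (T) in
/-- Bounded infinite matrices with `(i, j)` entry in `T(j, i)`, with the supremum norm. -/
abbrev BddMatrix : Type u := lp (fun p : ℕ × ℕ => T.Hom p.2 p.1) ∞

theorem BddMatrix.norm_apply_le (b : T.BddMatrix) (i j : ℕ) : ‖b (i, j)‖ ≤ ‖b‖ :=
  lp.norm_apply_le_norm ENNReal.top_ne_zero b (i, j)

theorem BddMatrix.continuous_apply (i j : ℕ) : Continuous fun b : T.BddMatrix => b (i, j) :=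
  (lp.lipschitzWith_one_eval ∞ ((i, j) : ℕ × ℕ)).continuous

/-- The space `M(m, n)` of the matrix algebra `M_T(K)`. Its elements are the finite families
`a = (a_{ij})`, `a_{ij} ∈ K(j, i)`, supported on the part of the diagonal through `(n, m)` that
ends at `(n, m)`; that is, `a_{ij} = 0` unless `i + m = j + n` and `i ≤ n`. Such an `a` is recorded
here through the matrix `b = ∑ₖ Λᵏ(a)` of its partial sums,
`b_{ij} = ∑_{k ≤ min(i, j)} a_{i - k, j - k} ⊗ 1ᵏ`, from which `a` is recovered by
`a_{0 j} = b_{0 j}`, `a_{i 0} = b_{i 0}` and `a_{i+1, j+1} = b_{i+1, j+1} - b_{ij} ⊗ 1`. Under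
`a ↦ b` the product `a ⋆ b = a · ∑_{k ≥ 0} Λᵏ(b) + ∑_{k ≥ 1} Λᵏ(a) · b` becomes the usual product
of matrices. The norm is the largest norm of a partial sum. -/
def diagMatrices (K : T.Ideal) (m n : ℕ) : Submodule ℂ T.BddMatrix where
  carrier := {b | (∀ i j, i + m ≠ j + n → b (i, j) = 0) ∧
    (∀ j, b (0, j) ∈ K.carrier j 0) ∧ (∀ i, b (i, 0) ∈ K.carrier 0 i) ∧
    (∀ i j, b (i + 1, j + 1) - T.tensor (b (i, j)) ∈ K.carrier (j + 1) (i + 1)) ∧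
    ∀ i j, n ≤ i → b (i + 1, j + 1) = T.tensor (b (i, j))}
  add_mem' {b c} hb hc := by
    refine ⟨fun i j h => ?_, fun j => ?_, fun i => ?_, fun i j => ?_, fun i j h => ?_⟩
    · change b (i, j) + c (i, j) = 0
      rw [hb.1 i j h, hc.1 i j h, add_zero]
    · exact add_mem (hb.2.1 j) (hc.2.1 j)
    · exact add_mem (hb.2.2.1 i) (hc.2.2.1 i)
    · change b (i + 1, j + 1) + c (i + 1, j + 1) - T.tensor (b (i, j) + c (i, j)) ∈ _
      rw [map_add, add_sub_add_comm]
      exact add_mem (hb.2.2.2.1 i j) (hc.2.2.2.1 i j)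
    · change b (i + 1, j + 1) + c (i + 1, j + 1) = T.tensor (b (i, j) + c (i, j))
      rw [map_add, hb.2.2.2.2 i j h, hc.2.2.2.2 i j h]
  zero_mem' := by
    refine ⟨fun _ _ _ => rfl, fun j => zero_mem _, fun i => zero_mem _, fun i j => ?_,
      fun i j _ => ?_⟩
    · change (0 : T.Hom (j + 1) (i + 1)) - T.tensor (0 : T.Hom j i) ∈ _
      simp
    · change (0 : T.Hom (j + 1) (i + 1)) = T.tensor (0 : T.Hom j i)
      simp
  smul_mem' s b hb := by
    refine ⟨fun i j h => ?_, fun j => ?_, fun i => ?_, fun i j => ?_, fun i j h => ?_⟩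
    · change s • b (i, j) = 0
      rw [hb.1 i j h, smul_zero]
    · exact Submodule.smul_mem _ s (hb.2.1 j)
    · exact Submodule.smul_mem _ s (hb.2.2.1 i)
    · change s • b (i + 1, j + 1) - T.tensor (s • b (i, j)) ∈ _
      rw [map_smul, ← smul_sub]
      exact Submodule.smul_mem _ s (hb.2.2.2.1 i j)
    · change s • b (i + 1, j + 1) = T.tensor (s • b (i, j))
      rw [map_smul, hb.2.2.2.2 i j h]

theorem continuous_tensor {m n : ℕ} : Continuous (T.tensor : T.Hom m n →ₗ[ℂ] _) :=
  AddMonoidHomClass.continuous_of_bound T.tensor 1 (fun a => by simpa using T.norm_tensor_le a)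

theorem isClosed_diagMatrices (K : T.Ideal) (m n : ℕ) :
    IsClosed (diagMatrices K m n : Set T.BddMatrix) := by
  have hc := fun i j => BddMatrix.continuous_apply (T := T) i j
  change IsClosed {b : T.BddMatrix | _ ∧ _ ∧ _ ∧ _ ∧ _}
  simp only [Set.ofPred_and, Set.ofPred_forall]
  refine IsClosed.inter ?_ (IsClosed.inter ?_ (IsClosed.inter ?_ (IsClosed.inter ?_ ?_)))
  · exact isClosed_iInter fun i => isClosed_iInter fun j => isClosed_iInter fun _ =>
      isClosed_eq (hc i j) continuous_const
  · exact isClosed_iInter fun j => (K.isClosed j 0).preimage (hc 0 j)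
  · exact isClosed_iInter fun i => (K.isClosed 0 i).preimage (hc i 0)
  · exact isClosed_iInter fun i => isClosed_iInter fun j =>
      (K.isClosed (j + 1) (i + 1)).preimage ((hc _ _).sub (continuous_tensor.comp (hc i j)))
  · exact isClosed_iInter fun i => isClosed_iInter fun j => isClosed_iInter fun _ =>
      isClosed_eq (hc _ _) (continuous_tensor.comp (hc i j))

theorem diagMatrices_ext {K : T.Ideal} {m n : ℕ} {b c : diagMatrices K m n}
    (h : ∀ i j, i + m = j + n → b.1 (i, j) = c.1 (i, j)) : b = c := by
  refine Subtype.ext (lp.ext (funext fun p => ?_))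
  by_cases hp : p.1 + m = p.2 + n
  · exact h p.1 p.2 hp
  · exact (b.2.1 p.1 p.2 hp).trans (c.2.1 p.1 p.2 hp).symm

theorem diagMatrices_norm_le {K : T.Ideal} {m n : ℕ} {b : diagMatrices K m n} {C : ℝ} (hC : 0 ≤ C)
    (h : ∀ i j, i + m = j + n → ‖b.1 (i, j)‖ ≤ C) : ‖b‖ ≤ C := by
  refine lp.norm_le_of_forall_le hC fun p => ?_
  by_cases hp : p.1 + m = p.2 + n
  · exact h p.1 p.2 hp
  · have h0 : b.1 p = 0 := b.2.1 p.1 p.2 hp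
    exact (congrArg norm h0).trans_le (norm_zero.trans_le hC)

/-- The matrix product of `M(m, n)` and `M(l, m)`. -/
def diagMul (K : T.Ideal) {l m n : ℕ} (b : diagMatrices K m n) (c : diagMatrices K l m) :
    diagMatrices K l n :=
  ⟨⟨fun p => T.comp (b.1 (p.1, p.1 + m - n)) (c.1 (p.1 + m - n, p.2)), memℓp_infty
      ⟨‖b‖ * ‖c‖, by
        rintro _ ⟨p, rfl⟩
        exact (T.norm_comp_le _ _).trans (mul_le_mul (BddMatrix.norm_apply_le b.1 _ _)
          (BddMatrix.norm_apply_le c.1 _ _) (norm_nonneg _) (norm_nonneg _))⟩⟩, by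
    have hb0 : ∀ {i : ℕ}, i + m < n → b.1 (i, i + m - n) = 0 := fun {i} h =>
      b.2.1 _ _ (by omega)
    refine ⟨fun i j h => ?_, fun j => ?_, fun i => ?_, fun i j => ?_, fun i j h => ?_⟩
    · change T.comp (b.1 (i, i + m - n)) (c.1 (i + m - n, j)) = 0
      rcases lt_or_ge (i + m) n with h' | h'
      · rw [hb0 h']; simp
      · rw [c.2.1 _ _ (by omega), map_zero]
    · change T.comp (b.1 (0, 0 + m - n)) (c.1 (0 + m - n, j)) ∈ _
      exact K.comp_right _ (b.2.2.1 _)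
    · change T.comp (b.1 (i, i + m - n)) (c.1 (i + m - n, 0)) ∈ _
      exact K.comp_left _ (c.2.2.2.1 _)
    · change T.comp (b.1 (i + 1, i + 1 + m - n)) (c.1 (i + 1 + m - n, j + 1)) -
        T.tensor (T.comp (b.1 (i, i + m - n)) (c.1 (i + m - n, j))) ∈ _
      rcases lt_or_ge (i + m) n with h' | h'
      · rw [hb0 h']
        have : i + 1 + m - n = 0 := by omega
        rw [this]
        simpa using K.comp_right _ (b.2.2.2.1 _)
      · obtain ⟨k, hk⟩ : ∃ k, k = i + m - n := ⟨_, rfl⟩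
        have : i + 1 + m - n = k + 1 := by omega
        rw [this, ← hk, T.tensor_comp]
        have e : T.comp (b.1 (i + 1, k + 1)) (c.1 (k + 1, j + 1)) -
            T.comp (T.tensor (b.1 (i, k))) (T.tensor (c.1 (k, j))) =
            T.comp (b.1 (i + 1, k + 1) - T.tensor (b.1 (i, k))) (c.1 (k + 1, j + 1)) +
            T.comp (T.tensor (b.1 (i, k))) (c.1 (k + 1, j + 1) - T.tensor (c.1 (k, j))) := by
          simp only [map_sub, LinearMap.sub_apply]; abel
        rw [e]
        exact add_mem (K.comp_right _ (b.2.2.2.2.1 i k)) (K.comp_left _ (c.2.2.2.2.1 k j))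
    · change T.comp (b.1 (i + 1, i + 1 + m - n)) (c.1 (i + 1 + m - n, j + 1)) =
        T.tensor (T.comp (b.1 (i, i + m - n)) (c.1 (i + m - n, j)))
      obtain ⟨k, hk⟩ : ∃ k, k = i + m - n := ⟨_, rfl⟩
      have : i + 1 + m - n = k + 1 := by omega
      rw [this, ← hk, T.tensor_comp, b.2.2.2.2.2 i k h, c.2.2.2.2.2 k j (by omega)]⟩

theorem diagMul_apply (K : T.Ideal) {l m n : ℕ} (b : diagMatrices K m n)
    (c : diagMatrices K l m) (i j : ℕ) : (diagMul K b c).1 (i, j) =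
      T.comp (b.1 (i, i + m - n)) (c.1 (i + m - n, j)) := rfl

theorem diagMul_apply' (K : T.Ideal) {l m n : ℕ} (b : diagMatrices K m n)
    (c : diagMatrices K l m) {i k : ℕ} (h : i + m = k + n) (j : ℕ) : (diagMul K b c).1 (i, j) =
      T.comp (b.1 (i, k)) (c.1 (k, j)) := by
  have : i + m - n = k := by omega
  rw [diagMul_apply, this]

theorem diagMul_apply_zero (K : T.Ideal) {l m n : ℕ} (b : diagMatrices K m n)
    (c : diagMatrices K l m) {i : ℕ} (h : i + m < n) (j : ℕ) : (diagMul K b c).1 (i, j) = 0 := by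
  rw [diagMul_apply, b.2.1 _ _ (by omega)]
  simp

/-- The adjoint matrix. -/
def diagAdj (K : T.Ideal) {m n : ℕ} (b : diagMatrices K m n) : diagMatrices K n m :=
  ⟨⟨fun p => T.adj (b.1 (p.2, p.1)), memℓp_infty
      ⟨‖b‖, by
        rintro _ ⟨p, rfl⟩
        exact (T.norm_adj _).trans_le (BddMatrix.norm_apply_le b.1 _ _)⟩⟩, by
    refine ⟨fun i j h => ?_, fun j => K.adj_mem (b.2.2.2.1 j), fun i => K.adj_mem (b.2.2.1 i),
      fun i j => ?_, fun i j h => ?_⟩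
    · change T.adj (b.1 (j, i)) = 0
      rw [b.2.1 _ _ (by omega), map_zero]
    · change T.adj (b.1 (j + 1, i + 1)) - T.tensor (T.adj (b.1 (j, i))) ∈ _
      rw [T.tensor_adj, ← map_sub]
      exact K.adj_mem (b.2.2.2.2.1 j i)
    · change T.adj (b.1 (j + 1, i + 1)) = T.tensor (T.adj (b.1 (j, i)))
      rw [T.tensor_adj]
      rcases le_or_gt n j with h' | h'
      · rw [b.2.2.2.2.2 j i h']
      · rw [b.2.1 _ _ (by omega), b.2.1 _ _ (by omega)]
        simp⟩

theorem diagAdj_apply (K : T.Ideal) {m n : ℕ} (b : diagMatrices K m n) (i j : ℕ) :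
    (diagAdj K b).1 (i, j) = T.adj (b.1 (j, i)) := rfl

/-- The matrix product as a bilinear map. -/
def diagComp (K : T.Ideal) {l m n : ℕ} :
    diagMatrices K m n →ₗ[ℂ] diagMatrices K l m →ₗ[ℂ] diagMatrices K l n :=
  LinearMap.mk₂ ℂ (diagMul K)
    (fun b b' c => diagMatrices_ext fun i j _ => by
      simp [diagMul_apply])
    (fun s b c => diagMatrices_ext fun i j _ => by
      simp [diagMul_apply])
    (fun b c c' => diagMatrices_ext fun i j _ => by
      simp [diagMul_apply])
    (fun s b c => diagMatrices_ext fun i j _ => by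
      simp [diagMul_apply])

/-- The adjoint matrix as a conjugate-linear map. -/
def diagStar (K : T.Ideal) {m n : ℕ} : diagMatrices K m n →ₗ⋆[ℂ] diagMatrices K n m where
  toFun := diagAdj K
  map_add' b c := diagMatrices_ext fun i j _ => by
    simp [diagAdj_apply]
  map_smul' s b := diagMatrices_ext fun i j _ => by
    simp [diagAdj_apply]

theorem diagComp_assoc (K : T.Ideal) {k l m n : ℕ} (a : diagMatrices K m n)
    (b : diagMatrices K l m) (c : diagMatrices K k l) :
    diagComp K (diagComp K a b) c = diagComp K a (diagComp K b c) := by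
  refine diagMatrices_ext fun i j _ => ?_
  change (diagMul K (diagMul K a b) c).1 (i, j) = (diagMul K a (diagMul K b c)).1 (i, j)
  rcases lt_or_ge (i + m) n with h | h
  · rw [diagMul_apply_zero K a _ h, diagMul_apply, diagMul_apply_zero K a _ h]
    simp
  · obtain ⟨p, hp⟩ : ∃ p, i + m = p + n := ⟨i + m - n, by omega⟩
    rw [diagMul_apply' K a _ hp]
    rcases lt_or_ge (i + l) n with h' | h'
    · rw [diagMul_apply_zero K b c (by omega), diagMul_apply,
        (diagMul K a b).2.1 _ _ (by omega)]
      simp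
    · obtain ⟨q, hq⟩ : ∃ q, i + l = q + n := ⟨i + l - n, by omega⟩
      rw [diagMul_apply' K b c (show p + l = q + m by omega), diagMul_apply' K _ c hq,
        diagMul_apply' K a b hp, T.comp_assoc]

theorem diagComp_norm_le (K : T.Ideal) {l m n : ℕ} (b : diagMatrices K m n)
    (c : diagMatrices K l m) : ‖diagComp K b c‖ ≤ ‖b‖ * ‖c‖ :=
  diagMatrices_norm_le (by positivity) fun _ _ _ =>
    (T.norm_comp_le _ _).trans (mul_le_mul (BddMatrix.norm_apply_le b.1 _ _)
      (BddMatrix.norm_apply_le c.1 _ _) (norm_nonneg _) (norm_nonneg _))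

theorem diagStar_diagStar (K : T.Ideal) {m n : ℕ} (b : diagMatrices K m n) :
    diagStar K (diagStar K b) = b :=
  diagMatrices_ext fun _ _ _ => T.adj_adj _

theorem diagStar_comp (K : T.Ideal) {l m n : ℕ} (b : diagMatrices K m n)
    (c : diagMatrices K l m) :
    diagStar K (diagComp K b c) = diagComp K (diagStar K c) (diagStar K b) := by
  refine diagMatrices_ext fun i j h => ?_
  change T.adj ((diagMul K b c).1 (j, i)) =
    (diagMul K (diagAdj K c) (diagAdj K b)).1 (i, j)
  rcases lt_or_ge (j + m) n with h' | h'
  · rw [diagMul_apply_zero K b c h', diagMul_apply_zero K _ _ (by omega), map_zero]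
  · obtain ⟨p, hp⟩ : ∃ p, j + m = p + n := ⟨j + m - n, by omega⟩
    rw [diagMul_apply' K b c hp, diagMul_apply' K _ _ (show i + m = p + l by omega), T.adj_comp]
    rfl

theorem diagComp_self_apply (K : T.Ideal) {m n : ℕ} (b : diagMatrices K m n) {i j : ℕ}
    (h : i + m = j + n) : (diagComp K (diagStar K b) b).1 (j, j) =
      T.comp (T.adj (b.1 (i, j))) (b.1 (i, j)) :=
  diagMul_apply' K (diagAdj K b) b h.symm j

theorem diag_norm_sq_le (K : T.Ideal) {m n : ℕ} (b : diagMatrices K m n) :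
    ‖b‖ ^ 2 ≤ ‖diagComp K (diagStar K b) b‖ := by
  have : ‖b‖ ≤ √‖diagComp K (diagStar K b) b‖ := by
    refine diagMatrices_norm_le (Real.sqrt_nonneg _) fun i j h => ?_
    apply Real.le_sqrt_of_sq_le
    rw [← T.norm_adj_comp_self, ← diagComp_self_apply K b h]
    exact BddMatrix.norm_apply_le (diagComp K (diagStar K b) b).1 j j
  calc ‖b‖ ^ 2 ≤ √‖diagComp K (diagStar K b) b‖ ^ 2 := by gcongr
    _ = _ := Real.sq_sqrt (norm_nonneg _)

/-- The family `M(m, n)` as a right tensor `C*`-precategory, with the tensoring given by the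
inclusions `M(m, n) ⊆ M(m + 1, n + 1)`. -/
def matrixPrecategory (K : T.Ideal) : RightTensorCStarPrecategory.{u} where
  Hom m n := diagMatrices K m n
  completeSpace m n := (isClosed_diagMatrices K m n).completeSpace_coe
  comp := diagComp K
  comp_assoc := diagComp_assoc K
  norm_comp_le := diagComp_norm_le K
  adj := diagStar K
  adj_adj := diagStar_diagStar K
  adj_comp := diagStar_comp K
  norm_adj_comp_self b := by
    have h2 := diag_norm_sq_le K (diagStar K b)
    have h4 := diagComp_norm_le K (diagStar K (diagStar K b)) (diagStar K b)
    rw [diagStar_diagStar] at h2 h4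
    exact (norm_eq_of_cstar (diag_norm_sq_le K b) (diagComp_norm_le K _ _) h2 h4).2
  adj_comp_self_pos {m n} b := by
    have : CompleteSpace (diagMatrices K m m) := (isClosed_diagMatrices K m m).completeSpace_coe
    let _ : NonUnitalCStarAlgebra (diagMatrices K m m) :=
      mkCStarAlgebra (diagComp K) (diagStar K) (diagComp_assoc K) (diagComp_norm_le K)
        (diagStar_diagStar K) (diagStar_comp K) (diag_norm_sq_le K)
    refine exists_eq_star_mul_self ?_ fun g c h => ?_
    · change diagStar K _ = _
      rw [diagStar_comp, diagStar_diagStar]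
    · have e : star g * diagComp K (diagStar K b) b * g =
          diagComp K (diagStar K (diagComp K b g)) (diagComp K b g) := by
        change diagComp K (diagComp K (diagStar K g) (diagComp K (diagStar K b) b)) g = _
        rw [diagStar_comp]
        simp only [diagComp_assoc]
      rw [e] at h ⊢
      refine diagMatrices_ext fun j j' hj => ?_
      obtain rfl : j = j' := by omega
      have h1 : (diagComp K (diagStar K (diagComp K b g)) (diagComp K b g)).1 (j, j) =
          -(diagComp K (diagStar K c) c).1 (j, j) :=
        congrArg (fun x : diagMatrices K m m => x.1 (j, j)) h
      rw [diagComp_self_apply K c rfl] at h1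
      let _ := T.endCStarAlgebra j
      rcases lt_or_ge (j + n) m with hlt | hge
      · change (diagMul K _ _).1 (j, j) = 0
        exact diagMul_apply_zero K _ _ hlt j
      · obtain ⟨i, hi⟩ : ∃ i, i + m = j + n := ⟨j + n - m, by omega⟩
        rw [diagComp_self_apply K _ hi] at h1 ⊢
        obtain ⟨d, hd⟩ := T.adj_comp_self_pos ((diagComp K b g).1 (i, j))
        rw [hd] at h1 ⊢
        exact eq_zero_of_star_mul_self_add (A := T.Hom j j) h1
  tensor {m n} :=
    { toFun := fun b => ⟨b.1, fun i j h => b.2.1 i j (by omega), b.2.2.1, b.2.2.2.1, b.2.2.2.2.1,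
        fun i j h => b.2.2.2.2.2 i j (by omega)⟩
      map_add' := fun _ _ => rfl
      map_smul' := fun _ _ => rfl }
  tensor_comp {l m n} b c := by
    refine diagMatrices_ext fun i j _ => ?_
    change T.comp (b.1 (i, i + m - n)) (c.1 (i + m - n, j)) =
      T.comp (b.1 (i, i + (m + 1) - (n + 1))) (c.1 (i + (m + 1) - (n + 1), j))
    have : i + (m + 1) - (n + 1) = i + m - n := by omega
    rw [this]
  tensor_adj b := rfl

/-- The kernel of the seminorm `‖·‖^J` on the spaces `M(m, n)`, where `‖a‖^J` is the maximum of the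
norms of the partial sums `b_{ij}` with `i < n` modulo `J` and of the norm of `b_{nm}`: the partial
sums with `i < n` belong to `J`, and `b_{nm} = 0` (equivalently, all later ones vanish). -/
def nullIdeal (K J : T.Ideal) : (matrixPrecategory K).Ideal where
  carrier m n :=
    { carrier := {b | (∀ i j, i < n → b.1 (i, j) ∈ J.carrier j i) ∧
        ∀ i j, n ≤ i → b.1 (i, j) = 0}
      add_mem' := fun {b c} hb hc =>
        ⟨fun i j h => add_mem (hb.1 i j h) (hc.1 i j h), fun i j h => by
          rw [show (b + c).1 (i, j) = b.1 (i, j) + c.1 (i, j) from rfl, hb.2 i j h, hc.2 i j h,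
            add_zero]⟩
      zero_mem' := ⟨fun _ _ _ => zero_mem _, fun _ _ _ => rfl⟩
      smul_mem' := fun s b hb =>
        ⟨fun i j h => Submodule.smul_mem _ s (hb.1 i j h), fun i j h => by
          rw [show (s • b).1 (i, j) = s • b.1 (i, j) from rfl, hb.2 i j h, smul_zero]⟩ }
  isClosed m n := by
    have hc : ∀ i j, Continuous fun b : diagMatrices K m n => b.1 (i, j) :=
      fun i j => (BddMatrix.continuous_apply i j).comp continuous_subtype_val
    change IsClosed {b : diagMatrices K m n | _ ∧ _}
    simp only [Set.ofPred_and, Set.ofPred_forall]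
    refine IsClosed.inter ?_ ?_
    · exact isClosed_iInter fun i => isClosed_iInter fun j => isClosed_iInter fun _ =>
        (J.isClosed j i).preimage (hc i j)
    · exact isClosed_iInter fun i => isClosed_iInter fun j => isClosed_iInter fun _ =>
        isClosed_eq (hc i j) continuous_const
  comp_left {l m n} a b hb := by
    have ha : ∀ {i j : ℕ}, i + m ≠ j + n → a.1 (i, j) = 0 := fun h => a.2.1 _ _ h
    refine ⟨fun i j h => ?_, fun i j h => ?_⟩
    · change T.comp (a.1 (i, i + m - n)) (b.1 (i + m - n, j)) ∈ _
      rcases lt_or_ge (i + m) n with h' | h'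
      · rw [ha (by omega)]; simp
      · exact J.comp_left _ (hb.1 _ _ (by omega))
    · change T.comp (a.1 (i, i + m - n)) (b.1 (i + m - n, j)) = 0
      rw [hb.2 _ _ (by omega), map_zero]
  comp_right {l m n} a b ha := by
    refine ⟨fun i j h => J.comp_right _ (ha.1 _ _ h), fun i j h => ?_⟩
    change T.comp (a.1 (i, i + m - n)) (b.1 (i + m - n, j)) = 0
    rw [ha.2 _ _ h]; simp

theorem nullIdeal_invariant (K J : T.Ideal) : (nullIdeal K J).Invariant := by
  intro m n b hb
  refine ⟨fun i j h => ?_, fun i j h => hb.2 i j (by omega)⟩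
  rcases lt_or_ge i n with h' | h'
  · exact hb.1 i j h'
  · change b.1 (i, j) ∈ _
    rw [hb.2 i j h']
    exact zero_mem _

/-- The right tensor `C*`-precategory `K_J = M(m, n) / ‖·‖^J`. The norm induced by `‖·‖^J` on the
quotient by its kernel is a complete norm satisfying the `C*`-identity, so it is the
quotient norm. -/
def relPrecategory (K J : T.Ideal) : RightTensorCStarPrecategory.{u} :=
  (nullIdeal K J).quotient (nullIdeal_invariant K J)

end matrices

section completion
open UniformSpace UniformSpace.Completion

theorem norm_fromCompletion_le {A E : Type*} [SeminormedAddCommGroup A] [NormedSpace ℂ A]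
    [SeminormedAddCommGroup E] [NormedSpace ℂ E] [CompleteSpace E] [T0Space E] {f : A →L[ℂ] E} {C : ℝ}
    (hf : ∀ a, ‖f a‖ ≤ C * ‖a‖) (a : Completion A) : ‖f.fromCompletion a‖ ≤ C * ‖a‖ := by
  induction a using Completion.induction_on with
  | hp => exact isClosed_le (by fun_prop) (by fun_prop)
  | ih a => simpa using hf a

variable {A : Type u} [SeminormedAddCommGroup A] [NormedSpace ℂ A]

/-- The product of a `*`-algebra with a submultiplicative seminorm, with values in the
completion. -/
def preComplMul (mul : A →ₗ[ℂ] A →ₗ[ℂ] A) (h : ∀ a b, ‖mul a b‖ ≤ ‖a‖ * ‖b‖) :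
    A →L[ℂ] A →L[ℂ] Completion A :=
  (mul.compr₂ (toComplₗᵢ (𝕜 := ℂ) (E := A)).toLinearMap).mkContinuous₂ 1 fun a b => by
    simpa using h a b

/-- The product on the completion of a `*`-algebra `A` with a submultiplicative seminorm. -/
def complMul (mul : A →ₗ[ℂ] A →ₗ[ℂ] A) (h : ∀ a b, ‖mul a b‖ ≤ ‖a‖ * ‖b‖) :
    Completion A →ₗ[ℂ] Completion A →ₗ[ℂ] Completion A :=
  LinearMap.mk₂ ℂ (fun a b => ((preComplMul mul h).fromCompletion a).fromCompletion b)
    (fun a a' b => by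
      rw [ContinuousLinearMap.fromCompletion_unique _
        (((preComplMul mul h).fromCompletion a).fromCompletion +
          ((preComplMul mul h).fromCompletion a').fromCompletion) (by simp)]
      simp)
    (fun c a b => by
      rw [ContinuousLinearMap.fromCompletion_unique _
        (c • ((preComplMul mul h).fromCompletion a).fromCompletion) (by simp)]
      simp)
    (fun a b b' => map_add _ _ _) (fun c a b => map_smul _ _ _)

variable (mul : A →ₗ[ℂ] A →ₗ[ℂ] A) (hmul : ∀ a b, ‖mul a b‖ ≤ ‖a‖ * ‖b‖)

theorem complMul_coe (a b : A) : complMul mul hmul a b = (mul a b : A) := by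
  simp [complMul, preComplMul]

theorem norm_complMul_le (a b : Completion A) : ‖complMul mul hmul a b‖ ≤ ‖a‖ * ‖b‖ := by
  have h1 : ∀ a : A, ‖preComplMul mul hmul a‖ ≤ 1 * ‖a‖ := fun a => by
    rw [one_mul]
    refine ContinuousLinearMap.opNorm_le_bound _ (norm_nonneg _) fun b => ?_
    simpa [preComplMul] using hmul a b
  refine norm_fromCompletion_le (fun b => ?_) b
  refine (ContinuousLinearMap.le_opNorm _ _).trans ?_
  have := norm_fromCompletion_le (E := A →L[ℂ] Completion A) h1 a
  rw [one_mul] at this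
  gcongr

theorem continuous_complMul :
    Continuous fun p : Completion A × Completion A => complMul mul hmul p.1 p.2 :=
  ((complMul mul hmul).mkContinuous₂ 1 fun a b => by
    simpa using norm_complMul_le mul hmul a b).continuous₂

variable (adj : A →ₗ⋆[ℂ] A) (hadj : ∀ a, ‖adj a‖ ≤ ‖a‖)

/-- The involution on the completion. -/
def complAdj : Completion A →L⋆[ℂ] Completion A :=
  (adj.mkContinuous 1 fun a => by simpa using hadj a).completion

theorem complAdj_coe (a : A) : complAdj adj hadj a = (adj a : A) := by
  simp [complAdj]

theorem continuous_complMul_comp {X : Type*} [TopologicalSpace X] {f g : X → Completion A}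
    (hf : Continuous f) (hg : Continuous g) :
    Continuous fun x => complMul mul hmul (f x) (g x) := by
  have h := continuous_complMul mul hmul
  generalize complMul mul hmul = M at *
  exact h.comp (hf.prodMk hg)

theorem complMul_assoc (assoc : ∀ a b c, mul (mul a b) c = mul a (mul b c))
    (a b c : Completion A) : complMul mul hmul (complMul mul hmul a b) c =
      complMul mul hmul a (complMul mul hmul b c) := by
  have hc := @continuous_complMul_comp A _ _ mul hmul
  refine Completion.induction_on₃ a b c ?_ fun a b c => by simp only [complMul_coe, assoc]
  exact isClosed_eq (hc (hc (by fun_prop) (by fun_prop)) (by fun_prop))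
    (hc (by fun_prop) (hc (by fun_prop) (by fun_prop)))

theorem complAdj_complAdj (adj_adj : ∀ a, adj (adj a) = a) (a : Completion A) :
    complAdj adj hadj (complAdj adj hadj a) = a := by
  refine Completion.induction_on a ?_ fun a => by simp only [complAdj_coe, adj_adj]
  exact isClosed_eq (by fun_prop) continuous_id

theorem complAdj_complMul (adj_mul : ∀ a b, adj (mul a b) = mul (adj b) (adj a))
    (a b : Completion A) : complAdj adj hadj (complMul mul hmul a b) =
      complMul mul hmul (complAdj adj hadj b) (complAdj adj hadj a) := by
  have hc := @continuous_complMul_comp A _ _ mul hmul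
  refine Completion.induction_on₂ a b ?_ fun a b => by simp only [complMul_coe, complAdj_coe, adj_mul]
  exact isClosed_eq ((complAdj adj hadj).continuous.comp (hc (by fun_prop) (by fun_prop)))
    (hc (by fun_prop) (by fun_prop))

theorem compl_norm_sq_le (norm_sq_le : ∀ a, ‖a‖ ^ 2 ≤ ‖mul (adj a) a‖) (a : Completion A) :
    ‖a‖ ^ 2 ≤ ‖complMul mul hmul (complAdj adj hadj a) a‖ := by
  have hc := @continuous_complMul_comp A _ _ mul hmul
  refine Completion.induction_on a ?_ fun a => by
    simp only [complMul_coe, complAdj_coe, Completion.norm_coe, norm_sq_le]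
  exact isClosed_le (by fun_prop) (hc (by fun_prop) (by fun_prop)).norm

/-- The completion of a `*`-algebra in a `C*`-seminorm. -/
@[reducible] def complCStarAlgebra (assoc : ∀ a b c, mul (mul a b) c = mul a (mul b c))
    (adj_adj : ∀ a, adj (adj a) = a) (adj_mul : ∀ a b, adj (mul a b) = mul (adj b) (adj a))
    (norm_sq_le : ∀ a, ‖a‖ ^ 2 ≤ ‖mul (adj a) a‖) : NonUnitalCStarAlgebra (Completion A) :=
  mkCStarAlgebra (complMul mul hmul) (complAdj adj hadj).toLinearMap
    (complMul_assoc mul hmul assoc) (norm_complMul_le mul hmul)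
    (complAdj_complAdj adj hadj adj_adj) (complAdj_complMul mul hmul adj hadj adj_mul)
    (compl_norm_sq_le mul hmul adj hadj norm_sq_le)

end completion

section doplicherRoberts
variable (T : RightTensorCStarPrecategory.{u})

/-- A matrix `x` with entries `x i j ∈ T(j, i)` is stable from `r` on if it is supported on the
diagonals at distance at most `r` from the main one, and `x_{i+1, j+1} = x_{ij} ⊗ 1` for
`i, j ≥ r`. -/
def IsStable {T : RightTensorCStarPrecategory.{u}} (x : ∀ i j : ℕ, T.Hom j i) (r : ℕ) : Prop :=
  (∀ i j, j + r < i → x i j = 0) ∧ (∀ i j, i + r < j → x i j = 0) ∧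
    ∀ i j, r ≤ i → r ≤ j → x (i + 1) (j + 1) = T.tensor (x i j)

variable {T}

theorem IsStable.mono {x : ∀ i j : ℕ, T.Hom j i} {r s : ℕ} (h : IsStable x r) (hrs : r ≤ s) :
    IsStable x s :=
  ⟨fun i j hij => h.1 i j (by omega), fun i j hij => h.2.1 i j (by omega),
    fun i j hi hj => h.2.2 i j (by omega) (by omega)⟩

theorem IsStable.add {x y : ∀ i j : ℕ, T.Hom j i} {r s : ℕ} (hx : IsStable x r)
    (hy : IsStable y s) : IsStable (x + y) (r + s) := by
  have h1 := hx.mono (show r ≤ r + s by omega)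
  have h2 := hy.mono (show s ≤ r + s by omega)
  refine ⟨fun i j h => ?_, fun i j h => ?_, fun i j hi hj => ?_⟩
  · simp [h1.1 i j h, h2.1 i j h]
  · simp [h1.2.1 i j h, h2.2.1 i j h]
  · simp [h1.2.2 i j hi hj, h2.2.2 i j hi hj]

theorem IsStable.smul {x : ∀ i j : ℕ, T.Hom j i} {r : ℕ} (hx : IsStable x r) (c : ℂ) :
    IsStable (c • x) r := by
  refine ⟨fun i j h => ?_, fun i j h => ?_, fun i j hi hj => ?_⟩
  · simp [hx.1 i j h]
  · simp [hx.2.1 i j h]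
  · simp [hx.2.2 i j hi hj]

theorem isStable_zero : IsStable (0 : ∀ i j : ℕ, T.Hom j i) 0 := by
  refine ⟨fun i j h => rfl, fun i j h => rfl, fun i j hi hj => ?_⟩
  simp

/-- The product of matrices. -/
def matMul (x y : ∀ i j : ℕ, T.Hom j i) (i j : ℕ) : T.Hom j i :=
  ∑ᶠ k, T.comp (x i k) (y k j)

theorem matMul_eq_left {x y : ∀ i j : ℕ, T.Hom j i} {r : ℕ} (hx : IsStable x r) {i j N : ℕ}
    (h : i + r < N) : matMul x y i j = ∑ k ∈ Finset.range N, T.comp (x i k) (y k j) := by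
  apply finsum_eq_sum_of_support_subset
  intro k hk
  rw [Finset.coe_range, Set.mem_Iio]
  by_contra hN
  apply hk
  change T.comp (x i k) (y k j) = 0
  rw [hx.2.1 i k (by omega)]
  simp

theorem matMul_eq_right {x y : ∀ i j : ℕ, T.Hom j i} {r : ℕ} (hy : IsStable y r) {i j N : ℕ}
    (h : j + r < N) : matMul x y i j = ∑ k ∈ Finset.range N, T.comp (x i k) (y k j) := by
  apply finsum_eq_sum_of_support_subset
  intro k hk
  rw [Finset.coe_range, Set.mem_Iio]
  by_contra hN
  apply hk
  change T.comp (x i k) (y k j) = 0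
  rw [hy.1 k j (by omega)]
  simp

theorem IsStable.matMul {x y : ∀ i j : ℕ, T.Hom j i} {r s : ℕ} (hx : IsStable x r)
    (hy : IsStable y s) : IsStable (matMul x y) (r + s + r + s) := by
  refine ⟨fun i j h => ?_, fun i j h => ?_, fun i j hi hj => ?_⟩
  · rw [matMul_eq_left hx (Nat.lt_succ_self _)]
    refine Finset.sum_eq_zero fun k _ => ?_
    rcases lt_or_ge (k + r) i with h' | h'
    · rw [hx.1 i k h']; simp
    · rw [hy.1 k j (by omega)]; simp
  · rw [matMul_eq_left hx (Nat.lt_succ_self _)]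
    refine Finset.sum_eq_zero fun k _ => ?_
    rcases lt_or_ge (i + r) k with h' | h'
    · rw [hx.2.1 i k h']; simp
    · rw [hy.2.1 k j (by omega)]; simp
  · rw [matMul_eq_left hx (show i + 1 + r < i + r + 1 + 1 by omega), Finset.sum_range_succ',
      matMul_eq_left hx (Nat.lt_succ_self _), map_sum]
    rcases Nat.eq_zero_or_pos (r + s) with h0 | h0
    · obtain rfl : r = 0 := by omega
      obtain rfl : s = 0 := by omega
      rw [hx.1 (i + 1) 0 (by omega)]
      simp only [map_zero, LinearMap.zero_apply, add_zero]
      refine Finset.sum_congr rfl fun k _ => ?_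
      rw [hx.2.2 i k (by omega) (by omega), hy.2.2 k j (by omega) (by omega), T.tensor_comp]
    · rw [hx.1 (i + 1) 0 (by omega)]
      simp only [map_zero, LinearMap.zero_apply, add_zero]
      refine Finset.sum_congr rfl fun k _ => ?_
      rw [T.tensor_comp]
      rcases lt_or_ge (k + r) i with h' | h'
      · rw [hx.1 i k h', hx.1 (i + 1) (k + 1) (by omega)]
        simp
      · rw [hx.2.2 i k (by omega) (by omega), hy.2.2 k j (by omega) (by omega)]

theorem matMul_assoc {x y z : ∀ i j : ℕ, T.Hom j i} {r s t : ℕ} (hx : IsStable x r)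
    (hy : IsStable y s) (hz : IsStable z t) :
    matMul (matMul x y) z = matMul x (matMul y z) := by
  funext i j
  have hN : ∃ N, N = i + j + (r + s + r + s) + (s + t + s + t) + 1 := ⟨_, rfl⟩
  obtain ⟨N, hN⟩ := hN
  rw [matMul_eq_left (hx.matMul hy) (show _ < N by omega),
    matMul_eq_left hx (show _ < N by omega)]
  have h1 : ∀ k, matMul x y i k = ∑ l ∈ Finset.range N, T.comp (x i l) (y l k) := fun k =>
    matMul_eq_left hx (by omega)
  have h2 : ∀ k, matMul y z k j = ∑ l ∈ Finset.range N, T.comp (y k l) (z l j) := fun k =>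
    matMul_eq_right hz (by omega)
  simp only [h1, h2, map_sum, LinearMap.sum_apply]
  rw [Finset.sum_comm]
  simp only [T.comp_assoc]

/-- The adjoint matrix. -/
def matAdj (x : ∀ i j : ℕ, T.Hom j i) (i j : ℕ) : T.Hom j i := T.adj (x j i)

theorem IsStable.matAdj {x : ∀ i j : ℕ, T.Hom j i} {r : ℕ} (hx : IsStable x r) :
    IsStable (matAdj x) r := by
  refine ⟨fun i j h => ?_, fun i j h => ?_, fun i j hi hj => ?_⟩
  · change T.adj (x j i) = 0
    rw [hx.2.1 j i h, map_zero]
  · change T.adj (x j i) = 0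
    rw [hx.1 j i h, map_zero]
  · change T.adj _ = T.tensor (T.adj _)
    rw [hx.2.2 j i hj hi, T.tensor_adj]

theorem matAdj_matMul {x y : ∀ i j : ℕ, T.Hom j i} {r s : ℕ} (hx : IsStable x r)
    (hy : IsStable y s) : matAdj (matMul x y) = matMul (matAdj y) (matAdj x) := by
  funext i j
  have hN : ∃ N, N = i + j + r + s + 1 := ⟨_, rfl⟩
  obtain ⟨N, hN⟩ := hN
  rw [matMul_eq_left hy.matAdj (show _ < N by omega)]
  change T.adj (matMul x y j i) = _
  rw [matMul_eq_left hx (show _ < N by omega), map_sum]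
  simp only [T.adj_comp]
  rfl

variable (T)

/-- The space of matrices that are stable from some `r` on. -/
def stableMatrices : Submodule ℂ (∀ i j : ℕ, T.Hom j i) where
  carrier := {x | ∃ r, IsStable x r}
  add_mem' := fun ⟨_, hx⟩ ⟨_, hy⟩ => ⟨_, hx.add hy⟩
  zero_mem' := ⟨0, isStable_zero⟩
  smul_mem' c _ := fun ⟨r, hx⟩ => ⟨r, hx.smul c⟩

/-- The `*`-algebra of stable matrices. The `k`-th diagonal of a stable matrix is, eventually, a
sequence `a, a ⊗ 1, a ⊗ 1², …`; modulo matrices with finitely many entries, this `*`-algebra is the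
algebraic direct sum over `k ∈ ℤ` of the algebraic inductive limits of
`T(r, r + k) → T(r + 1, r + k + 1) → …`. -/
def PreDR : Type u := stableMatrices T

instance : AddCommGroup (PreDR T) := inferInstanceAs (AddCommGroup (stableMatrices T))
instance : Module ℂ (PreDR T) := inferInstanceAs (Module ℂ (stableMatrices T))

variable {T}

namespace PreDR

/-- A stable matrix as an element of `PreDR T`. -/
def mk (x : ∀ i j : ℕ, T.Hom j i) (h : ∃ r, IsStable x r) : PreDR T := (⟨x, h⟩ : stableMatrices T)

/-- The entries of an element of `PreDR T`. -/
def mat (x : PreDR T) : ∀ i j : ℕ, T.Hom j i := (show stableMatrices T from x).1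

theorem stable (x : PreDR T) : ∃ r, IsStable x.mat r := (show stableMatrices T from x).2

@[simp] theorem mat_mk (x : ∀ i j : ℕ, T.Hom j i) (h : ∃ r, IsStable x r) : (mk x h).mat = x := rfl

theorem ext {x y : PreDR T} (h : ∀ i j, x.mat i j = y.mat i j) : x = y :=
  Subtype.ext (funext fun i => funext fun j => h i j)

@[simp] theorem add_mat (x y : PreDR T) (i j : ℕ) : (x + y).mat i j = x.mat i j + y.mat i j := rfl
@[simp] theorem smul_mat (c : ℂ) (x : PreDR T) (i j : ℕ) : (c • x).mat i j = c • x.mat i j := rfl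

end PreDR

/-- The product in `PreDR T`: the product of matrices. -/
def preMul : PreDR T →ₗ[ℂ] PreDR T →ₗ[ℂ] PreDR T :=
  LinearMap.mk₂ ℂ (fun x y => PreDR.mk (matMul x.mat y.mat) (by
      obtain ⟨r, hr⟩ := x.stable
      obtain ⟨s, hs⟩ := y.stable
      exact ⟨_, hr.matMul hs⟩))
    (fun x x' y => PreDR.ext fun i j => by
      obtain ⟨r, hr⟩ := y.stable
      simp only [PreDR.add_mat, PreDR.mat_mk]
      simp only [matMul_eq_right hr (Nat.lt_succ_self (j + r)), ← Finset.sum_add_distrib]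
      simp)
    (fun c x y => PreDR.ext fun i j => by
      obtain ⟨r, hr⟩ := y.stable
      simp only [PreDR.smul_mat, PreDR.mat_mk]
      simp only [matMul_eq_right hr (Nat.lt_succ_self (j + r)), Finset.smul_sum]
      simp)
    (fun x y y' => PreDR.ext fun i j => by
      obtain ⟨r, hr⟩ := x.stable
      simp only [PreDR.add_mat, PreDR.mat_mk]
      simp only [matMul_eq_left hr (Nat.lt_succ_self (i + r)), ← Finset.sum_add_distrib]
      simp)
    (fun c x y => PreDR.ext fun i j => by
      obtain ⟨r, hr⟩ := x.stable
      simp only [PreDR.smul_mat, PreDR.mat_mk]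
      simp only [matMul_eq_left hr (Nat.lt_succ_self (i + r)), Finset.smul_sum]
      simp)

@[simp] theorem mat_preMul (x y : PreDR T) : (preMul x y).mat = matMul x.mat y.mat := rfl

/-- The involution in `PreDR T`: the adjoint matrix. -/
def preAdj : PreDR T →ₗ⋆[ℂ] PreDR T where
  toFun x := PreDR.mk (matAdj x.mat) (by
    obtain ⟨r, hr⟩ := x.stable
    exact ⟨_, hr.matAdj⟩)
  map_add' x y := PreDR.ext fun i j => map_add T.adj _ _
  map_smul' c x := PreDR.ext fun i j => by
    change T.adj (c • x.mat j i) = star c • T.adj (x.mat j i)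
    simp

@[simp] theorem mat_preAdj (x : PreDR T) : (preAdj x).mat = matAdj x.mat := rfl

theorem preMul_assoc (x y z : PreDR T) :
    preMul (preMul x y) z = preMul x (preMul y z) := by
  obtain ⟨r, hr⟩ := x.stable
  obtain ⟨s, hs⟩ := y.stable
  obtain ⟨t, ht⟩ := z.stable
  exact Subtype.ext (matMul_assoc hr hs ht)

theorem preAdj_preAdj (x : PreDR T) : preAdj (preAdj x) = x :=
  PreDR.ext fun _ _ => T.adj_adj _

theorem preAdj_preMul (x y : PreDR T) :
    preAdj (preMul x y) = preMul (preAdj y) (preAdj x) := by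
  obtain ⟨r, hr⟩ := x.stable
  obtain ⟨s, hs⟩ := y.stable
  exact Subtype.ext (matAdj_matMul hr hs)

/-- The circle action defined by the grading. -/
def preGauge (z : Circle) : PreDR T →ₗ[ℂ] PreDR T where
  toFun x := PreDR.mk (fun i j => ((z : ℂ) ^ ((j : ℤ) - (i : ℤ))) • x.mat i j) (by
    obtain ⟨r, h⟩ := x.stable
    refine ⟨r, fun i j hij => ?_, fun i j hij => ?_, fun i j hi hj => ?_⟩
    · beta_reduce
      rw [h.1 i j hij, smul_zero]
    · beta_reduce
      rw [h.2.1 i j hij, smul_zero]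
    · beta_reduce
      rw [h.2.2 i j hi hj, map_smul]
      congr 2
      push_cast
      ring)
  map_add' x y := PreDR.ext fun i j => smul_add _ _ _
  map_smul' c x := PreDR.ext fun i j => smul_comm _ _ _

@[simp] theorem mat_preGauge (z : Circle) (x : PreDR T) (i j : ℕ) :
    (preGauge z x).mat i j = ((z : ℂ) ^ ((j : ℤ) - (i : ℤ))) • x.mat i j := rfl

theorem preGauge_preMul (z : Circle) (x y : PreDR T) :
    preGauge z (preMul x y) = preMul (preGauge z x) (preGauge z y) := by
  obtain ⟨r, hr⟩ := x.stable
  obtain ⟨s, hs⟩ := (preGauge z x).stable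
  refine PreDR.ext fun i j => ?_
  rw [mat_preGauge, mat_preMul, mat_preMul, matMul_eq_left hr (show i + r < i + r + s + 1 by omega),
    matMul_eq_left hs (show i + s < i + r + s + 1 by omega), Finset.smul_sum]
  refine Finset.sum_congr rfl fun k _ => ?_
  rw [mat_preGauge, mat_preGauge, map_smul, map_smul, LinearMap.smul_apply, smul_smul,
    ← zpow_add₀ z.coe_ne_zero]
  congr 2
  ring

theorem preGauge_preAdj (z : Circle) (x : PreDR T) :
    preGauge z (preAdj x) = preAdj (preGauge z x) := by
  refine PreDR.ext fun i j => ?_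
  rw [mat_preGauge]
  change _ • T.adj (x.mat j i) = T.adj ((preGauge z x).mat j i)
  rw [mat_preGauge, LinearMap.map_smulₛₗ, map_zpow₀, ← Circle.coe_inv_eq_conj, Circle.coe_inv,
    inv_zpow', neg_sub]

/-- `C*`-seminorms on the graded `*`-algebra `PreDR T` that are invariant under the circle action
given by the grading, and that are dominated by the sum over the diagonals of the norms in the
inductive limits (`le_row`: a row beyond `2 * r` of a matrix that is stable from `r` on meets every
nonzero diagonal once, in the stable range). In particular they vanish on matrices with finitely
many entries. -/
structure IsAdmissible (p : Seminorm ℂ (PreDR T)) : Prop where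
  mul_le : ∀ x y, p (preMul x y) ≤ p x * p y
  adj_mul_self : ∀ x, p (preMul (preAdj x) x) = p x ^ 2
  gauge : ∀ (z : Circle) (x), p (preGauge z x) = p x
  le_row : ∀ (x : PreDR T) (r : ℕ), IsStable x.mat r → ∀ i, 2 * r ≤ i → p x ≤ ∑ᶠ j, ‖x.mat i j‖

variable (T) in
theorem bddAbove_admissible : BddAbove {p : Seminorm ℂ (PreDR T) | IsAdmissible p} := by
  rw [Seminorm.bddAbove_iff, bddAbove_pi]
  intro x
  obtain ⟨r, hr⟩ := x.stable
  refine ⟨∑ᶠ j, ‖x.mat (2 * r) j‖, ?_⟩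
  rintro _ ⟨_, ⟨p, hp, rfl⟩, rfl⟩
  exact hp.le_row x r hr _ le_rfl

variable (T) in
/-- The seminorm defining the Doplicher-Roberts algebra: the largest admissible `C*`-seminorm. Passing
to the completion of the graded algebra `⊕ₖ lim T(r, r + k)` this is the unique `C*`-norm for
which the circle action given by the grading is isometric. -/
def drSeminorm : Seminorm ℂ (PreDR T) := sSup {p | IsAdmissible p}

theorem IsAdmissible.le {p : Seminorm ℂ (PreDR T)} (hp : IsAdmissible p) (x : PreDR T) :
    p x ≤ drSeminorm T x :=
  le_csSup (bddAbove_admissible T) (show p ∈ {p : Seminorm ℂ (PreDR T) | IsAdmissible p} from hp) x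

theorem isAdmissible_zero : IsAdmissible (0 : Seminorm ℂ (PreDR T)) where
  mul_le x y := by simp
  adj_mul_self x := by simp
  gauge z x := rfl
  le_row x r _ i _ := finsum_nonneg fun j => norm_nonneg _

theorem drSeminorm_le {x : PreDR T} {C : ℝ} 
    (h : ∀ p : Seminorm ℂ (PreDR T), IsAdmissible p → p x ≤ C) : drSeminorm T x ≤ C := by
  rw [drSeminorm, Seminorm.sSup_apply (bddAbove_admissible T)]
  have : Nonempty {p : Seminorm ℂ (PreDR T) | IsAdmissible p} := ⟨⟨0, isAdmissible_zero⟩⟩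
  exact ciSup_le fun p => h p.1 p.2

variable (T) in
theorem isAdmissible_drSeminorm : IsAdmissible (drSeminorm T) where
  mul_le x y := drSeminorm_le fun p hp => (hp.mul_le x y).trans
    (mul_le_mul (hp.le x) (hp.le y) (apply_nonneg _ _) (apply_nonneg _ _))
  adj_mul_self x := by
    refine le_antisymm (drSeminorm_le fun p hp => ?_) ?_
    · rw [hp.adj_mul_self]
      exact pow_le_pow_left₀ (apply_nonneg _ _) (hp.le x) 2
    · have : drSeminorm T x ≤ √(drSeminorm T (preMul (preAdj x) x)) :=
        drSeminorm_le fun p hp => Real.le_sqrt_of_sq_le (by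
          rw [← hp.adj_mul_self]
          exact hp.le _)
      calc drSeminorm T x ^ 2 ≤ √(drSeminorm T (preMul (preAdj x) x)) ^ 2 :=
            pow_le_pow_left₀ (apply_nonneg _ _) this 2
        _ = _ := Real.sq_sqrt (apply_nonneg _ _)
  gauge z x := by
    refine le_antisymm (drSeminorm_le fun p hp => ?_) (drSeminorm_le fun p hp => ?_)
    · rw [hp.gauge]
      exact hp.le x
    · rw [← hp.gauge z]
      exact hp.le _
  le_row x r hr i hi := drSeminorm_le fun p hp => hp.le_row x r hr i hi

instance : SeminormedAddCommGroup (PreDR T) :=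
  { (drSeminorm T).toAddGroupSeminorm.toSeminormedAddCommGroup with
    toAddCommGroup := inferInstance }

theorem PreDR.norm_def (x : PreDR T) : ‖x‖ = drSeminorm T x := rfl

instance : NormedSpace ℂ (PreDR T) where
  norm_smul_le c x := (map_smul_eq_mul (drSeminorm T) c x).le

theorem norm_preAdj_le (x : PreDR T) : ‖preAdj x‖ ≤ ‖x‖ := by
  have h1 := (isAdmissible_drSeminorm T).adj_mul_self (preAdj x)
  have h2 := (isAdmissible_drSeminorm T).mul_le (preAdj (preAdj x)) (preAdj x)
  rw [preAdj_preAdj] at h1 h2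
  have h3 : 0 ≤ ‖x‖ := norm_nonneg _
  have h4 : 0 ≤ ‖preAdj x‖ := norm_nonneg _
  simp only [← PreDR.norm_def] at h1 h2
  rw [h1] at h2
  nlinarith

open UniformSpace

variable (T) in
/-- The Doplicher-Roberts algebra `DR(T)` of a right tensor `C*`-precategory: the completion of
`⊕ₖ lim T(r, r + k)` in the `C*`-norm for which the circle action defined by the grading is
isometric. -/
def DR : Type u := Completion (PreDR T)

instance : NonUnitalCStarAlgebra (DR T) :=
  complCStarAlgebra preMul (isAdmissible_drSeminorm T).mul_le preAdj norm_preAdj_le preMul_assoc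
    preAdj_preAdj preAdj_preMul (fun x => ((isAdmissible_drSeminorm T).adj_mul_self x).ge)

/-- The circle action on the completion. -/
def complGauge (z : Circle) : Completion (PreDR T) →L[ℂ] Completion (PreDR T) :=
  ((preGauge z).mkContinuous 1 fun x => by
    rw [one_mul]; exact ((isAdmissible_drSeminorm T).gauge z x).le).completion

theorem complGauge_coe (z : Circle) (x : PreDR T) :
    complGauge z (x : Completion (PreDR T)) = (preGauge z x : PreDR T) := by
  simp [complGauge]

theorem complGauge_complMul (z : Circle) (x y : Completion (PreDR T)) :
    complGauge z (complMul preMul (isAdmissible_drSeminorm T).mul_le x y) =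
      complMul preMul (isAdmissible_drSeminorm T).mul_le (complGauge z x) (complGauge z y) := by
  have hc := @continuous_complMul_comp (PreDR T) _ _ preMul (isAdmissible_drSeminorm T).mul_le
  refine Completion.induction_on₂ x y ?_ fun x y => by
    simp only [complMul_coe, complGauge_coe, preGauge_preMul]
  exact isClosed_eq ((complGauge z).continuous.comp (hc (by fun_prop) (by fun_prop)))
    (hc (by fun_prop) (by fun_prop))

theorem complGauge_complAdj (z : Circle) (x : Completion (PreDR T)) :
    complGauge z (complAdj preAdj norm_preAdj_le x) =
      complAdj preAdj norm_preAdj_le (complGauge z x) := by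
  refine Completion.induction_on x ?_ fun x => by
    simp only [complAdj_coe, complGauge_coe, preGauge_preAdj]
  exact isClosed_eq (by fun_prop) (by fun_prop)

variable (T) in
/-- The gauge action on `DR(T)`, given by `γ_z(i_{(n,m)}(a)) = z ^ (m - n) i_{(n,m)}(a)`
(see `gauge_toDR`). -/
def gauge (z : Circle) : DR T →⋆ₙₐ[ℂ] DR T where
  toFun := complGauge z
  map_smul' c x := (complGauge z).map_smul c x
  map_zero' := (complGauge z).map_zero
  map_add' := (complGauge z).map_add
  map_mul' := complGauge_complMul z
  map_star' := complGauge_complAdj z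

end doplicherRoberts

section embeddings
variable {T : RightTensorCStarPrecategory.{u}}

/-- The matrix `∑ₖ Λᵏ(e)`, where `Λ(e)_{i+1, j+1} = e_{ij} ⊗ 1` and `Λ(e)` has zero first row and
column. -/
def diagSum (e : ∀ i j : ℕ, T.Hom j i) : ∀ i j : ℕ, T.Hom j i
  | 0, j => e 0 j
  | i + 1, 0 => e (i + 1) 0
  | i + 1, j + 1 => e (i + 1) (j + 1) + T.tensor (diagSum e i j)

/-- The matrix with the single entry `a` in row `n` and column `m`. -/
def singleEntry {m n : ℕ} (a : T.Hom m n) : ∀ i j : ℕ, T.Hom j i :=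
  Pi.single n (Pi.single m a)

theorem singleEntry_self {m n : ℕ} (a : T.Hom m n) : singleEntry a n m = a := by
  simp [singleEntry]

theorem singleEntry_of_ne {m n : ℕ} (a : T.Hom m n) {i j : ℕ} (h : i ≠ n ∨ j ≠ m) :
    singleEntry a i j = 0 := by
  unfold singleEntry
  by_cases hi : i = n
  · subst hi
    rw [Pi.single_eq_same, Pi.single_eq_of_ne (by tauto)]
  · rw [Pi.single_eq_of_ne hi]
    rfl

theorem singleEntry_mem (K : T.Ideal) {m n : ℕ} {a : T.Hom m n} (ha : a ∈ K.carrier m n) (i j : ℕ) :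
    singleEntry a i j ∈ K.carrier j i := by
  by_cases h : i = n ∧ j = m
  · obtain ⟨rfl, rfl⟩ := h
    rwa [singleEntry_self]
  · rw [singleEntry_of_ne a (by tauto)]
    exact zero_mem _

/-- The matrix with entries `a ⊗ 1ᵏ` at `(n + k, m + k)`, and zero elsewhere. -/
def stableMatrix {m n : ℕ} : T.Hom m n →ₗ[ℂ] ∀ i j : ℕ, T.Hom j i where
  toFun a := diagSum (singleEntry a)
  map_add' a b := by
    funext i
    induction i with
    | zero => funext j; simp [diagSum, singleEntry, Pi.single_add]
    | succ i ih =>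
      funext j
      cases j with
      | zero => simp [diagSum, singleEntry, Pi.single_add]
      | succ j =>
        have := congrFun ih j
        simp only [Pi.add_apply] at this
        simp only [diagSum, this, Pi.add_apply, map_add]
        simp only [singleEntry, Pi.single_add, Pi.add_apply]
        abel
  map_smul' c a := by
    funext i
    induction i with
    | zero => funext j; simp [diagSum, singleEntry, Pi.single_smul]
    | succ i ih =>
      funext j
      cases j with
      | zero => simp [diagSum, singleEntry, Pi.single_smul]
      | succ j =>
        have := congrFun ih j
        simp only [Pi.smul_apply, RingHom.id_apply] at this
        simp only [diagSum, this, Pi.smul_apply, map_smul, RingHom.id_apply]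
        simp only [singleEntry, Pi.single_smul, Pi.smul_apply, smul_add]

theorem stableMatrix_succ {m n : ℕ} (a : T.Hom m n) (i j : ℕ) :
    stableMatrix a (i + 1) (j + 1) = singleEntry a (i + 1) (j + 1) + T.tensor (stableMatrix a i j) :=
  rfl

theorem stableMatrix_of_ne {m n : ℕ} (a : T.Hom m n) {i j : ℕ} (h : i + m ≠ j + n) :
    stableMatrix a i j = 0 := by
  induction i generalizing j with
  | zero =>
    change singleEntry a 0 j = 0
    exact singleEntry_of_ne a (by omega)
  | succ i ih =>
    cases j with
    | zero =>
      change singleEntry a (i + 1) 0 = 0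
      exact singleEntry_of_ne a (by omega)
    | succ j =>
      rw [stableMatrix_succ, ih (by omega), singleEntry_of_ne a (by omega)]
      simp

theorem stableMatrix_of_lt {m n : ℕ} (a : T.Hom m n) {i j : ℕ} (h : i < n) :
    stableMatrix a i j = 0 := by
  induction i generalizing j with
  | zero =>
    change singleEntry a 0 j = 0
    exact singleEntry_of_ne a (by omega)
  | succ i ih =>
    cases j with
    | zero =>
      change singleEntry a (i + 1) 0 = 0
      exact singleEntry_of_ne a (by omega)
    | succ j =>
      rw [stableMatrix_succ, ih (by omega), singleEntry_of_ne a (by omega)]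
      simp

theorem stableMatrix_tensor {m n : ℕ} (a : T.Hom m n) {i j : ℕ} (h : n ≤ i) :
    stableMatrix a (i + 1) (j + 1) = T.tensor (stableMatrix a i j) := by
  rw [stableMatrix_succ, singleEntry_of_ne a (by omega), zero_add]

theorem isStable_stableMatrix {m n : ℕ} (a : T.Hom m n) : IsStable (stableMatrix a) (m + n) :=
  ⟨fun i j h => stableMatrix_of_ne a (by omega), fun i j h => stableMatrix_of_ne a (by omega),
    fun i j hi hj => stableMatrix_tensor a (by omega)⟩

theorem stableMatrix_self {m n : ℕ} (a : T.Hom m n) : stableMatrix a n m = a := by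
  cases n with
  | zero => exact singleEntry_self a
  | succ n =>
    cases m with
    | zero => exact singleEntry_self a
    | succ m =>
      rw [stableMatrix_succ, singleEntry_self, stableMatrix_of_lt a (by omega)]
      simp

theorem norm_stableMatrix_le {m n : ℕ} (a : T.Hom m n) (i j : ℕ) : ‖stableMatrix a i j‖ ≤ ‖a‖ := by
  rcases lt_or_ge i n with h | h
  · rw [stableMatrix_of_lt a h, norm_zero]
    exact norm_nonneg _
  · induction i, h using Nat.le_induction generalizing j with
    | base =>
      by_cases hj : j = m
      · subst hj
        rw [stableMatrix_self]
      · rw [stableMatrix_of_ne a (by omega), norm_zero]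
        exact norm_nonneg _
    | succ i h ih =>
      cases j with
      | zero =>
        rw [show stableMatrix a (i + 1) 0 = singleEntry a (i + 1) 0 from rfl,
          singleEntry_of_ne a (by omega), norm_zero]
        exact norm_nonneg _
      | succ j =>
        rw [stableMatrix_tensor a h]
        exact (T.norm_tensor_le _).trans (ih j)

variable (T) in
/-- The canonical map `i_{(n,m)} : T(m, n) → DR(T)`. -/
def toDR (n m : ℕ) : T.Hom m n →ₗ[ℂ] DR T where
  toFun a := ((PreDR.mk (stableMatrix a) ⟨_, isStable_stableMatrix a⟩ : PreDR T) :
    UniformSpace.Completion (PreDR T))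
  map_add' a b := by
    have : PreDR.mk (stableMatrix (a + b)) ⟨_, isStable_stableMatrix (a + b)⟩ =
        PreDR.mk (stableMatrix a) ⟨_, isStable_stableMatrix a⟩ +
          PreDR.mk (stableMatrix b) ⟨_, isStable_stableMatrix b⟩ :=
      PreDR.ext fun i j => by simp
    rw [this]
    exact UniformSpace.Completion.coe_add _ _
  map_smul' c a := by
    have : PreDR.mk (stableMatrix (c • a)) ⟨_, isStable_stableMatrix (c • a)⟩ =
        c • PreDR.mk (stableMatrix a) ⟨_, isStable_stableMatrix a⟩ :=
      PreDR.ext fun i j => by simp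
    rw [this]
    exact UniformSpace.Completion.coe_smul _ _

/-- The map `K(m, n) → M(m, n)` sending `a` to the matrix with the single entry `a` at `(n, m)`
(recorded through its partial sums). -/
def toMatrices (K : T.Ideal) (m n : ℕ) : K.carrier m n →ₗ[ℂ] diagMatrices K m n where
  toFun a := ⟨⟨fun p => stableMatrix (a : T.Hom m n) p.1 p.2, memℓp_infty
      ⟨‖a‖, by
        rintro _ ⟨p, rfl⟩
        exact norm_stableMatrix_le (a : T.Hom m n) p.1 p.2⟩⟩,
    fun i j h => stableMatrix_of_ne _ h, fun j => singleEntry_mem K a.2 0 j,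
    fun i => by
      cases i with
      | zero => exact singleEntry_mem K a.2 0 0
      | succ i => exact singleEntry_mem K a.2 (i + 1) 0,
    fun i j => by
      change stableMatrix (a : T.Hom m n) (i + 1) (j + 1) -
        T.tensor (stableMatrix (a : T.Hom m n) i j) ∈ _
      rw [stableMatrix_succ, add_sub_cancel_right]
      exact singleEntry_mem K a.2 (i + 1) (j + 1),
    fun i j h => stableMatrix_tensor _ h⟩
  map_add' a b := diagMatrices_ext fun i j _ => by
    change stableMatrix (a + b : T.Hom m n) i j =
      stableMatrix (a : T.Hom m n) i j + stableMatrix (b : T.Hom m n) i j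
    simp
  map_smul' c a := diagMatrices_ext fun i j _ => by
    change stableMatrix (c • (a : T.Hom m n)) i j = c • stableMatrix (a : T.Hom m n) i j
    simp

/-- The canonical map `K(m, n) → K_J(m, n)`. -/
def toRel (K J : T.Ideal) (m n : ℕ) : K.carrier m n →ₗ[ℂ] (relPrecategory K J).Hom m n :=
  ((nullIdeal K J).carrier m n).mkQ ∘ₗ toMatrices K m n

end embeddings

section representations
variable {T : RightTensorCStarPrecategory.{u}}

/-- The ideal `J(K) = K ∩ (⊗ 1)⁻¹(K)`. -/
def Ideal.tensorIdeal (K : T.Ideal) : T.Ideal where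
  carrier m n := K.carrier m n ⊓ (K.carrier (m + 1) (n + 1)).comap T.tensor
  isClosed m n := (K.isClosed m n).inter
    ((K.isClosed (m + 1) (n + 1)).preimage continuous_tensor)
  comp_left a _ hb := ⟨K.comp_left a hb.1, by
    have h := K.comp_left (T.tensor a) (Submodule.mem_comap.1 hb.2)
    rw [← T.tensor_comp] at h
    exact h⟩
  comp_right b ha := ⟨K.comp_right b ha.1, by
    have h := K.comp_right (T.tensor b) (Submodule.mem_comap.1 ha.2)
    rw [← T.tensor_comp] at h
    exact h⟩

variable (T) in
/-- The iterated tensoring `a ↦ a ⊗ 1ᵏ`. -/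
def tensorPow {m n : ℕ} : ∀ k : ℕ, T.Hom m n → T.Hom (m + k) (n + k)
  | 0, a => a
  | k + 1, a => T.tensor (tensorPow k a)

/-- Families of linear maps `π_{nm} : K(m, n) → B` into a `C*`-algebra `B`. -/
abbrev RepFamily (K : T.Ideal) (B : Type v) [NonUnitalCStarAlgebra B] : Type (max u v) :=
  ∀ n m : ℕ, K.carrier m n →ₗ[ℂ] B

namespace RepFamily
variable {K : T.Ideal} {B : Type v} [NonUnitalCStarAlgebra B]

/-- Right tensor representations of the ideal `K` of `T`: `π_{nm}(a)* = π_{mn}(a*)`,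
`π_{nm}(a) π_{ml}(b) = π_{nl}(ab)`, and `π_{nm}(a) π_{m+k,l}(b) = π_{n+k,l}((a ⊗ 1ᵏ) b)`. -/
structure IsRightTensorRep (π : RepFamily K B) : Prop where
  star_apply : ∀ {m n : ℕ} (a : K.carrier m n),
    star (π n m a) = π m n ⟨T.adj (a : T.Hom m n), K.adj_mem a.2⟩
  mul_apply : ∀ {l m n : ℕ} (a : K.carrier m n) (b : K.carrier l m),
    π n m a * π m l b = π n l ⟨T.comp (a : T.Hom m n) (b : T.Hom l m), K.comp_left _ b.2⟩
  mul_tensor_apply : ∀ {k l m n : ℕ} (a : K.carrier m n) (b : K.carrier l (m + k)),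
    π n m a * π (m + k) l b =
      π (n + k) l ⟨T.comp (T.tensorPow k (a : T.Hom m n)) (b : T.Hom l (m + k)), K.comp_left _ b.2⟩

/-- `π` is coisometric on `J ⊆ J(K)`: `π_{nm}(a) = π_{n+1,m+1}(a ⊗ 1)` for `a ∈ J(m, n)`. -/
def IsCoisometricOn (π : RepFamily K B) (J : T.Ideal) : Prop :=
  ∀ {m n : ℕ} (a : T.Hom m n) (_ : a ∈ J.carrier m n) (ha : a ∈ K.carrier m n)
    (ha' : T.tensor a ∈ K.carrier (m + 1) (n + 1)), π n m ⟨a, ha⟩ = π (n + 1) (m + 1) ⟨T.tensor a, ha'⟩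

/-- The `C*`-algebra `C*(π)` generated by the ranges of the maps `π_{nm}`. -/
def generatedAlgebra (π : RepFamily K B) : NonUnitalStarSubalgebra ℂ B :=
  (NonUnitalStarAlgebra.adjoin ℂ (⋃ (n : ℕ) (m : ℕ), Set.range (π n m))).topologicalClosure

/-- `π` admits a gauge action: for each `z` in the unit circle there is a `*`-homomorphism
`β_z : C*(π) → C*(π)` with `β_z(π_{nm}(a)) = z ^ (n - m) π_{nm}(a)`. -/
def AdmitsGaugeAction (π : RepFamily K B) : Prop :=
  ∀ z : Circle, ∃ β : π.generatedAlgebra →⋆ₙₐ[ℂ] π.generatedAlgebra,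
    ∀ (n m : ℕ) (a : K.carrier m n) (b : π.generatedAlgebra), (b : B) = π n m a →
      (β b : B) = ((z : ℂ) ^ ((n : ℤ) - (m : ℤ))) • π n m a

/-- `N` is the kernel of `π`: `N(m, n) = ker π_{nm}`. -/
def HasKernel (π : RepFamily K B) (N : T.Ideal) : Prop :=
  ∀ (m n : ℕ) (a : T.Hom m n), a ∈ N.carrier m n ↔ ∃ h : a ∈ K.carrier m n, π n m ⟨a, h⟩ = 0

/-- The pair `(B, i)` is universal for the right tensor representations of `K` coisometric on `J`: `i` is
such a representation, its range generates `B`, and every such representation `π` factors as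
`π = Ψ ∘ i`. -/
structure IsUniversal (i : RepFamily K B) (J : T.Ideal) : Prop where
  isRightTensorRep : i.IsRightTensorRep
  isCoisometricOn : i.IsCoisometricOn J
  generates : i.generatedAlgebra = ⊤
  exists_lift : ∀ (C : Type w) [NonUnitalCStarAlgebra C] (π : RepFamily K C),
    π.IsRightTensorRep → π.IsCoisometricOn J →
      ∃ Ψ : B →⋆ₙₐ[ℂ] C, ∀ (n m : ℕ) (a : K.carrier m n), Ψ (i n m a) = π n m a

end RepFamily
end representations

section universal

variable {T : RightTensorCStarPrecategory.{u}}

theorem gauge_toDR (z : Circle) {m n : ℕ} (a : T.Hom m n) :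
    gauge T z (toDR T n m a) = ((z : ℂ) ^ ((m : ℤ) - (n : ℤ))) • toDR T n m a := by
  rw [← map_smul]
  refine (complGauge_coe z _).trans ?_
  change _ = ((PreDR.mk (stableMatrix _) ⟨_, isStable_stableMatrix _⟩ : PreDR T) :
    UniformSpace.Completion (PreDR T))
  congr 1
  refine PreDR.ext fun i j => ?_
  rw [mat_preGauge, PreDR.mat_mk, PreDR.mat_mk, map_smul, Pi.smul_apply, Pi.smul_apply]
  by_cases h : i + m = j + n
  · congr 2
    omega
  · rw [stableMatrix_of_ne a h, smul_zero, smul_zero]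

variable (T) in
/-- The universal right tensor representation `i` of `T` in `DR(T)`. -/
def universalRep : RepFamily (⊤ : T.Ideal) (DR T) :=
  fun n m => toDR T n m ∘ₗ Submodule.subtype _

/-- The universal representation of `K` in `O_T(K, J) = DR(K_J)`: the canonical maps
`K(m, n) → K_J(m, n)` followed by `i_{(n,m)} : K_J(m, n) → DR(K_J)`. -/
def relUniversalRep (K J : T.Ideal) : RepFamily K (DR (relPrecategory K J)) :=
  fun n m => toDR (relPrecategory K J) n m ∘ₗ toRel K J m n

/-- `O(N)`: the closed linear span of the image of `N` in `DR(T)`. -/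
def Ideal.spanDR (N : T.Ideal) : Submodule ℂ (DR T) :=
  (Submodule.span ℂ
    (⋃ (n : ℕ) (m : ℕ), toDR T n m '' (N.carrier m n : Set (T.Hom m n)))).topologicalClosure

/-- Closed two-sided ideals of `DR(T)` that are invariant under the gauge action. -/
structure IsGaugeInvariantIdeal (P : Submodule ℂ (DR T)) : Prop where
  isClosed : IsClosed (P : Set (DR T))
  mul_mem_left : ∀ (x : DR T) {y : DR T}, y ∈ P → x * y ∈ P
  mul_mem_right : ∀ {x : DR T} (y : DR T), x ∈ P → x * y ∈ P
  gauge_mem : ∀ (z : Circle) {x : DR T}, x ∈ P → gauge T z x ∈ P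

variable (T) in
/-- The invariant and `T`-saturated ideals `N` of `T`: `N ⊗ 1 ⊆ N` and `(⊗ 1)⁻¹(N) ⊆ N`, ordered by
inclusion. -/
abbrev InvariantSaturatedIdeal : Type u :=
  {N : T.Ideal // N.Invariant ∧ N.Saturated ⊤}

variable (T) in
/-- The gauge invariant ideals of `DR(T)`, ordered by inclusion. -/
abbrev GaugeInvariantIdeal : Type u :=
  {P : Submodule ℂ (DR T) // IsGaugeInvariantIdeal P}

end universal
end
end RightTensorCStarPrecategory

open RightTensorCStarPrecategory

/-! Apart from the universal property of `K_J`, everything holds for `DR(T)` with an arbitrary right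
tensor precategory `T`, and is then applied to `T = K_J`. An element of the dense subalgebra of
`DR(T)` is given by a stable matrix of which only the far rows matter. Such a row contains one
representative of every homogeneous component.

The norm of `DR(T)` is the largest admissible seminorm, so every admissible seminorm bounds it from
below. This is used twice. A representation that is coisometric on `T` has a row sum that does not
depend on the far row; the supremum of its norm over gauge translates is admissible, so the row sum
extends to a `*`-homomorphism on `DR(T)` (`CoisometricRep.lift`). And the operator norm of a matrix
acting from the right on far rows, viewed as elements of a Hilbert module over `T(s, s)`, is
admissible (`isAdmissible_tailSeminorm`). Hence if `i_{(n,m)}(a)` is small, some `a ⊗ 1ᵏ` is small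
(`exists_norm_tensorPow_le`); in particular `i` is injective when `⊗ 1` is.

A gauge-invariant ideal `P` is recovered from its preimage in `T` by Fourier analysis
(`IsGaugeInvariantIdeal.spanDR_preimage`). The Fourier coefficients of a gauge orbit in `P` lie in
`P`, and each is a limit of elements `i_{(n,m)}(a)`. Such an `a` has small image modulo `P`, hence
lies close to the preimage of `P`, because a representation is isometric modulo its kernel. Finally,
a closed subspace that contains all Fourier coefficients of `x` contains `x`.

Conversely, if `N` is invariant and saturated, then `⊗ 1` is injective on `T / N`, so `T → DR(T /
N)` has kernel exactly `N`. The induced map on `DR(T)` commutes with the gauge actions, so its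
kernel is `O(N)` (`Ideal.kerDR_quotientRep`). This gives the correspondence and a representation
with gauge action for each `N`. For a general representation, a gauge action on the image amounts to
gauge invariance of `ker Ψ`, which means that `ker Ψ = O(N)`. The map `DR(N) → DR(T)` is injective,
since its kernel is again generated by elements of `N`, and these vanish by the estimate on `a ⊗
1ᵏ`.

For the universal property of `O_T(K, J)`, a representation of `K` is extended to `M(m, n)` by
summing its values along a diagonal (`RepFamily.diagRep`). If the representation is coisometric on
`J`, the sum telescopes on the kernel of `‖·‖^J` to the value at the last partial sum, which is zero
there (`relRep`). -/

namespace RightTensorCStarPrecategory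

/-! ### Calculus in `DR(T)` by means of far rows of matrices. -/

noncomputable section rows
open UniformSpace
variable {T : RightTensorCStarPrecategory.{u}}

theorem DR.coe_eq_zero {x : PreDR T} (h : ‖x‖ ≤ 0) : (x : Completion (PreDR T)) = 0 := by
  rw [← norm_le_zero_iff, Completion.norm_coe]
  exact h

/-- From row `i` on, each row of `x` is the shift of the previous one. -/
def RowStable (x : ∀ i j : ℕ, T.Hom j i) (i : ℕ) : Prop :=
  ∀ i', i ≤ i' → x (i' + 1) 0 = 0 ∧ ∀ j, x (i' + 1) (j + 1) = T.tensor (x i' j)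

/-- Beyond row `2 * r` the columns before `r` lie outside the band of nonzero diagonals, so the
restriction on columns in `IsStable` costs nothing. -/
theorem IsStable.rowStable {x : ∀ i j : ℕ, T.Hom j i} {r : ℕ} (hx : IsStable x r) {i : ℕ}
    (hi : 2 * r ≤ i) : RowStable x i := by
  intro i' hi'
  refine ⟨hx.1 _ _ (by omega), fun j => ?_⟩
  rcases lt_or_ge j r with h | h
  · rw [hx.1 _ _ (by omega), hx.1 i' j (by omega), map_zero]
  · exact hx.2.2 _ _ (by omega) h

theorem rowStable_stableMatrix {m n : ℕ} (a : T.Hom m n) {i : ℕ} (hi : n ≤ i) :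
    RowStable (stableMatrix a) i := fun i' hi' =>
  ⟨stableMatrix_of_ne a (by omega), fun _ => stableMatrix_tensor a (by omega)⟩

theorem RowStable.sub {x y : ∀ i j : ℕ, T.Hom j i} {i : ℕ} (hx : RowStable x i)
    (hy : RowStable y i) : RowStable (x - y) i := fun i' hi' => by
  refine ⟨?_, fun j => ?_⟩
  · simp [(hx i' hi').1, (hy i' hi').1]
  · simp [(hx i' hi').2 j, (hy i' hi').2 j]

theorem RowStable.sum {ι : Type*} {s : Finset ι} {x : ι → ∀ i j : ℕ, T.Hom j i} {i : ℕ}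
    (hx : ∀ k, RowStable (x k) i) : RowStable (∑ k ∈ s, x k) i := fun i' hi' => by
  refine ⟨?_, fun j => ?_⟩
  · simp [fun k => (hx k i' hi').1]
  · simp [fun k => (hx k i' hi').2 j]

/-- Applied to a difference, this reduces an identity in `DR(T)` to the comparison of a single row.
-/
theorem RowStable.eq_zero {x : ∀ i j : ℕ, T.Hom j i} {i : ℕ} (hx : RowStable x i)
    (h : ∀ j, x i j = 0) {i' : ℕ} (hi : i ≤ i') (j : ℕ) : x i' j = 0 := by
  induction i', hi using Nat.le_induction generalizing j with
  | base => exact h j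
  | succ i' hi ih =>
    cases j with
    | zero => exact (hx i' hi).1
    | succ j => rw [(hx i' hi).2, ih, map_zero]

/-- Any far row may be used in the bound `le_row`, so finitely many rows are negligible. -/
theorem PreDR.norm_le_zero {x : PreDR T} {i : ℕ} (h : ∀ i', i ≤ i' → ∀ j, x.mat i' j = 0) :
    ‖x‖ ≤ 0 := by
  obtain ⟨r, hr⟩ := x.stable
  refine ((isAdmissible_drSeminorm T).le_row x r hr (2 * r + i) (by omega)).trans ?_
  rw [finsum_eq_zero_of_forall_eq_zero]
  intro j
  rw [h _ (by omega), norm_zero]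

theorem PreDR.coe_eq {x y : PreDR T} {i : ℕ} (h : ∀ i', i ≤ i' → ∀ j, x.mat i' j = y.mat i' j) :
    (x : Completion (PreDR T)) = y := by
  rw [← sub_eq_zero, ← Completion.coe_sub]
  apply DR.coe_eq_zero
  apply PreDR.norm_le_zero (i := i)
  intro i' hi' j
  change x.mat i' j - y.mat i' j = 0
  rw [h i' hi', sub_self]

@[simp] theorem PreDR.sum_mat {ι : Type*} (s : Finset ι) (x : ι → PreDR T) (i j : ℕ) :
    (∑ k ∈ s, x k).mat i j = ∑ k ∈ s, (x k).mat i j := by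
  classical
  induction s using Finset.induction_on with
  | empty => rfl
  | insert k s hk ih => rw [Finset.sum_insert hk, Finset.sum_insert hk, PreDR.add_mat, ih]

/-- The image of a stable matrix in `DR(T)`. -/
def PreDR.toDR (x : PreDR T) : DR T := (x : Completion (PreDR T))

theorem PreDR.denseRange_toDR : DenseRange (PreDR.toDR : PreDR T → DR T) :=
  Completion.denseRange_coe

theorem toDR_eq {m n : ℕ} (a : T.Hom m n) :
    toDR T n m a = (PreDR.mk (stableMatrix a) ⟨_, isStable_stableMatrix a⟩).toDR := rfl

theorem PreDR.toDR_mul (x y : PreDR T) : (preMul x y).toDR = x.toDR * y.toDR :=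
  (complMul_coe preMul (isAdmissible_drSeminorm T).mul_le x y).symm

theorem PreDR.toDR_star (x : PreDR T) : (preAdj x).toDR = star x.toDR :=
  (complAdj_coe preAdj norm_preAdj_le x).symm

theorem PreDR.toDR_add (x y : PreDR T) : (x + y).toDR = x.toDR + y.toDR :=
  Completion.coe_add x y

theorem PreDR.norm_toDR (x : PreDR T) : ‖x.toDR‖ = ‖x‖ := Completion.norm_coe x

theorem PreDR.toDR_sum {ι : Type*} (s : Finset ι) (x : ι → PreDR T) :
    (∑ k ∈ s, x k).toDR = ∑ k ∈ s, (x k).toDR :=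
  map_sum (AddMonoidHom.mk' PreDR.toDR PreDR.toDR_add) x s

/-- A stable matrix is the sum of the entries of a far row. -/
theorem PreDR.toDR_eq_sum {x : PreDR T} {r : ℕ} (hr : IsStable x.mat r) {i N : ℕ}
    (hi : 2 * r ≤ i) (hN : i + r < N) :
    x.toDR = ∑ j ∈ Finset.range N, RightTensorCStarPrecategory.toDR T i j (x.mat i j) := by
  simp only [toDR_eq]
  rw [← PreDR.toDR_sum]
  refine PreDR.coe_eq (i := i) fun i' hi' j => ?_
  rw [PreDR.sum_mat]
  simp only [PreDR.mat_mk]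
  have h1 : RowStable (x.mat - ∑ j ∈ Finset.range N, stableMatrix (x.mat i j)) i :=
    (hr.rowStable hi).sub (RowStable.sum fun k => rowStable_stableMatrix _ le_rfl)
  have h2 := h1.eq_zero (fun j => ?_) hi' j
  · simpa [sub_eq_zero] using h2
  · simp only [Pi.sub_apply, Finset.sum_apply, sub_eq_zero]
    rcases lt_or_ge j N with h | h
    · rw [Finset.sum_eq_single j (fun k _ hk => stableMatrix_of_ne _ (by omega))
        (fun h' => absurd (Finset.mem_range.2 h) h'), stableMatrix_self]
    · rw [hr.2.1 _ _ (by omega), Finset.sum_eq_zero fun k hk => stableMatrix_of_ne _ (by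
        have := Finset.mem_range.1 hk
        omega)]

theorem toDR_tensor {m n : ℕ} (a : T.Hom m n) :
    toDR T (n + 1) (m + 1) (T.tensor a) = toDR T n m a := by
  refine PreDR.coe_eq (i := n + 1) fun i' hi' j => ?_
  have h1 : RowStable (stableMatrix (T.tensor a) - stableMatrix a) (n + 1) :=
    (rowStable_stableMatrix _ le_rfl).sub (rowStable_stableMatrix _ (by omega))
  have h2 := h1.eq_zero (fun j => ?_) hi' j
  · simpa [sub_eq_zero] using h2
  · simp only [Pi.sub_apply, sub_eq_zero]
    by_cases hj : j = m + 1
    · subst hj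
      rw [stableMatrix_self, stableMatrix_tensor a le_rfl, stableMatrix_self]
    · rw [stableMatrix_of_ne _ (by omega), stableMatrix_of_ne _ (by omega)]

theorem stableMatrix_add {m n : ℕ} (a : T.Hom m n) (k : ℕ) :
    stableMatrix a (n + k) (m + k) = T.tensorPow k a := by
  induction k with
  | zero => exact stableMatrix_self a
  | succ k ih =>
    change stableMatrix a (n + k + 1) (m + k + 1) = T.tensor _
    rw [stableMatrix_tensor a (by omega), ih]

theorem stableMatrix_adj {m n : ℕ} (a : T.Hom m n) (i j : ℕ) :
    stableMatrix (T.adj a) i j = T.adj (stableMatrix a j i) := by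
  by_cases h : i + n = j + m
  · rcases lt_or_ge i m with h' | h'
    · rw [stableMatrix_of_lt _ h', stableMatrix_of_lt _ (by omega), map_zero]
    · obtain ⟨k, rfl⟩ := Nat.exists_eq_add_of_le h'
      obtain rfl : j = n + k := by omega
      induction k with
      | zero => exact (stableMatrix_self _).trans (congrArg T.adj (stableMatrix_self a).symm)
      | succ k ih =>
        change stableMatrix (T.adj a) (m + k + 1) (n + k + 1) =
          T.adj (stableMatrix a (n + k + 1) (m + k + 1))
        rw [stableMatrix_tensor _ (by omega), stableMatrix_tensor _ (by omega),
          ih (by omega) (by omega),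
          T.tensor_adj]
  · rw [stableMatrix_of_ne _ h, stableMatrix_of_ne _ (by omega), map_zero]

/-- `(a ⊗ 1ᵏ) b`, tensored to position `(i, j)`. -/
theorem stableMatrix_comp {m n q p l : ℕ} (a : T.Hom m n) (b : T.Hom l p) (hp : m ≤ p)
    (hq : q + m = p + n) {i k j : ℕ} (hik : i + m = k + n) :
    T.comp (stableMatrix a i k) (stableMatrix b k j) =
      stableMatrix (T.comp (stableMatrix a q p) b) i j := by
  by_cases h : k + l = j + p
  · rcases lt_or_ge k p with h' | h'
    · rw [stableMatrix_of_lt b h', map_zero, stableMatrix_of_lt _ (by omega)]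
    · obtain ⟨s, rfl⟩ := Nat.exists_eq_add_of_le h'
      obtain rfl : j = l + s := by omega
      obtain rfl : i = q + s := by omega
      induction s with
      | zero => simp only [Nat.add_zero, stableMatrix_self]
      | succ s ih =>
        change T.comp (stableMatrix a (q + s + 1) (p + s + 1))
            (stableMatrix b (p + s + 1) (l + s + 1)) =
          stableMatrix _ (q + s + 1) (l + s + 1)
        rw [stableMatrix_tensor a (by omega), stableMatrix_tensor b (by omega),
          stableMatrix_tensor _ (by omega), ← T.tensor_comp, ih (by omega) (by omega) (by omega)]
  · rw [stableMatrix_of_ne b h, map_zero, stableMatrix_of_ne _ (by omega)]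

/-- The matrix of `a` lives on one diagonal, so each entry of the product in a row `i ≥ n` is a
single composition, with middle index `k = i + m - n`. -/
theorem toDR_mul_tensor {m n q p l : ℕ} (a : T.Hom m n) (b : T.Hom l p) (hp : m ≤ p)
    (hq : q + m = p + n) : toDR T n m a * toDR T p l b =
      toDR T q l (T.comp (stableMatrix a q p) b) := by
  rw [toDR_eq, toDR_eq, ← PreDR.toDR_mul]
  refine PreDR.coe_eq (i := n) fun i hi j => ?_
  rw [mat_preMul, PreDR.mat_mk, PreDR.mat_mk, PreDR.mat_mk]
  obtain ⟨k, hk⟩ : ∃ k, i + m = k + n := ⟨i + m - n, by omega⟩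
  rw [← stableMatrix_comp a b hp hq hk, matMul]
  apply finsum_eq_single
  intro k' hk'
  rw [stableMatrix_of_ne a (by omega)]
  simp

theorem toDR_mul {m n l : ℕ} (a : T.Hom m n) (b : T.Hom l m) :
    toDR T n m a * toDR T m l b = toDR T n l (T.comp a b) := by
  rw [toDR_mul_tensor a b le_rfl (add_comm _ _), stableMatrix_self]

theorem toDR_star {m n : ℕ} (a : T.Hom m n) : star (toDR T n m a) = toDR T m n (T.adj a) := by
  rw [toDR_eq, toDR_eq, ← PreDR.toDR_star]
  congr 1
  exact PreDR.ext fun i j => (stableMatrix_adj a i j).symm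

theorem toDR_stableMatrix {m n : ℕ} (a : T.Hom m n) {i j : ℕ} (hi : n ≤ i) (hj : i + m = j + n) :
    toDR T i j (stableMatrix a i j) = toDR T n m a := by
  obtain ⟨k, rfl⟩ := Nat.exists_eq_add_of_le hi
  obtain rfl : j = m + k := by omega
  induction k with
  | zero => simp only [Nat.add_zero, stableMatrix_self]
  | succ k ih =>
    change toDR T (n + k + 1) (m + k + 1) (stableMatrix a (n + k + 1) (m + k + 1)) = _
    rw [stableMatrix_tensor a (by omega), toDR_tensor, ih (by omega) (by omega)]

/-- The images of stable matrices are dense, and each is a finite sum of elements `i_{(n,m)}(a)`,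
taken from a far row. -/
theorem DR.eq_top_of_toDR_mem (S : Submodule ℂ (DR T)) (hS : IsClosed (S : Set (DR T)))
    (h : ∀ (n m : ℕ) (a : T.Hom m n), toDR T n m a ∈ S) : S = ⊤ := by
  rw [eq_top_iff]
  rintro x -
  refine PreDR.denseRange_toDR.induction_on (p := fun x => x ∈ S) x hS fun y => ?_
  obtain ⟨r, hr⟩ := y.stable
  rw [PreDR.toDR_eq_sum hr le_rfl (Nat.lt_succ_self _)]
  exact sum_mem fun j _ => h _ _ _

theorem norm_toDR_le {m n : ℕ} (a : T.Hom m n) : ‖toDR T n m a‖ ≤ ‖a‖ := by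
  rw [toDR_eq, PreDR.norm_toDR]
  refine ((isAdmissible_drSeminorm T).le_row
    (PreDR.mk (stableMatrix a) ⟨_, isStable_stableMatrix a⟩) (m + n) (isStable_stableMatrix a)
    (2 * (m + n)) le_rfl).trans ?_
  rw [finsum_eq_single _ (2 * (m + n) + m - n)]
  · exact norm_stableMatrix_le a _ _
  · intro j hj
    rw [PreDR.mat_mk, stableMatrix_of_ne a (by omega), norm_zero]

end rows
-- Extension of coisometric representations of `T` to `DR(T)`.
noncomputable section lift
open UniformSpace
variable {T : RightTensorCStarPrecategory.{u}} {B : Type v} [NonUnitalCStarAlgebra B]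

/-- A right tensor representation of `T` in `B` that is coisometric on `T`. -/
structure CoisometricRep (T : RightTensorCStarPrecategory.{u}) (B : Type v)
    [NonUnitalCStarAlgebra B] where
  map : ∀ n m : ℕ, T.Hom m n →ₗ[ℂ] B
  map_adj : ∀ {m n : ℕ} (a : T.Hom m n), map m n (T.adj a) = star (map n m a)
  map_comp : ∀ {l m n : ℕ} (a : T.Hom m n) (b : T.Hom l m),
    map n l (T.comp a b) = map n m a * map m l b
  map_tensor : ∀ {m n : ℕ} (a : T.Hom m n), map (n + 1) (m + 1) (T.tensor a) = map n m a

namespace CoisometricRep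

variable (ρ : CoisometricRep T B)

/-- The restriction of a representation to the `C*`-algebra `T(m, m)`. -/
@[reducible] def endHom (m : ℕ) :
    letI := T.endCStarAlgebra m
    T.Hom m m →⋆ₙₐ[ℂ] B :=
  letI := T.endCStarAlgebra m
  { toFun := ρ.map m m
    map_smul' := fun _ _ => map_smul _ _ _
    map_zero' := map_zero _
    map_add' := map_add _
    map_mul' := fun x y => ρ.map_comp x y
    map_star' := fun x => ρ.map_adj x }

theorem norm_map_sq {m n : ℕ} (a : T.Hom m n) :
    ‖ρ.map n m a‖ ^ 2 = ‖ρ.map m m (T.comp (T.adj a) a)‖ := by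
  rw [ρ.map_comp, ρ.map_adj, CStarRing.norm_star_mul_self, sq]

/-- The `C*`-identity reduces the estimate to `a* a ∈ T(m, m)`, where `ρ` is a `*`-homomorphism of
`C*`-algebras. -/
theorem norm_map_le {m n : ℕ} (a : T.Hom m n) : ‖ρ.map n m a‖ ≤ ‖a‖ := by
  let _ := T.endCStarAlgebra m
  have h : ‖ρ.map m m (T.comp (T.adj a) a)‖ ≤ ‖T.comp (T.adj a) a‖ :=
    NonUnitalStarAlgHom.norm_apply_le (ρ.endHom m) (T.comp (T.adj a) a)
  refine (sq_le_sq₀ (norm_nonneg _) (norm_nonneg _)).1 ?_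
  rw [norm_map_sq, ← T.norm_adj_comp_self]
  exact h

theorem norm_map_of_injective (h : ∀ {m : ℕ} (a : T.Hom m m), ρ.map m m a = 0 → a = 0) {m n : ℕ}
    (a : T.Hom m n) : ‖ρ.map n m a‖ = ‖a‖ := by
  let _ := T.endCStarAlgebra m
  have h : ‖ρ.map m m (T.comp (T.adj a) a)‖ = ‖T.comp (T.adj a) a‖ :=
    NonUnitalStarAlgHom.norm_map (ρ.endHom m)
      ((injective_iff_map_eq_zero (ρ.endHom m)).2 fun a ha => h a ha) (T.comp (T.adj a) a)
  refine (sq_eq_sq₀ (norm_nonneg _) (norm_nonneg _)).1 ?_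
  rw [norm_map_sq, ← T.norm_adj_comp_self]
  exact h

/-- The sum of the images of the entries of a row. -/
def rowSum (x : ∀ i j : ℕ, T.Hom j i) (i : ℕ) : B := ∑ᶠ j, ρ.map i j (x i j)

theorem rowSum_eq {x : ∀ i j : ℕ, T.Hom j i} {r i N : ℕ} (hx : IsStable x r) (h : i + r < N) :
    ρ.rowSum x i = ∑ j ∈ Finset.range N, ρ.map i j (x i j) := by
  apply finsum_eq_sum_of_support_subset
  intro k hk
  rw [Finset.coe_range, Set.mem_Iio]
  by_contra hN
  apply hk
  change ρ.map i k (x i k) = 0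
  rw [hx.2.1 i k (by omega), map_zero]

/-- Each row is the tensor shift of the previous one, and coisometry makes `ρ` blind to this shift.
-/
theorem rowSum_of_le {x : ∀ i j : ℕ, T.Hom j i} {r i : ℕ} (hx : IsStable x r)
    (hi : RowStable x i) {i' : ℕ} (h : i ≤ i') : ρ.rowSum x i' = ρ.rowSum x i := by
  induction i', h using Nat.le_induction with
  | base => rfl
  | succ i' h ih =>
    rw [← ih, ρ.rowSum_eq hx (show i' + 1 + r < i' + 1 + r + 1 by omega), Finset.sum_range_succ',
      ρ.rowSum_eq hx (show i' + r < i' + 1 + r by omega), (hi i' h).1, map_zero, add_zero]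
    refine Finset.sum_congr rfl fun j _ => ?_
    rw [(hi i' h).2, ρ.map_tensor]

/-- The eventual row sum of a stable matrix. -/
def preLiftFun (x : PreDR T) : B := ρ.rowSum x.mat (2 * x.stable.choose)

theorem preLiftFun_eq (x : PreDR T) {i : ℕ} (hi : RowStable x.mat i) :
    ρ.preLiftFun x = ρ.rowSum x.mat i := by
  have hr := x.stable.choose_spec
  rw [preLiftFun, ← ρ.rowSum_of_le hr (hr.rowStable le_rfl)
    (le_max_left (2 * x.stable.choose) i), ρ.rowSum_of_le hr hi (le_max_right _ _)]

theorem preLiftFun_eq_sum (x : PreDR T) {r i N : ℕ} (hr : IsStable x.mat r) (hi : 2 * r ≤ i)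
    (hN : i + r < N) : ρ.preLiftFun x = ∑ j ∈ Finset.range N, ρ.map i j (x.mat i j) := by
  rw [ρ.preLiftFun_eq x (hr.rowStable hi), ρ.rowSum_eq hr hN]

/-- The eventual row sum, as a linear map. -/
def preLift : PreDR T →ₗ[ℂ] B where
  toFun := ρ.preLiftFun
  map_add' x y := by
    obtain ⟨r, hr⟩ := x.stable
    obtain ⟨s, hs⟩ := y.stable
    have h : IsStable (x + y).mat (r + s) := hr.add hs
    have hN : 2 * (r + s) + (r + s) < 2 * (r + s) + (r + s) + 1 := Nat.lt_succ_self _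
    rw [ρ.preLiftFun_eq_sum _ h le_rfl hN,
      ρ.preLiftFun_eq_sum x (hr.mono (Nat.le_add_right _ _)) le_rfl hN,
      ρ.preLiftFun_eq_sum y (hs.mono (Nat.le_add_left _ _)) le_rfl hN, ← Finset.sum_add_distrib]
    simp
  map_smul' c x := by
    obtain ⟨r, hr⟩ := x.stable
    have h : IsStable (c • x).mat r := hr.smul c
    rw [ρ.preLiftFun_eq_sum _ h le_rfl (Nat.lt_succ_self _),
      ρ.preLiftFun_eq_sum x hr le_rfl (Nat.lt_succ_self _), RingHom.id_apply, Finset.smul_sum]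
    simp

theorem preLift_eq_sum (x : PreDR T) {r i N : ℕ} (hr : IsStable x.mat r) (hi : 2 * r ≤ i)
    (hN : i + r < N) : ρ.preLift x = ∑ j ∈ Finset.range N, ρ.map i j (x.mat i j) :=
  ρ.preLiftFun_eq_sum x hr hi hN

/-- Row `i` of the product combines the rows `k` of `y` with coefficients `x i k`. Every row `k`
that contributes is far enough to have the same row sum, which then factors out. -/
theorem preLift_preMul (x y : PreDR T) : ρ.preLift (preMul x y) = ρ.preLift x * ρ.preLift y := by
  obtain ⟨r, hr⟩ := x.stable
  obtain ⟨s, hs⟩ := y.stable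
  have h : IsStable (preMul x y).mat (r + s + r + s) := hr.matMul hs
  -- The product is stable from `2 * (r + s)` on, and row sums are constant from twice this index.
  -- Then `k ≥ i - r` gives `k ≥ 2 * s`, and `N` exceeds all columns that occur.
  obtain ⟨i, hi⟩ : ∃ i, i = 4 * (r + s) := ⟨_, rfl⟩
  obtain ⟨N, hN⟩ : ∃ N, N = i + 4 * (r + s) + 1 := ⟨_, rfl⟩
  rw [ρ.preLift_eq_sum _ h (show _ ≤ i by omega) (show _ < N by omega),
    ρ.preLift_eq_sum x hr (show _ ≤ i by omega) (show _ < N by omega), Finset.sum_mul]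
  have e : ∀ j, ρ.map i j ((preMul x y).mat i j) =
      ∑ k ∈ Finset.range N, ρ.map i k (x.mat i k) * ρ.map k j (y.mat k j) := fun j => by
    rw [mat_preMul, matMul_eq_left hr (show _ < N by omega), map_sum]
    simp only [ρ.map_comp]
  simp only [e]
  rw [Finset.sum_comm]
  refine Finset.sum_congr rfl fun k _ => ?_
  rw [← Finset.mul_sum]
  by_cases hk : i ≤ k + r ∧ k ≤ i + r
  · rw [ρ.preLift_eq_sum y hs (show _ ≤ k by omega) (show _ < N by omega)]
  · have : x.mat i k = 0 := by
      rcases not_and_or.1 hk with hk | hk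
      · exact hr.1 _ _ (by omega)
      · exact hr.2.1 _ _ (by omega)
    rw [this, map_zero, zero_mul, zero_mul]

theorem map_diag {x : ∀ i j : ℕ, T.Hom j i} {r : ℕ} (hx : IsStable x r) {i j : ℕ} (hi : r ≤ i)
    (hj : r ≤ j) (k : ℕ) : ρ.map (i + k) (j + k) (x (i + k) (j + k)) = ρ.map i j (x i j) := by
  induction k with
  | zero => rfl
  | succ k ih =>
    change ρ.map (i + k + 1) (j + k + 1) (x (i + k + 1) (j + k + 1)) = _
    rw [hx.2.2 _ _ (by omega) (by omega), ρ.map_tensor, ih]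

/-- In row `2 * r` the band occupies the columns from `r` to `3 * r`, so the sum is indexed by the
`2 * r + 1` diagonals. This form makes the reversal of diagonals under the adjoint visible. -/
theorem preLift_eq_sum_band (x : PreDR T) {r : ℕ} (hr : IsStable x.mat r) :
    ρ.preLift x = ∑ t ∈ Finset.range (2 * r + 1), ρ.map (r + r) (r + t) (x.mat (r + r) (r + t)) := by
  rw [ρ.preLift_eq_sum x hr (show 2 * r ≤ r + r by omega) (show r + r + r < r + (2 * r + 1) by omega),
    Finset.sum_range_add, Finset.sum_eq_zero, zero_add]
  intro j hj
  rw [hr.1 _ _ (by have := Finset.mem_range.1 hj; omega), map_zero]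

/-- The adjoint exchanges rows and columns, so the row sum of `x*` is the adjoint of a column sum of
`x`. Coisometry lets every entry move along its diagonal, so that a column sum equals a row sum. -/
theorem preLift_preAdj (x : PreDR T) : ρ.preLift (preAdj x) = star (ρ.preLift x) := by
  obtain ⟨r, hr⟩ := x.stable
  have h : IsStable (preAdj x).mat r := hr.matAdj
  rw [ρ.preLift_eq_sum_band _ h, ρ.preLift_eq_sum_band x hr, ← Finset.sum_range_reflect, star_sum]
  refine Finset.sum_congr rfl fun t ht => ?_
  have ht := Finset.mem_range.1 ht
  change ρ.map _ _ (T.adj (x.mat _ _)) = _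
  rw [ρ.map_adj]
  congr 1
  -- After the reflection of the index set, both entries lie on the same diagonal; both are moved to
  -- row `3 * r`.
  obtain ⟨s, hs⟩ : ∃ s, s = 2 * r - t := ⟨_, rfl⟩
  have e1 : r + (2 * r + 1 - 1 - t) = r + s := by omega
  rw [e1, ← ρ.map_diag hr (i := r + s) (j := r + r) (by omega) (by omega) t,
    ← ρ.map_diag hr (i := r + r) (j := r + t) (by omega) (by omega) r]
  have e2 : r + s + t = r + r + r := by omega
  have e3 : r + r + t = r + t + r := by omega
  rw [e2, e3]

theorem norm_preLift_le (x : PreDR T) {r : ℕ} (hr : IsStable x.mat r) {i : ℕ} (hi : 2 * r ≤ i) :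
    ‖ρ.preLift x‖ ≤ ∑ᶠ j, ‖x.mat i j‖ := by
  rw [ρ.preLift_eq_sum x hr hi (Nat.lt_succ_self (i + r)),
    finsum_eq_sum_of_support_subset (s := Finset.range (i + r).succ)]
  · exact (norm_sum_le _ _).trans (Finset.sum_le_sum fun j _ => ρ.norm_map_le _)
  · intro k hk
    rw [Finset.coe_range, Set.mem_Iio]
    by_contra hN
    apply hk
    change ‖x.mat i k‖ = 0
    rw [hr.2.1 i k (by omega), norm_zero]

theorem isStable_preGauge (z : Circle) {x : PreDR T} {r : ℕ} (h : IsStable x.mat r) :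
    IsStable (preGauge z x).mat r := by
  refine ⟨fun i j hij => ?_, fun i j hij => ?_, fun i j hi hj => ?_⟩
  · rw [mat_preGauge, h.1 i j hij, smul_zero]
  · rw [mat_preGauge, h.2.1 i j hij, smul_zero]
  · rw [mat_preGauge, mat_preGauge, h.2.2 i j hi hj, map_smul]
    congr 2
    push_cast
    ring

theorem norm_zpow_circle (z : Circle) (k : ℤ) : ‖(z : ℂ) ^ k‖ = 1 := by
  rw [norm_zpow, Circle.norm_coe, one_zpow]

theorem norm_preLift_preGauge_le (x : PreDR T) {r : ℕ} (hr : IsStable x.mat r) {i : ℕ}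
    (hi : 2 * r ≤ i) (z : Circle) : ‖ρ.preLift (preGauge z x)‖ ≤ ∑ᶠ j, ‖x.mat i j‖ := by
  refine (ρ.norm_preLift_le _ (isStable_preGauge z hr) hi).trans_eq ?_
  refine finsum_congr fun j => ?_
  rw [mat_preGauge, norm_smul, norm_zpow_circle, one_mul]

theorem bddAbove_preLift (x : PreDR T) :
    BddAbove (Set.range fun z : Circle => ‖ρ.preLift (preGauge z x)‖) := by
  obtain ⟨r, hr⟩ := x.stable
  refine ⟨∑ᶠ j, ‖x.mat (2 * r) j‖, ?_⟩
  rintro _ ⟨z, rfl⟩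
  exact ρ.norm_preLift_preGauge_le x hr le_rfl z

/-- The gauge invariant seminorm defined by a representation. -/
def liftSeminorm : Seminorm ℂ (PreDR T) :=
  Seminorm.of (fun x => ⨆ z : Circle, ‖ρ.preLift (preGauge z x)‖)
    (fun x y => ciSup_le fun z => by
      rw [map_add, map_add]
      exact (norm_add_le _ _).trans
        (add_le_add (le_ciSup (ρ.bddAbove_preLift x) z) (le_ciSup (ρ.bddAbove_preLift y) z)))
    (fun c x => by
      simp only [map_smul, norm_smul]
      exact (Real.mul_iSup_of_nonneg (norm_nonneg c) _).symm)

theorem liftSeminorm_apply (x : PreDR T) :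
    ρ.liftSeminorm x = ⨆ z : Circle, ‖ρ.preLift (preGauge z x)‖ := rfl

theorem preGauge_preGauge (z w : Circle) (x : PreDR T) :
    preGauge z (preGauge w x) = preGauge (z * w) x := by
  refine PreDR.ext fun i j => ?_
  rw [mat_preGauge, mat_preGauge, mat_preGauge, smul_smul, Circle.coe_mul, mul_zpow]

theorem preGauge_one (x : PreDR T) : preGauge 1 x = x := by
  refine PreDR.ext fun i j => ?_
  rw [mat_preGauge, Circle.coe_one, one_zpow, one_smul]

/-- The image of `ρ` need not carry a gauge action, so `‖ρ.preLift x‖` alone need not be gauge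
invariant. The supremum over the circle repairs this and preserves the `C*`-identity, which holds
for each `z` separately. -/
theorem isAdmissible_liftSeminorm : IsAdmissible ρ.liftSeminorm where
  mul_le x y := ciSup_le fun z => by
    rw [preGauge_preMul, preLift_preMul]
    exact (norm_mul_le _ _).trans (mul_le_mul (le_ciSup (ρ.bddAbove_preLift x) z)
      (le_ciSup (ρ.bddAbove_preLift y) z) (norm_nonneg _) (apply_nonneg ρ.liftSeminorm x))
  adj_mul_self x := by
    have e : ∀ z : Circle, ‖ρ.preLift (preGauge z (preMul (preAdj x) x))‖ =
        ‖ρ.preLift (preGauge z x)‖ ^ 2 := fun z => by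
      rw [preGauge_preMul, preGauge_preAdj, preLift_preMul, preLift_preAdj,
        CStarRing.norm_star_mul_self, sq]
    have h0 := apply_nonneg ρ.liftSeminorm x
    refine le_antisymm (ciSup_le fun z => ?_) ?_
    · rw [e]
      exact pow_le_pow_left₀ (norm_nonneg _) (le_ciSup (ρ.bddAbove_preLift x) z) 2
    · have h1 : ρ.liftSeminorm x ≤ √(ρ.liftSeminorm (preMul (preAdj x) x)) := by
        refine ciSup_le fun z => Real.le_sqrt_of_sq_le ?_
        rw [← e]
        exact le_ciSup (ρ.bddAbove_preLift _) z
      calc _ ≤ √(ρ.liftSeminorm (preMul (preAdj x) x)) ^ 2 := pow_le_pow_left₀ h0 h1 2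
        _ = _ := Real.sq_sqrt (apply_nonneg _ _)
  gauge z x := by
    simp only [liftSeminorm_apply, preGauge_preGauge]
    exact (Equiv.mulRight z).iSup_comp (g := fun w => ‖ρ.preLift (preGauge w x)‖)
  le_row x r hr i hi := ciSup_le fun z => ρ.norm_preLift_preGauge_le x hr hi z

theorem norm_preLift_le_norm (x : PreDR T) : ‖ρ.preLift x‖ ≤ ‖x‖ := by
  refine le_trans ?_ (ρ.isAdmissible_liftSeminorm.le x)
  have := le_ciSup (ρ.bddAbove_preLift x) 1
  rwa [preGauge_one] at this

/-- The continuous linear extension of `preLift`. -/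
def liftCLM : DR T →L[ℂ] B :=
  (ρ.preLift.mkContinuous 1 fun x => by
    rw [one_mul]; exact ρ.norm_preLift_le_norm x).fromCompletion

theorem liftCLM_toDR (x : PreDR T) : ρ.liftCLM x.toDR = ρ.preLift x := by
  exact ContinuousLinearMap.fromCompletion_apply_coe _ x

/-- The `*`-homomorphism on `DR(T)` defined by a representation. -/
def lift : DR T →⋆ₙₐ[ℂ] B where
  toFun := ρ.liftCLM
  map_smul' c x := map_smul _ _ _
  map_zero' := map_zero _
  map_add' := map_add _
  map_mul' x y := by
    refine PreDR.denseRange_toDR.induction_on₂ (p := fun x y => ρ.liftCLM (x * y) =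
      ρ.liftCLM x * ρ.liftCLM y) ?_ (fun x y => ?_) x y
    · exact isClosed_eq (by fun_prop) (by fun_prop)
    · rw [← PreDR.toDR_mul, liftCLM_toDR, liftCLM_toDR, liftCLM_toDR, preLift_preMul]
  map_star' x := by
    refine PreDR.denseRange_toDR.induction_on (p := fun x => ρ.liftCLM (star x) =
      star (ρ.liftCLM x)) x ?_ fun x => ?_
    · exact isClosed_eq (by fun_prop) (by fun_prop)
    · rw [← PreDR.toDR_star, liftCLM_toDR, liftCLM_toDR, preLift_preAdj]

theorem lift_toDR {m n : ℕ} (a : T.Hom m n) : ρ.lift (toDR T n m a) = ρ.map n m a := by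
  change ρ.liftCLM (PreDR.toDR _) = _
  rw [liftCLM_toDR, preLift, LinearMap.coe_mk, AddHom.coe_mk,
    ρ.preLiftFun_eq (PreDR.mk (stableMatrix a) ⟨_, isStable_stableMatrix a⟩)
      (rowStable_stableMatrix a le_rfl), rowSum, finsum_eq_single _ m]
  · rw [PreDR.mat_mk, stableMatrix_self]
  · intro j hj
    rw [PreDR.mat_mk, stableMatrix_of_ne a (by omega), map_zero]

variable (T) in
/-- The universal representation. -/
def univ : CoisometricRep T (DR T) where
  map n m := toDR T n m
  map_adj a := (toDR_star a).symm
  map_comp a b := (toDR_mul a b).symm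
  map_tensor a := toDR_tensor a

/-- The composition of a representation with a `*`-homomorphism. -/
def compHom {C : Type w} [NonUnitalCStarAlgebra C] (f : B →⋆ₙₐ[ℂ] C) : CoisometricRep T C where
  map n m := (f : B →ₗ[ℂ] C) ∘ₗ ρ.map n m
  map_adj a := (congrArg f (ρ.map_adj a)).trans (map_star f _)
  map_comp a b := (congrArg f (ρ.map_comp a b)).trans (map_mul f _ _)
  map_tensor a := congrArg f (ρ.map_tensor a)

end CoisometricRep

theorem continuous_starHom {A C : Type*} [NonUnitalCStarAlgebra A] [NonUnitalCStarAlgebra C]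
    (f : A →⋆ₙₐ[ℂ] C) : Continuous f :=
  AddMonoidHomClass.continuous_of_bound f 1 fun x => by
    rw [one_mul]; exact NonUnitalStarAlgHom.norm_apply_le f x

theorem DR.hom_ext {f g : DR T →⋆ₙₐ[ℂ] B}
    (h : ∀ (n m : ℕ) (a : T.Hom m n), f (toDR T n m a) = g (toDR T n m a)) : f = g := by
  have hf : Continuous f := continuous_starHom f
  have hg : Continuous g := continuous_starHom g
  let S : Submodule ℂ (DR T) :=
    LinearMap.eqLocus (f : DR T →ₗ[ℂ] B) (g : DR T →ₗ[ℂ] B)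
  have hS : S = ⊤ := DR.eq_top_of_toDR_mem S (isClosed_eq hf hg) h
  ext x
  exact (hS ▸ Submodule.mem_top : x ∈ S)

end lift
-- The Hilbert module of finite rows with entries in `T(i, s)`.
noncomputable section rowModule
variable (T : RightTensorCStarPrecategory.{u})

/-- The `C*`-algebra `T(s, s)` with its spectral order. -/
def EndAlg (s : ℕ) : Type u := T.Hom s s

instance (s : ℕ) : NonUnitalCStarAlgebra (EndAlg T s) := T.endCStarAlgebra s
instance (s : ℕ) : PartialOrder (EndAlg T s) := CStarAlgebra.spectralOrder _
instance (s : ℕ) : StarOrderedRing (EndAlg T s) := CStarAlgebra.spectralOrderedRing _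

/-- Finite rows with entries in `T(i, s)`. -/
def RowModule (N s : ℕ) : Type u := ∀ i : Fin N, T.Hom i s

instance (N s : ℕ) : AddCommGroup (RowModule T N s) :=
  inferInstanceAs (AddCommGroup (∀ i : Fin N, T.Hom i s))
instance (N s : ℕ) : Module ℂ (RowModule T N s) :=
  inferInstanceAs (Module ℂ (∀ i : Fin N, T.Hom i s))
instance (N s : ℕ) : SMul (EndAlg T s) (RowModule T N s) := ⟨fun a v i => T.comp a (v i)⟩

variable {T}

/-- The element `a b*` of `T(s, s)`. -/
def mulAdj {i s : ℕ} (a b : T.Hom i s) : EndAlg T s := T.comp a (T.adj b)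

theorem mulAdj_add_left {i s : ℕ} (a a' b : T.Hom i s) :
    mulAdj (a + a') b = mulAdj a b + mulAdj a' b := by
  change T.comp (a + a') (T.adj b) = T.comp a (T.adj b) + T.comp a' (T.adj b)
  simp

theorem star_mulAdj {i s : ℕ} (a b : T.Hom i s) : star (mulAdj a b) = mulAdj b a := by
  change T.adj (T.comp a (T.adj b)) = T.comp b (T.adj a)
  rw [T.adj_comp, T.adj_adj]

/-- For `i ≠ s` this is not a fact about the algebra `T(s, s)` alone; it rests on the axiom
`adj_comp_self_pos`. -/
theorem mulAdj_self_nonneg {i s : ℕ} (a : T.Hom i s) : 0 ≤ mulAdj a a := by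
  obtain ⟨c, hc⟩ := T.adj_comp_self_pos (T.adj a)
  rw [T.adj_adj] at hc
  let d : EndAlg T s := c
  have : mulAdj a a = star d * d := hc
  rw [this]
  exact star_mul_self_nonneg d

theorem norm_mulAdj_self {i s : ℕ} (a : T.Hom i s) : ‖mulAdj a a‖ = ‖a‖ ^ 2 := by
  have := T.norm_adj_comp_self (T.adj a)
  rw [T.adj_adj, T.norm_adj] at this
  exact this

instance (N s : ℕ) : Norm (RowModule T N s) :=
  ⟨fun v => √‖∑ i, mulAdj (v i) (v i)‖⟩

/-- The module structure supplies the Cauchy-Schwarz and triangle inequalities for rows. -/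
instance (N s : ℕ) : CStarModule (EndAlg T s) (RowModule T N s) where
  inner v w := ∑ i, mulAdj (w i) (v i)
  inner_add_right {x y z} := by
    rw [← Finset.sum_add_distrib]
    exact Finset.sum_congr rfl fun i _ => mulAdj_add_left _ _ _
  inner_self_nonneg := Finset.sum_nonneg fun i _ => mulAdj_self_nonneg _
  inner_self {x} := by
    constructor
    · intro h
      funext i
      have h := (Finset.sum_eq_zero_iff_of_nonneg fun i _ => mulAdj_self_nonneg (x i)).1 h
      have := norm_mulAdj_self (x i)
      rw [h i (Finset.mem_univ i), norm_zero] at this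
      exact norm_eq_zero.1 (pow_eq_zero_iff two_ne_zero |>.1 this.symm)
    · rintro rfl
      refine Finset.sum_eq_zero fun i _ => ?_
      change T.comp (0 : T.Hom i s) _ = 0
      simp
  inner_op_smul_right {a x y} := by
    rw [Finset.mul_sum]
    exact Finset.sum_congr rfl fun i _ => T.comp_assoc _ _ _
  inner_smul_right_complex {z x y} := by
    rw [Finset.smul_sum]
    refine Finset.sum_congr rfl fun i _ => ?_
    change T.comp (z • y i) (T.adj (x i)) = z • T.comp (y i) (T.adj (x i))
    simp
  star_inner x y := by
    rw [star_sum]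
    exact Finset.sum_congr rfl fun i _ => star_mulAdj _ _
  norm_eq_sqrt_norm_inner_self x := rfl

/-- The inner product `∑_{i < N} wᵢ vᵢ*` of rows. -/
def rowInner {s : ℕ} (N : ℕ) (v w : ∀ i, T.Hom i s) : EndAlg T s :=
  ∑ i ∈ Finset.range N, mulAdj (w i) (v i)

/-- The norm of the truncation of a row. -/
def rowNorm {s : ℕ} (N : ℕ) (v : ∀ i, T.Hom i s) : ℝ := √‖rowInner N v v‖

/-- The truncation of a row. -/
def rowTrunc {s : ℕ} (N : ℕ) (v : ∀ i, T.Hom i s) : RowModule T N s := fun i => v i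

theorem rowInner_eq {s : ℕ} (N : ℕ) (v w : ∀ i, T.Hom i s) :
    rowInner N v w = inner (EndAlg T s) (rowTrunc N v) (rowTrunc N w) :=
  Finset.sum_range fun i => mulAdj (w i) (v i)

theorem rowNorm_eq {s : ℕ} (N : ℕ) (v : ∀ i, T.Hom i s) : rowNorm N v = ‖rowTrunc N v‖ := by
  rw [rowNorm, rowInner_eq, ← CStarModule.norm_eq_sqrt_norm_inner_self]

theorem rowNorm_nonneg {s : ℕ} (N : ℕ) (v : ∀ i, T.Hom i s) : 0 ≤ rowNorm N v :=
  Real.sqrt_nonneg _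

theorem rowNorm_sq {s : ℕ} (N : ℕ) (v : ∀ i, T.Hom i s) : rowNorm N v ^ 2 = ‖rowInner N v v‖ :=
  Real.sq_sqrt (norm_nonneg _)

theorem norm_rowInner_le {s : ℕ} (N : ℕ) (v w : ∀ i, T.Hom i s) :
    ‖rowInner N v w‖ ≤ rowNorm N v * rowNorm N w := by
  rw [rowInner_eq, rowNorm_eq, rowNorm_eq]
  exact CStarModule.norm_inner_le _

theorem rowNorm_add_le {s : ℕ} (N : ℕ) (v w : ∀ i, T.Hom i s) :
    rowNorm N (v + w) ≤ rowNorm N v + rowNorm N w := by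
  rw [rowNorm_eq, rowNorm_eq, rowNorm_eq]
  exact CStarModule.norm_triangle (EndAlg T s) _ _

theorem rowNorm_zero {s : ℕ} (N : ℕ) : rowNorm N (0 : ∀ i, T.Hom i s) = 0 := by
  rw [rowNorm_eq]
  exact CStarModule.norm_zero (EndAlg T s)

theorem rowInner_self_nonneg {s : ℕ} (N : ℕ) (v : ∀ i, T.Hom i s) : 0 ≤ rowInner N v v :=
  Finset.sum_nonneg fun i _ => mulAdj_self_nonneg (v i)

theorem rowNorm_mono {s : ℕ} {N M : ℕ} (h : N ≤ M) (v : ∀ i, T.Hom i s) :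
    rowNorm N v ≤ rowNorm M v :=
  Real.sqrt_le_sqrt (CStarAlgebra.norm_le_norm_of_nonneg_of_le (rowInner_self_nonneg N v)
    (Finset.sum_le_sum_of_subset_of_nonneg (Finset.range_mono h)
      fun i _ _ => mulAdj_self_nonneg (v i)))

theorem mulAdj_smul {i s : ℕ} (c d : ℂ) (a b : T.Hom i s) :
    mulAdj (c • a) (d • b) = (c * star d) • mulAdj a b := by
  change T.comp (c • a) (T.adj (d • b)) = (c * star d) • T.comp a (T.adj b)
  simp [smul_smul, mul_comm]

/-- The coefficients may vary with the index as long as their modulus is constant. This covers both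
multiplication by a scalar and the gauge action. -/
theorem rowNorm_smul_apply {s : ℕ} (N : ℕ) (c : ℕ → ℂ) (C : ℝ) (hC : 0 ≤ C) (hc : ∀ i, ‖c i‖ = C)
    (v : ∀ i, T.Hom i s) : rowNorm N (fun i => c i • v i) = C * rowNorm N v := by
  have h : rowInner N (fun i => c i • v i) (fun i => c i • v i) = ((C : ℂ) ^ 2) • rowInner N v v := by
    rw [rowInner, rowInner, Finset.smul_sum]
    refine Finset.sum_congr rfl fun i _ => ?_
    rw [mulAdj_smul]
    congr 1
    have := Complex.mul_conj' (c i)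
    rw [hc] at this
    exact this
  rw [rowNorm, h, norm_smul, rowNorm, Real.sqrt_mul (norm_nonneg _)]
  congr 1
  simp [Real.sqrt_sq, hC]

/-- The reason is `b b* ≤ ‖b‖² 1`, sandwiched between `c` and `c*`. Since `T(i, i)` may have no
unit, the positive element `‖b‖² 1 - b b*` is written as `g* g` in the unitization, and `g = l + g'`
is split into its two components. -/
theorem mulAdj_comp_le {i j s : ℕ} (c : T.Hom i s) (b : T.Hom j i) :
    mulAdj (T.comp c b) (T.comp c b) ≤ (‖b‖ ^ 2 : ℝ) • mulAdj c c := by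
  let A := EndAlg T i
  let h : A := mulAdj b b
  let _ : PartialOrder (Unitization ℂ A) := CStarAlgebra.spectralOrder _
  let _ : StarOrderedRing (Unitization ℂ A) := CStarAlgebra.spectralOrderedRing _
  have hsa : IsSelfAdjoint (h : Unitization ℂ A) := by
    change star (h : Unitization ℂ A) = h
    rw [← Unitization.inr_star, star_mulAdj]
  have h1 := sub_nonneg.2 (IsSelfAdjoint.le_algebraMap_norm_self hsa)
  obtain ⟨g, hg⟩ := CStarAlgebra.nonneg_iff_eq_star_mul_self.1 h1
  have hn : ‖(h : Unitization ℂ A)‖ = ‖b‖ ^ 2 := by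
    rw [Unitization.norm_inr, norm_mulAdj_self]
  rw [hn, sub_eq_add_neg] at hg
  let l : ℂ := g.fst
  let g' : T.Hom i i := g.snd
  have hfst : ((‖b‖ ^ 2 : ℝ) : ℂ) = star l * l := by
    have := congrArg (fun x => x.fst) hg
    simpa [Unitization.algebraMap_eq_inl_comp, Unitization.fst_add, Unitization.fst_neg] using this
  have hsnd : -(T.comp b (T.adj b)) = star l • g' + l • T.adj g' + T.comp (T.adj g') g' := by
    have := congrArg (fun x => x.snd) hg
    simp only [Unitization.algebraMap_eq_inl_comp, Function.comp_apply,
      Unitization.snd_add, Unitization.snd_neg, Unitization.snd_inl,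
      Unitization.snd_inr, Unitization.snd_mul, Unitization.fst_star, Unitization.snd_star,
      zero_add] at this
    exact this
  rw [← sub_nonneg]
  -- The right-hand side is `(c g*) (c g*)*`, with `c g*` written out as `l̄ c + c g'*`.
  have key : (‖b‖ ^ 2 : ℝ) • mulAdj c c - mulAdj (T.comp c b) (T.comp c b) =
      mulAdj (star l • c + T.comp c (T.adj g')) (star l • c + T.comp c (T.adj g')) := by
    have e1 : (‖b‖ ^ 2 : ℝ) • mulAdj c c = (star l * l) • mulAdj c c := by
      rw [← hfst]
      exact (Complex.coe_smul _ _).symm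
    rw [e1]
    have e2 : mulAdj (T.comp c b) (T.comp c b) =
        -(T.comp (T.comp c (-(T.comp b (T.adj b)))) (T.adj c)) := by
      change T.comp (T.comp c b) (T.adj (T.comp c b)) = _
      simp [T.adj_comp, T.comp_assoc]
    rw [e2, hsnd]
    have e3 : (star l * l) • T.comp c (T.adj c) + T.comp (T.comp c (star l • g' + l • T.adj g' +
        T.comp (T.adj g') g')) (T.adj c) = T.comp (star l • c + T.comp c (T.adj g'))
          (T.adj (star l • c + T.comp c (T.adj g'))) := by
      simp only [map_add, T.adj_comp, T.adj_adj, map_smul, LinearMap.map_smulₛₗ,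
        LinearMap.add_apply, LinearMap.smul_apply, T.comp_assoc, smul_add, smul_smul]
      simp only [RCLike.star_def, Complex.conj_conj, mul_comm]
      abel
    exact (sub_neg_eq_add (α := EndAlg T s) _ _).trans e3
  rw [key]
  exact mulAdj_self_nonneg _

end rowModule
-- The operator norm on far rows, an admissible seminorm.
noncomputable section tail
variable {T : RightTensorCStarPrecategory.{u}}

/-- The product of the truncation of a row with a matrix. -/
def rowAct {s : ℕ} (N : ℕ) (v : ∀ i, T.Hom i s) (x : ∀ i j : ℕ, T.Hom j i) (j : ℕ) : T.Hom j s :=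
  ∑ i ∈ Finset.range N, T.comp (v i) (x i j)

/-- The matrix `x` acts with norm at most `C` on finite rows supported on `[k, ∞)`. -/
def TailBound (x : ∀ i j : ℕ, T.Hom j i) (k : ℕ) (C : ℝ) : Prop :=
  0 ≤ C ∧ ∀ (s N : ℕ) (v : ∀ i, T.Hom i s), (∀ i, i < k → v i = 0) → (∀ i, N ≤ i → v i = 0) →
    ∀ M, rowNorm M (rowAct N v x) ≤ C * rowNorm N v

variable {x y : ∀ i j : ℕ, T.Hom j i} {k l r : ℕ} {C D : ℝ}

theorem TailBound.mono (h : TailBound x k C) (hkl : k ≤ l) (hC : C ≤ D) : TailBound x l D :=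
  ⟨h.1.trans hC, fun s N v h1 h2 M => (h.2 s N v (fun i hi => h1 i (by omega)) h2 M).trans
    (mul_le_mul_of_nonneg_right hC (rowNorm_nonneg _ _))⟩

theorem TailBound.add (hx : TailBound x k C) (hy : TailBound y k D) :
    TailBound (x + y) k (C + D) := by
  refine ⟨add_nonneg hx.1 hy.1, fun s N v h1 h2 M => ?_⟩
  have : rowAct N v (x + y) = rowAct N v x + rowAct N v y := by
    funext j
    simp [rowAct, Finset.sum_add_distrib]
  rw [this, add_mul]
  exact (rowNorm_add_le _ _ _).trans (add_le_add (hx.2 s N v h1 h2 M) (hy.2 s N v h1 h2 M))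

theorem TailBound.sum {ι : Type*} {S : Finset ι} {x : ι → ∀ i j : ℕ, T.Hom j i} {C : ι → ℝ}
    (hx : ∀ t ∈ S, TailBound (x t) k (C t)) : TailBound (∑ t ∈ S, x t) k (∑ t ∈ S, C t) := by
  classical
  induction S using Finset.induction_on with
  | empty =>
    refine ⟨le_rfl, fun s N v _ _ M => ?_⟩
    have : rowAct N v (0 : ∀ i j : ℕ, T.Hom j i) = 0 := by
      funext j
      simp [rowAct]
    simp [this, rowNorm_zero]
  | insert t S ht ih =>
    rw [Finset.sum_insert ht, Finset.sum_insert ht]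
    exact (hx t (Finset.mem_insert_self _ _)).add
      (ih fun t' ht' => hx t' (Finset.mem_insert_of_mem ht'))

/-- The matrix is multiplied on the left by the unitary diagonal matrix `d` and on the right by the
diagonal matrix `c`, which is `E` times a unitary one. -/
theorem TailBound.smul_apply (hx : TailBound x k C) {c d : ℕ → ℂ} {E : ℝ} (hE : 0 ≤ E)
    (hc : ∀ i, ‖c i‖ = E) (hd : ∀ i, ‖d i‖ = 1) :
    TailBound (fun i j => (d i * c j) • x i j) k (E * C) := by
  refine ⟨mul_nonneg hE hx.1, fun s N v h1 h2 M => ?_⟩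
  have : rowAct N v (fun i j => (d i * c j) • x i j) =
      fun j => c j • rowAct N (fun i => d i • v i) x j := by
    funext j
    simp [rowAct, Finset.smul_sum, smul_smul, mul_comm]
  rw [this, rowNorm_smul_apply _ _ _ hE hc, mul_assoc]
  refine mul_le_mul_of_nonneg_left ?_ hE
  have h3 := hx.2 s N (fun i => d i • v i) (fun i hi => by rw [h1 i hi, smul_zero])
    (fun i hi => by rw [h2 i hi, smul_zero]) M
  rwa [rowNorm_smul_apply _ _ 1 zero_le_one hd, one_mul] at h3

theorem rowAct_matMul {s N N' : ℕ} (v : ∀ i, T.Hom i s) (hx : IsStable x r) (hN : N + r < N') :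
    rowAct N v (matMul x y) = rowAct N' (rowAct N v x) y := by
  funext j
  simp only [rowAct]
  have e : ∀ i ∈ Finset.range N, T.comp (v i) (matMul x y i j) =
      ∑ l ∈ Finset.range N', T.comp (T.comp (v i) (x i l)) (y l j) := fun i hi => by
    have := Finset.mem_range.1 hi
    rw [matMul_eq_left hx (show i + r < N' by omega), map_sum]
    simp only [T.comp_assoc]
  rw [Finset.sum_congr rfl e, Finset.sum_comm]
  simp

/-- Multiplication by `x` moves the support of a row to the left by at most the width `r` of the
band. This accounts for the starting index `k + r`. -/
theorem TailBound.matMul (hx : TailBound x k C) (hy : TailBound y k D) (hr : IsStable x r) :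
    TailBound (matMul x y) (k + r) (C * D) := by
  refine ⟨mul_nonneg hx.1 hy.1, fun s N v h1 h2 M => ?_⟩
  rw [rowAct_matMul v hr (Nat.lt_succ_self (N + r)), mul_comm C, mul_assoc]
  refine (hy.2 s _ _ (fun j hj => ?_) (fun j hj => ?_) M).trans
    (mul_le_mul_of_nonneg_left (hx.2 s N v (fun i hi => h1 i (by omega)) h2 _) hy.1)
  · refine Finset.sum_eq_zero fun i _ => ?_
    rcases lt_or_ge i (k + r) with h | h
    · rw [h1 i h]; simp
    · rw [hr.1 i j (by omega), map_zero]
  · refine Finset.sum_eq_zero fun i hi => ?_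
    have := Finset.mem_range.1 hi
    rw [hr.2.1 i j (by omega), map_zero]

/-- With `M` beyond the support of `v x`, no term is truncated, and `x*` is the adjoint of the
action of `x`. -/
theorem rowInner_rowAct {s N M : ℕ} (v : ∀ i, T.Hom i s) (hx : IsStable x r) (hM : N + r < M) :
    rowInner M (rowAct N v x) (rowAct N v x) = rowInner N v (rowAct N v (matMul x (matAdj x))) := by
  change (∑ j ∈ Finset.range M, T.comp (rowAct N v x j) (T.adj (rowAct N v x j)) : T.Hom s s) =
    (∑ i ∈ Finset.range N, T.comp (rowAct N v (RightTensorCStarPrecategory.matMul x (matAdj x)) i)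
      (T.adj (v i)) : T.Hom s s)
  rw [rowAct_matMul v hx hM]
  simp only [rowAct, matAdj, map_sum, LinearMap.sum_apply, T.adj_comp, T.comp_assoc]
  rw [Finset.sum_comm]

/-- By Cauchy-Schwarz, `‖v x‖² = ‖⟨v, v x x*⟩‖ ≤ ‖v‖ ‖v x x*‖ ≤ C ‖v‖²`. This is the nontrivial half
of the `C*`-identity. -/
theorem TailBound.sqrt (h : TailBound (RightTensorCStarPrecategory.matMul x (matAdj x)) k C)
    (hx : IsStable x r) : TailBound x k (√C) := by
  refine ⟨Real.sqrt_nonneg _, fun s N v h1 h2 M => ?_⟩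
  refine (rowNorm_mono (show M ≤ M + (N + r + 1) by omega) _).trans ?_
  refine (sq_le_sq₀ (rowNorm_nonneg _ _)
    (mul_nonneg (Real.sqrt_nonneg _) (rowNorm_nonneg _ _))).1 ?_
  rw [mul_pow, Real.sq_sqrt h.1, rowNorm_sq, rowInner_rowAct v hx (by omega), sq, ← mul_assoc,
    mul_comm (C * _)]
  exact (norm_rowInner_le _ _ _).trans
    (mul_le_mul_of_nonneg_left (h.2 s N v h1 h2 N) (rowNorm_nonneg _ _))

theorem mulAdj_sum_of_eq_zero {s j N : ℕ} (w : ℕ → T.Hom j s)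
    (h : ∀ i i', i ≠ i' → w i = 0 ∨ w i' = 0) :
    mulAdj (∑ i ∈ Finset.range N, w i) (∑ i ∈ Finset.range N, w i) =
      ∑ i ∈ Finset.range N, mulAdj (w i) (w i) := by
  change T.comp (∑ i ∈ Finset.range N, w i) (T.adj (∑ i ∈ Finset.range N, w i)) =
    ∑ i ∈ Finset.range N, T.comp (w i) (T.adj (w i))
  rw [map_sum, LinearMap.sum_apply]
  refine Finset.sum_congr rfl fun i hi => ?_
  rw [map_sum, map_sum, Finset.sum_eq_single_of_mem i hi]
  intro i' _ hne
  rcases h i i' hne.symm with h | h <;> simp [h]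

/-- A matrix with at most one nonzero entry in each row and column acts with norm at most the
largest norm of its entries. -/
theorem tailBound_of_monomial {c : ℝ} (hc : 0 ≤ c) (h : ∀ i j, k ≤ i → ‖x i j‖ ≤ c)
    (hcol : ∀ i i' j, i ≠ i' → x i j = 0 ∨ x i' j = 0)
    (hrow : ∀ i j j', j ≠ j' → x i j = 0 ∨ x i j' = 0) : TailBound x k c := by
  refine ⟨hc, fun s N v h1 h2 M => ?_⟩
  refine (sq_le_sq₀ (rowNorm_nonneg _ _) (mul_nonneg hc (rowNorm_nonneg _ _))).1 ?_
  rw [mul_pow, rowNorm_sq, rowNorm_sq]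
  -- Each column of `x` has at most one nonzero entry, so the mixed terms vanish.
  have e : rowInner M (rowAct N v x) (rowAct N v x) = ∑ i ∈ Finset.range N,
      ∑ j ∈ Finset.range M, mulAdj (T.comp (v i) (x i j)) (T.comp (v i) (x i j)) := by
    rw [Finset.sum_comm]
    refine Finset.sum_congr rfl fun j _ => mulAdj_sum_of_eq_zero _ fun i i' hi => ?_
    rcases hcol i i' j hi with h | h <;> simp [h]
  have hle : ∀ i, ∀ j, mulAdj (T.comp (v i) (x i j)) (T.comp (v i) (x i j)) ≤
      (c ^ 2 : ℝ) • mulAdj (v i) (v i) := fun i j => by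
    rcases lt_or_ge i k with hi | hi
    · rw [h1 i hi]
      have e0 : mulAdj (0 : T.Hom i s) 0 = 0 := by
        change T.comp 0 (T.adj (0 : T.Hom i s)) = 0
        simp
      have e1 : T.comp (0 : T.Hom i s) (x i j) = 0 := by simp
      have e2 : mulAdj (0 : T.Hom j s) 0 = 0 := by
        change T.comp 0 (T.adj (0 : T.Hom j s)) = 0
        simp
      rw [e1, e0, e2, smul_zero]
    · exact (mulAdj_comp_le _ _).trans (smul_le_smul_of_nonneg_right
        (pow_le_pow_left₀ (norm_nonneg _) (h i j hi) 2) (mulAdj_self_nonneg _))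
  -- Each row of `x` has at most one nonzero entry, so the sum over `j` has at most one term and no
  -- factor `M` appears.
  have hsum : ∀ i, ∑ j ∈ Finset.range M, mulAdj (T.comp (v i) (x i j)) (T.comp (v i) (x i j)) ≤
      (c ^ 2 : ℝ) • mulAdj (v i) (v i) := fun i => by
    by_cases hex : ∃ j ∈ Finset.range M, x i j ≠ 0
    · obtain ⟨j, hj, hne⟩ := hex
      rw [Finset.sum_eq_single_of_mem j hj]
      · exact hle i j
      · intro j' _ hj'
        rw [(hrow i j j' hj'.symm).resolve_left hne]
        change T.comp (T.comp (v i) 0) _ = 0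
        simp
    · push Not at hex
      rw [Finset.sum_eq_zero]
      · exact smul_nonneg (sq_nonneg c) (mulAdj_self_nonneg _)
      · intro j hj
        rw [hex j hj]
        change T.comp (T.comp (v i) 0) _ = 0
        simp
  have hle' : rowInner M (rowAct N v x) (rowAct N v x) ≤ (c ^ 2 : ℝ) • rowInner N v v := by
    rw [e, rowInner, Finset.smul_sum]
    exact Finset.sum_le_sum fun i _ => hsum i
  refine (CStarAlgebra.norm_le_norm_of_nonneg_of_le (rowInner_self_nonneg _ _) hle').trans_eq ?_
  rw [norm_smul, Real.norm_of_nonneg (sq_nonneg c)]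

theorem norm_add_le_of_rowStable {i j : ℕ} (hx : RowStable x i) (k : ℕ) :
    ‖x (i + k) (j + k)‖ ≤ ‖x i j‖ := by
  induction k with
  | zero => exact le_rfl
  | succ k ih =>
    change ‖x (i + k + 1) (j + k + 1)‖ ≤ _
    rw [(hx _ (by omega)).2]
    exact (T.norm_tensor_le _).trans ih

/-- The `t`-th diagonal of a matrix, counted from distance `r` below the main one. -/
def diagPart (x : ∀ i j : ℕ, T.Hom j i) (r t i j : ℕ) : T.Hom j i :=
  if j + r = i + t then x i j else 0

theorem IsStable.eq_sum_diagPart (hx : IsStable x r) :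
    x = ∑ t ∈ Finset.range (2 * r + 1), diagPart x r t := by
  funext i j
  simp only [Finset.sum_apply, diagPart]
  by_cases h : i ≤ j + r ∧ j ≤ i + r
  · obtain ⟨t, ht⟩ : ∃ t, j + r = i + t := ⟨j + r - i, by omega⟩
    rw [Finset.sum_eq_single_of_mem t (Finset.mem_range.2 (by omega)), if_pos ht]
    intro t' _ ht'
    rw [if_neg (by omega)]
  · have h0 : x i j = 0 := by
      rcases not_and_or.1 h with h | h
      · exact hx.1 _ _ (by omega)
      · exact hx.2.1 _ _ (by omega)
    simp [h0]

/-- A diagonal acts with norm at most the largest norm of its entries. From row `i` on these norms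
decrease along the diagonal, so the entry in row `i` dominates, and one sums over the diagonals. -/
theorem IsStable.tailBound (hx : IsStable x r) {i : ℕ} (hi : 2 * r ≤ i) :
    TailBound x i (∑ᶠ j, ‖x i j‖) := by
  obtain ⟨d, rfl⟩ := Nat.exists_eq_add_of_le (show r ≤ i by omega)
  have e : ∑ᶠ j, ‖x (r + d) j‖ = ∑ t ∈ Finset.range (2 * r + 1), ‖x (r + d) (d + t)‖ := by
    rw [finsum_eq_sum_of_support_subset (s := Finset.range (d + (2 * r + 1))),
      Finset.sum_range_add, Finset.sum_eq_zero, zero_add]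
    · intro j hj
      rw [hx.1 _ _ (by have := Finset.mem_range.1 hj; omega), norm_zero]
    · intro j hj
      rw [Finset.coe_range, Set.mem_Iio]
      by_contra hN
      apply hj
      change ‖x (r + d) j‖ = 0
      rw [hx.2.1 _ j (by omega), norm_zero]
  rw [e]
  have h := TailBound.sum (S := Finset.range (2 * r + 1)) (x := fun t => diagPart x r t)
    (C := fun t => ‖x (r + d) (d + t)‖) (k := r + d) fun t _ => ?_
  · rwa [← hx.eq_sum_diagPart] at h
  · refine tailBound_of_monomial (norm_nonneg _) (fun i j hij => ?_) (fun i i' j hne => ?_)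
      fun i j j' hne => ?_
    · unfold diagPart
      split_ifs with h
      · obtain ⟨p, rfl⟩ := Nat.exists_eq_add_of_le hij
        obtain rfl : j = d + t + p := by omega
        exact norm_add_le_of_rowStable (hx.rowStable (by omega)) p
      · rw [norm_zero]; exact norm_nonneg _
    · unfold diagPart
      by_cases h : j + r = i + t
      · right
        rw [if_neg (by omega)]
      · left
        rw [if_neg h]
    · unfold diagPart
      by_cases h : j + r = i + t
      · right
        rw [if_neg (by omega)]
      · left
        rw [if_neg h]

/-- The bound is tested on the row with single entry `b*` at `i`, where `b` is the entry to be
estimated. Its image has the single entry `b* b`, so `‖b‖² ≤ C ‖b‖`. -/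
theorem TailBound.norm_stableMatrix_le {m n : ℕ} {a : T.Hom m n}
    (h : TailBound (stableMatrix a) k C) {i j : ℕ} (hi : k ≤ i) (hij : i + m = j + n) :
    ‖stableMatrix a i j‖ ≤ C := by
  let b := stableMatrix a i j
  let v : ∀ i', T.Hom i' j := Pi.single i (T.adj b)
  have hv : ∀ i', i' ≠ i → v i' = 0 := fun i' hi' => Pi.single_eq_of_ne hi' _
  have hvi : v i = T.adj b := Pi.single_eq_same _ _
  have h0 : ∀ i', mulAdj (0 : T.Hom i' j) 0 = 0 := fun i' => by
    change T.comp 0 (T.adj (0 : T.Hom i' j)) = 0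
    simp
  have h1 := h.2 j (i + 1) v (fun i' hi' => hv _ (by omega)) (fun i' hi' => hv _ (by omega)) (j + 1)
  have e1 : rowNorm (i + 1) v = ‖b‖ := by
    rw [rowNorm, rowInner, Finset.sum_eq_single i, hvi, norm_mulAdj_self, T.norm_adj,
      Real.sqrt_sq (norm_nonneg _)]
    · intro i' _ hi'
      rw [hv i' hi', h0]
    · intro hn
      exact absurd (Finset.mem_range.2 (Nat.lt_succ_self i)) hn
  have e2 : ∀ j', rowAct (i + 1) v (stableMatrix a) j' = T.comp (T.adj b) (stableMatrix a i j') :=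
    fun j' => by
      rw [rowAct, Finset.sum_eq_single i, hvi]
      · intro i' _ hi'
        rw [hv i' hi']; simp
      · intro hn
        exact absurd (Finset.mem_range.2 (Nat.lt_succ_self i)) hn
  have e3 : rowNorm (j + 1) (rowAct (i + 1) v (stableMatrix a)) = ‖b‖ ^ 2 := by
    rw [rowNorm, rowInner, Finset.sum_eq_single j, norm_mulAdj_self, e2, T.norm_adj_comp_self,
      Real.sqrt_sq (sq_nonneg _)]
    · intro j' _ hj'
      rw [e2, stableMatrix_of_ne a (show i + m ≠ j' + n by omega), map_zero, h0]
    · intro hn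
      exact absurd (Finset.mem_range.2 (Nat.lt_succ_self j)) hn
  rw [e1, e3] at h1
  change ‖b‖ ≤ C
  have h2 := norm_nonneg b
  have h3 := h.1
  rcases eq_or_lt_of_le h2 with h4 | h4
  · rwa [← h4]
  · nlinarith

/-- The norm of the action of a stable matrix on far rows. -/
def tailNorm (x : PreDR T) : ℝ := sInf {C | ∃ k, TailBound x.mat k C}

theorem bddBelow_tailBound (x : PreDR T) : BddBelow {C | ∃ k, TailBound x.mat k C} :=
  ⟨0, fun _ ⟨_, h⟩ => h.1⟩

theorem TailBound.tailNorm_le {x : PreDR T} (h : TailBound x.mat k C) : tailNorm x ≤ C :=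
  csInf_le (bddBelow_tailBound x) ⟨k, h⟩

theorem exists_tailBound {x : PreDR T} (h : tailNorm x < C) : ∃ k, TailBound x.mat k C := by
  obtain ⟨r, hr⟩ := x.stable
  obtain ⟨D, ⟨k, hD⟩, hlt⟩ := exists_lt_of_csInf_lt
    (show {C | ∃ k, TailBound x.mat k C}.Nonempty from ⟨_, _, hr.tailBound le_rfl⟩) h
  exact ⟨k, hD.mono le_rfl hlt.le⟩

theorem tailNorm_nonneg (x : PreDR T) : 0 ≤ tailNorm x :=
  Real.sInf_nonneg fun _ ⟨_, h⟩ => h.1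

theorem tailNorm_add_le (x y : PreDR T) : tailNorm (x + y) ≤ tailNorm x + tailNorm y := by
  refine le_of_forall_pos_le_add fun ε hε => ?_
  obtain ⟨k, hk⟩ := exists_tailBound (show tailNorm x < tailNorm x + ε / 2 by linarith)
  obtain ⟨l, hl⟩ := exists_tailBound (show tailNorm y < tailNorm y + ε / 2 by linarith)
  have := TailBound.tailNorm_le (x := x + y)
    ((hk.mono (le_max_left k l) le_rfl).add (hl.mono (le_max_right k l) le_rfl))
  linarith

theorem tailNorm_smul_le (c : ℂ) (x : PreDR T) : tailNorm (c • x) ≤ ‖c‖ * tailNorm x := by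
  refine le_of_forall_pos_le_add fun ε hε => ?_
  have h0 : 0 < ‖c‖ + 1 := by positivity
  obtain ⟨k, hk⟩ := exists_tailBound (show tailNorm x < tailNorm x + ε / (‖c‖ + 1) by
    have : 0 < ε / (‖c‖ + 1) := by positivity
    linarith)
  have h1 := hk.smul_apply (norm_nonneg c) (c := fun _ => c) (d := fun _ => 1) (fun _ => rfl)
    fun _ => norm_one
  simp only [one_mul] at h1
  refine (TailBound.tailNorm_le (x := c • x) h1).trans ?_
  rw [mul_add]
  gcongr
  rw [mul_div_assoc', div_le_iff₀ h0]
  nlinarith [norm_nonneg c]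

theorem tailNorm_preMul_le (x y : PreDR T) : tailNorm (preMul x y) ≤ tailNorm x * tailNorm y := by
  have hc : Filter.Tendsto (fun δ : ℝ => (tailNorm x + δ) * (tailNorm y + δ))
      (nhdsWithin 0 (Set.Ioi 0)) (nhds (tailNorm x * tailNorm y)) := by
    have : Continuous (fun δ : ℝ => (tailNorm x + δ) * (tailNorm y + δ)) := by fun_prop
    simpa using (this.tendsto 0).mono_left nhdsWithin_le_nhds
  refine ge_of_tendsto hc (Filter.eventually_of_mem self_mem_nhdsWithin fun δ hδ => ?_)
  obtain ⟨r, hr⟩ := x.stable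
  have hδ : 0 < δ := hδ
  obtain ⟨k, hk⟩ := exists_tailBound (show tailNorm x < tailNorm x + δ by linarith)
  obtain ⟨l, hl⟩ := exists_tailBound (show tailNorm y < tailNorm y + δ by linarith)
  exact TailBound.tailNorm_le (x := preMul x y)
    ((hk.mono (le_max_left k l) le_rfl).matMul (hl.mono (le_max_right k l) le_rfl) hr)

theorem tailNorm_sq_le (x : PreDR T) : tailNorm x ^ 2 ≤ tailNorm (preMul x (preAdj x)) := by
  refine le_of_forall_pos_le_add fun ε hε => ?_
  obtain ⟨r, hr⟩ := x.stable
  obtain ⟨k, hk⟩ := exists_tailBound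
    (show tailNorm (preMul x (preAdj x)) < tailNorm (preMul x (preAdj x)) + ε by linarith)
  have h1 := TailBound.tailNorm_le (hk.sqrt hr)
  calc tailNorm x ^ 2 ≤ √(tailNorm (preMul x (preAdj x)) + ε) ^ 2 :=
        pow_le_pow_left₀ (tailNorm_nonneg _) h1 2
    _ = _ := Real.sq_sqrt hk.1

/-- From `‖y‖² ≤ ‖y y*‖ ≤ ‖y‖ ‖y*‖` it follows that the involution is isometric, and then both
inequalities of the `C*`-identity are available. -/
theorem tailNorm_preAdj_preMul (x : PreDR T) : tailNorm (preMul (preAdj x) x) = tailNorm x ^ 2 := by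
  have key : ∀ y : PreDR T, tailNorm y ≤ tailNorm (preAdj y) := fun y => by
    have h1 := (tailNorm_sq_le y).trans (tailNorm_preMul_le y (preAdj y))
    have h2 := tailNorm_nonneg y
    have h3 := tailNorm_nonneg (preAdj y)
    rcases eq_or_lt_of_le h2 with h4 | h4
    · rwa [← h4]
    · nlinarith
  have e : tailNorm (preAdj x) = tailNorm x :=
    le_antisymm ((key (preAdj x)).trans_eq (by rw [preAdj_preAdj])) (key x)
  refine le_antisymm ((tailNorm_preMul_le _ _).trans_eq (by rw [e, sq])) ?_
  have := tailNorm_sq_le (preAdj x)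
  rwa [preAdj_preAdj, e] at this

/-- Since `z ^ (j - i) = z ^ (-i) * z ^ j`, the gauge action is conjugation by a unitary diagonal
matrix. -/
theorem tailNorm_preGauge_le (z : Circle) (x : PreDR T) : tailNorm (preGauge z x) ≤ tailNorm x := by
  refine le_of_forall_pos_le_add fun ε hε => ?_
  obtain ⟨k, hk⟩ := exists_tailBound (show tailNorm x < tailNorm x + ε by linarith)
  have h1 := hk.smul_apply zero_le_one (c := fun j => (z : ℂ) ^ (j : ℤ))
    (d := fun i => (z : ℂ) ^ (-(i : ℤ))) (fun _ => CoisometricRep.norm_zpow_circle _ _)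
    fun _ => CoisometricRep.norm_zpow_circle _ _
  rw [one_mul] at h1
  have e : (fun i j : ℕ => ((z : ℂ) ^ (-(i : ℤ)) * (z : ℂ) ^ (j : ℤ)) • x.mat i j) =
      (preGauge z x).mat := by
    funext i j
    rw [mat_preGauge, ← zpow_add₀ z.coe_ne_zero]
    congr 2
    ring
  rw [e] at h1
  exact h1.tailNorm_le

theorem preGauge_inv_preGauge (z : Circle) (x : PreDR T) : preGauge z⁻¹ (preGauge z x) = x := by
  rw [CoisometricRep.preGauge_preGauge, inv_mul_cancel, CoisometricRep.preGauge_one]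

variable (T) in
/-- The norm of the action on far rows, as a seminorm. -/
def tailSeminorm : Seminorm ℂ (PreDR T) :=
  Seminorm.of tailNorm tailNorm_add_le fun c x => by
    refine le_antisymm (tailNorm_smul_le c x) ?_
    rcases eq_or_ne c 0 with rfl | hc
    · simpa using tailNorm_nonneg _
    · have h := tailNorm_smul_le c⁻¹ (c • x)
      rw [smul_smul, inv_mul_cancel₀ hc, one_smul, norm_inv] at h
      rwa [← div_eq_inv_mul, le_div_iff₀' (norm_pos_iff.2 hc)] at h

variable (T) in
theorem isAdmissible_tailSeminorm : IsAdmissible (tailSeminorm T) where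
  mul_le := tailNorm_preMul_le
  adj_mul_self := tailNorm_preAdj_preMul
  gauge z x := le_antisymm (tailNorm_preGauge_le z x) (by
    have := tailNorm_preGauge_le z⁻¹ (preGauge z x)
    rwa [preGauge_inv_preGauge] at this)
  le_row x r hr i hi := (hr.tailBound hi).tailNorm_le

/-- If `i_{(n,m)}(a)` is small then so is some `a ⊗ 1ᵏ`. -/
theorem exists_norm_tensorPow_le {m n : ℕ} (a : T.Hom m n) {ε : ℝ} (h : ‖toDR T n m a‖ < ε) :
    ∃ k, ‖T.tensorPow k a‖ ≤ ε := by
  rw [toDR_eq, PreDR.norm_toDR] at h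
  obtain ⟨k, hk⟩ := exists_tailBound (((isAdmissible_tailSeminorm T).le _).trans_lt h)
  refine ⟨k, ?_⟩
  rw [← stableMatrix_add]
  exact TailBound.norm_stableMatrix_le hk (by omega) (by omega)

end tail
-- Kernels of representations, and quotients and ranges for `C*`-algebras.
noncomputable section quotients

/-- A `C*`-algebra `A`, as the precategory with all morphism spaces `A` and `⊗ 1` the identity. -/
def constPrecategory (A : Type u) [NonUnitalCStarAlgebra A] : RightTensorCStarPrecategory.{u} where
  Hom _ _ := A
  comp := LinearMap.mul ℂ A
  comp_assoc := mul_assoc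
  norm_comp_le := norm_mul_le
  adj := (starLinearEquiv ℂ : A ≃ₗ⋆[ℂ] A).toLinearMap
  adj_adj := star_star
  adj_comp := star_mul
  norm_adj_comp_self a := by
    rw [sq]
    exact CStarRing.norm_star_mul_self
  adj_comp_self_pos a := ⟨a, rfl⟩
  tensor := LinearMap.id
  tensor_comp _ _ := rfl
  tensor_adj _ := rfl

variable {T : RightTensorCStarPrecategory.{u}} {B : Type v} [NonUnitalCStarAlgebra B]

namespace CoisometricRep
variable (ρ : CoisometricRep T B)

theorem continuous_map {m n : ℕ} : Continuous (ρ.map n m) :=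
  AddMonoidHomClass.continuous_of_bound (ρ.map n m) 1 fun a => by
    rw [one_mul]; exact ρ.norm_map_le a

/-- The kernel of a representation. -/
def kerIdeal : T.Ideal where
  carrier m n := LinearMap.ker (ρ.map n m)
  isClosed m n := isClosed_singleton.preimage ρ.continuous_map
  comp_left a b hb := by
    rw [LinearMap.mem_ker] at hb ⊢
    rw [ρ.map_comp, hb, mul_zero]
  comp_right b ha := by
    rw [LinearMap.mem_ker] at ha ⊢
    rw [ρ.map_comp, ha, zero_mul]

theorem mem_kerIdeal {m n : ℕ} {a : T.Hom m n} :
    a ∈ ρ.kerIdeal.carrier m n ↔ ρ.map n m a = 0 := Iff.rfl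

theorem kerIdeal_invariant : ρ.kerIdeal.Invariant := fun m n a ha => by
  rw [mem_kerIdeal] at ha ⊢
  rw [ρ.map_tensor, ha]

/-- Coisometry gives `a` and `a ⊗ 1` the same image, so one is in the kernel exactly when the other
is. The two implications are invariance and saturation. -/
theorem kerIdeal_saturated : ρ.kerIdeal.Saturated ⊤ := fun m n a _ ha => by
  rw [mem_kerIdeal] at ha ⊢
  rw [← ρ.map_tensor, ha]

/-- The faithful representation of the quotient by the kernel. -/
def quotRep : CoisometricRep (ρ.kerIdeal.quotient ρ.kerIdeal_invariant) B where
  map n m := (ρ.kerIdeal.carrier m n).liftQ (ρ.map n m) le_rfl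
  map_adj a := by
    induction a using Submodule.Quotient.induction_on with
    | H a => exact ρ.map_adj a
  map_comp a b := by
    induction a using Submodule.Quotient.induction_on with
    | H a =>
      induction b using Submodule.Quotient.induction_on with
      | H b => exact ρ.map_comp a b
  map_tensor a := by
    induction a using Submodule.Quotient.induction_on with
    | H a => exact ρ.map_tensor a

theorem norm_quotRep {m n : ℕ} (a : (ρ.kerIdeal.quotient ρ.kerIdeal_invariant).Hom m n) :
    ‖ρ.quotRep.map n m a‖ = ‖a‖ := by
  refine ρ.quotRep.norm_map_of_injective (fun {m} a ha => ?_) a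
  induction a using Submodule.Quotient.induction_on with
  | H a => exact (Submodule.Quotient.mk_eq_zero _).2 ha

/-- The quotient by the kernel is represented isometrically, so `‖ρ.map n m a‖` is the distance from
`a` to the kernel. -/
theorem exists_mem_kerIdeal {m n : ℕ} {a : T.Hom m n} {ε : ℝ} (h : ‖ρ.map n m a‖ < ε) :
    ∃ b ∈ ρ.kerIdeal.carrier m n, ‖a - b‖ < ε := by
  have h1 : ‖(Submodule.Quotient.mk a : T.Hom m n ⧸ ρ.kerIdeal.carrier m n)‖ < ε :=
    (ρ.norm_quotRep (Submodule.Quotient.mk a)).symm.trans_lt h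
  obtain ⟨w, hw, hwn⟩ := Submodule.Quotient.norm_mk_lt
    (Submodule.Quotient.mk a : T.Hom m n ⧸ ρ.kerIdeal.carrier m n) (sub_pos.2 h1)
  refine ⟨a - w, ?_, ?_⟩
  · rw [← Submodule.Quotient.mk_eq_zero, Submodule.Quotient.mk_sub, hw, sub_self]
  · rw [sub_sub_cancel]
    linarith

/-- A `*`-homomorphism, as a representation of the constant precategory. -/
def ofHom {A : Type u} [NonUnitalCStarAlgebra A] (f : A →⋆ₙₐ[ℂ] B) :
    CoisometricRep (constPrecategory A) B where
  map _ _ := (f : A →ₗ[ℂ] B)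
  map_adj a := map_star f (show A from a)
  map_comp a b := map_mul f (show A from a) (show A from b)
  map_tensor _ := rfl

end CoisometricRep

/-- Regarding `A` as a constant precategory, `f` factors through the quotient by its kernel as an
isometry of a complete space, whose range is closed. -/
theorem isClosed_range_starHom {A : Type u} [NonUnitalCStarAlgebra A] (f : A →⋆ₙₐ[ℂ] B) :
    IsClosed (Set.range f) := by
  let ρ := CoisometricRep.ofHom f
  let g := ρ.quotRep.map 0 0
  have hg : Isometry g := AddMonoidHomClass.isometry_of_norm g fun a => ρ.norm_quotRep a
  have hr : Set.range f = Set.range g := by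
    ext y
    constructor
    · rintro ⟨x, rfl⟩
      exact ⟨Submodule.Quotient.mk x, rfl⟩
    · rintro ⟨x, rfl⟩
      induction x using Submodule.Quotient.induction_on with
      | H x => exact ⟨x, rfl⟩
  rw [hr]
  exact hg.isClosedEmbedding.isClosed_range

section
variable {A : Type u} [NonUnitalCStarAlgebra A] (P : Submodule ℂ A) (hP : IsClosed (P : Set A))
  (hl : ∀ (x : A) {y : A}, y ∈ P → x * y ∈ P) (hr : ∀ {x : A} (y : A), x ∈ P → x * y ∈ P)

/-- A closed two-sided ideal of a `C*`-algebra, as an ideal of the constant precategory. -/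
def constIdeal : (constPrecategory A).Ideal where
  carrier _ _ := P
  isClosed _ _ := hP
  comp_left a _ hb := hl a hb
  comp_right b ha := hr b ha

/-- The quotient of a `C*`-algebra by a closed two-sided ideal. -/
def QuotAlg : Type u :=
  ((constIdeal P hP hl hr).quotient (fun _ _ _ h => h)).Hom 0 0

instance : NonUnitalCStarAlgebra (QuotAlg P hP hl hr) :=
  ((constIdeal P hP hl hr).quotient (fun _ _ _ h => h)).endCStarAlgebra 0

/-- The quotient map. -/
def quotHom : A →⋆ₙₐ[ℂ] QuotAlg P hP hl hr where
  toFun := P.mkQ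
  map_smul' _ _ := map_smul P.mkQ _ _
  map_zero' := map_zero P.mkQ
  map_add' := map_add P.mkQ
  map_mul' _ _ := rfl
  map_star' _ := rfl

theorem quotHom_eq_zero {x : A} : quotHom P hP hl hr x = 0 ↔ x ∈ P :=
  Submodule.Quotient.mk_eq_zero P

end
end quotients

/-! ### Fourier analysis of the gauge action, and recovery of gauge-invariant ideals. -/

noncomputable section spectral
open MeasureTheory AddCircle
variable {T : RightTensorCStarPrecategory.{u}}

theorem norm_gauge_le (z : Circle) (x : DR T) : ‖gauge T z x‖ ≤ ‖x‖ :=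
  NonUnitalStarAlgHom.norm_apply_le _ _

/-- On stable matrices the orbit is a trigonometric polynomial. The gauge maps are contractive, so a
general orbit is a uniform limit of such orbits. -/
theorem continuous_gauge (x : DR T) : Continuous fun z : Circle => gauge T z x := by
  apply continuous_of_uniform_approx_of_continuous
  intro u hu
  obtain ⟨ε, hε, hu⟩ := Metric.mem_uniformity_dist.1 hu
  obtain ⟨y, hy⟩ := PreDR.denseRange_toDR.exists_dist_lt x hε
  refine ⟨fun z => gauge T z y.toDR, ?_, fun z => hu ?_⟩
  · obtain ⟨r, hr⟩ := y.stable
    simp only [PreDR.toDR_eq_sum hr le_rfl (Nat.lt_succ_self _), map_sum, gauge_toDR]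
    refine continuous_finsetSum _ fun j _ => ?_
    have h : Continuous fun z : Circle => (z : ℂ) ^ ((j : ℤ) - ((2 * r : ℕ) : ℤ)) :=
      Continuous.zpow₀ continuous_subtype_val _ fun z => Or.inl (Circle.coe_ne_zero z)
    exact h.smul continuous_const
  · rw [dist_eq_norm, ← map_sub]
    refine (norm_gauge_le z _).trans_lt ?_
    rwa [← dist_eq_norm]

/-- The orbit map of the gauge action, on the additive circle. -/
def orbit (x : DR T) (t : UnitAddCircle) : DR T := gauge T (toCircle t) x

theorem continuous_orbit (x : DR T) : Continuous (orbit x) :=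
  (continuous_gauge x).comp continuous_toCircle

theorem integrable_fourier_orbit (x : DR T) (k : ℤ) :
    Integrable (fun t : UnitAddCircle => fourier k t • orbit x t) haarAddCircle := by
  have hc : Continuous fun t : UnitAddCircle => fourier k t • orbit x t :=
    (map_continuous (fourier k)).smul (continuous_orbit x)
  exact hc.integrable_of_hasCompactSupport (HasCompactSupport.of_compactSpace _)

/-- The spectral component of degree `k` for the gauge action. -/
def spec (k : ℤ) (x : DR T) : DR T := fourierCoeff (orbit x) k

theorem spec_add (k : ℤ) (x y : DR T) : spec k (x + y) = spec k x + spec k y := by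
  rw [spec, spec, spec, fourierCoeff, fourierCoeff, fourierCoeff,
    ← integral_add (integrable_fourier_orbit _ _) (integrable_fourier_orbit _ _)]
  congr 1
  funext t
  rw [← smul_add]
  congr 1
  exact map_add _ _ _

theorem spec_sum (k : ℤ) {ι : Type*} (S : Finset ι) (x : ι → DR T) :
    spec k (∑ i ∈ S, x i) = ∑ i ∈ S, spec k (x i) :=
  map_sum (AddMonoidHom.mk' (spec k) (spec_add k)) x S

theorem norm_spec_le (k : ℤ) (x : DR T) : ‖spec k x‖ ≤ ‖x‖ := by
  refine (norm_integral_le_of_norm_le_const (μ := haarAddCircle) (C := ‖x‖)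
    (Filter.Eventually.of_forall fun t => ?_)).trans_eq ?_
  · rw [norm_smul, fourier_apply, Circle.norm_coe, one_mul]
    exact norm_gauge_le _ _
  · simp

/-- The orbit of `i_{(n,m)}(a)` is this element multiplied by the character of degree `m - n`, and
characters are orthonormal. -/
theorem spec_toDR (k : ℤ) {m n : ℕ} (a : T.Hom m n) :
    spec k (toDR T n m a) = if k = (m : ℤ) - n then toDR T n m a else 0 := by
  have h : ∀ t : UnitAddCircle, fourier (-k) t • orbit (toDR T n m a) t =
      (fourier (-k) t • fourier ((m : ℤ) - n) t) • toDR T n m a := fun t => by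
    rw [orbit, gauge_toDR, smul_smul, smul_eq_mul]
    congr 2
    rw [fourier_apply, toCircle_zsmul, Circle.coe_zpow]
  have h2 := congrFun (fourierCoeff_fourier (T := 1) ((m : ℤ) - n)) k
  rw [fourierCoeff] at h2
  rw [spec, fourierCoeff]
  simp only [h]
  rw [integral_smul_const, h2, Pi.single_apply, ite_smul, one_smul, zero_smul]

/-- The map `spec k` is contractive, so `x` may be replaced by a stable matrix. A far row of that
matrix meets the diagonal of degree `k` at most once, so a single morphism suffices. -/
theorem exists_norm_spec_sub_lt (k : ℤ) (x : DR T) {ε : ℝ} (hε : 0 < ε) :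
    ∃ (n m : ℕ) (a : T.Hom m n), ‖spec k x - toDR T n m a‖ < ε := by
  obtain ⟨y, hy⟩ := PreDR.denseRange_toDR.exists_dist_lt x hε
  rw [dist_eq_norm] at hy
  have h1 : ‖spec k x - spec k y.toDR‖ < ε := by
    have := spec_add k (x - y.toDR) y.toDR
    rw [sub_add_cancel] at this
    rw [this, add_sub_cancel_right]
    exact (norm_spec_le _ _).trans_lt hy
  suffices h : ∃ (n m : ℕ) (a : T.Hom m n), spec k y.toDR = toDR T n m a by
    obtain ⟨n, m, a, h⟩ := h
    exact ⟨n, m, a, by rwa [← h]⟩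
  obtain ⟨r, hr⟩ := y.stable
  rw [PreDR.toDR_eq_sum hr le_rfl (Nat.lt_succ_self _), spec_sum]
  simp only [spec_toDR]
  by_cases h : ∃ j ∈ Finset.range (2 * r + r).succ, k = (j : ℤ) - (2 * r : ℕ)
  · obtain ⟨j, hj, hk⟩ := h
    refine ⟨2 * r, j, y.mat (2 * r) j, ?_⟩
    rw [Finset.sum_eq_single_of_mem j hj, if_pos hk]
    intro j' _ hj'
    rw [if_neg (by omega)]
  · push Not at h
    -- The diagonal of degree `k` misses the band, so the component is zero and the zero morphism
    -- represents it.
    refine ⟨0, 0, 0, ?_⟩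
    rw [map_zero, Finset.sum_eq_zero]
    intro j hj
    rw [if_neg (h j hj)]

theorem continuousLinearMap_spec {E : Type*} [NormedAddCommGroup E] [NormedSpace ℂ E]
    [CompleteSpace E] (f : DR T →L[ℂ] E) (k : ℤ) (x : DR T) :
    f (spec k x) = fourierCoeff (fun t => f (orbit x t)) k := by
  rw [spec, fourierCoeff, fourierCoeff, ← f.integral_comp_comm (integrable_fourier_orbit x (-k))]
  simp

/-- Vanishing coefficients are summable, so the Fourier series converges to `F`; but all its terms
are zero. -/
theorem eq_zero_of_fourierCoeff_eq_zero {F : C(UnitAddCircle, ℂ)} (h : fourierCoeff F = 0) :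
    F = 0 := by
  have h1 := hasSum_fourier_series_of_summable (f := F) (by rw [h]; exact summable_zero)
  have h2 : (fun i : ℤ => fourierCoeff F i • (fourier i : C(UnitAddCircle, ℂ))) = fun _ => 0 := by
    funext i
    rw [h]
    exact zero_smul ℂ (fourier i : C(UnitAddCircle, ℂ))
  rw [h2] at h1
  exact h1.unique hasSum_zero

theorem gauge_one (x : DR T) : gauge T 1 x = x := by
  refine congrFun (congrArg DFunLike.coe (DR.hom_ext (f := gauge T 1)
    (g := NonUnitalStarAlgHom.id ℂ (DR T)) fun n m a => ?_)) x
  rw [gauge_toDR, Circle.coe_one, one_zpow, one_smul]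
  rfl

/-- Otherwise Hahn-Banach in the quotient by `S` gives a functional `f` with `f = 0` on `S` and `f x
≠ 0`. The scalar function `t ↦ f (orbit x t)` is continuous with vanishing Fourier coefficients,
hence zero, and at `t = 0` its value is `f x`. -/
theorem mem_of_spec_mem (S : Submodule ℂ (DR T)) (hS : IsClosed (S : Set (DR T))) {x : DR T}
    (h : ∀ k, spec k x ∈ S) : x ∈ S := by
  by_contra hx
  have h0 : ‖(S.mkQL x : DR T ⧸ S)‖ ≠ 0 := by
    rw [norm_ne_zero_iff]
    exact fun h0 => hx ((Submodule.Quotient.mk_eq_zero S).1 h0)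
  obtain ⟨g, -, hg⟩ := exists_dual_vector ℂ (S.mkQL x) h0
  let f : DR T →L[ℂ] ℂ := g.comp S.mkQL
  have hf : ∀ y ∈ S, f y = 0 := fun y hy => by
    have : S.mkQL y = 0 := (Submodule.Quotient.mk_eq_zero S).2 hy
    change g (S.mkQL y) = 0
    rw [this, map_zero]
  let F : C(UnitAddCircle, ℂ) := ⟨fun t => f (orbit x t), f.continuous.comp (continuous_orbit x)⟩
  have hF : fourierCoeff F = 0 := by
    funext k
    exact (continuousLinearMap_spec f k x).symm.trans (hf _ (h k))
  have h2 : f (orbit x 0) = 0 := DFunLike.congr_fun (eq_zero_of_fourierCoeff_eq_zero hF) 0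
  rw [orbit, toCircle_zero, gauge_one] at h2
  exact h0 (Complex.ofReal_eq_zero.1 (hg.symm.trans h2))

namespace IsGaugeInvariantIdeal
variable {P : Submodule ℂ (DR T)} (hP : IsGaugeInvariantIdeal P)

/-- The quotient map of `DR(T)` by a gauge invariant ideal. -/
def quotHom : DR T →⋆ₙₐ[ℂ] QuotAlg P hP.isClosed hP.mul_mem_left hP.mul_mem_right :=
  RightTensorCStarPrecategory.quotHom P hP.isClosed hP.mul_mem_left hP.mul_mem_right

theorem quotHom_eq_zero {x : DR T} : hP.quotHom x = 0 ↔ x ∈ P :=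
  RightTensorCStarPrecategory.quotHom_eq_zero _ _ _ _

/-- The representation `T → DR(T) / P`. -/
def quotRep : CoisometricRep T (QuotAlg P hP.isClosed hP.mul_mem_left hP.mul_mem_right) :=
  (CoisometricRep.univ T).compHom hP.quotHom

/-- The preimage of `P` in `T`. -/
def preimage : T.Ideal := hP.quotRep.kerIdeal

theorem mem_preimage {m n : ℕ} {a : T.Hom m n} :
    a ∈ hP.preimage.carrier m n ↔ toDR T n m a ∈ P := hP.quotHom_eq_zero

/-- The orbit of `x` stays in `P`, and the quotient map, being continuous and linear, passes through
the integral. -/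
theorem spec_mem (hP : IsGaugeInvariantIdeal P) {x : DR T} (hx : x ∈ P) (k : ℤ) : spec k x ∈ P := by
  rw [← hP.quotHom_eq_zero]
  let f : DR T →L[ℂ] QuotAlg P hP.isClosed hP.mul_mem_left hP.mul_mem_right :=
    ⟨(hP.quotHom : DR T →ₗ[ℂ] _), continuous_starHom hP.quotHom⟩
  refine (continuousLinearMap_spec f k x).trans ?_
  have : (fun t => f (orbit x t)) = 0 := by
    funext t
    exact hP.quotHom_eq_zero.2 (hP.gauge_mem _ hx)
  rw [this, fourierCoeff]
  simp

/-- It suffices to approximate each spectral component by elements of the preimage, since `O` of the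
preimage is closed. -/
theorem le_spanDR (hP : IsGaugeInvariantIdeal P) : P ≤ hP.preimage.spanDR := by
  intro x hx
  refine mem_of_spec_mem _ (Submodule.isClosed_topologicalClosure _) fun k => ?_
  have hcl : IsClosed (hP.preimage.spanDR : Set (DR T)) := Submodule.isClosed_topologicalClosure _
  change spec k x ∈ (hP.preimage.spanDR : Set (DR T))
  rw [← hcl.closure_eq, Metric.mem_closure_iff]
  intro ε hε
  obtain ⟨n, m, a, ha⟩ := exists_norm_spec_sub_lt k x (half_pos hε)
  have h1 : ‖hP.quotRep.map n m a‖ < ε / 2 := by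
    have h2 : hP.quotRep.map n m a = hP.quotHom (-(spec k x - toDR T n m a)) := by
      rw [neg_sub, map_sub, hP.quotHom_eq_zero.2 (hP.spec_mem hx k), sub_zero]
      rfl
    rw [h2]
    refine (NonUnitalStarAlgHom.norm_apply_le _ _).trans_lt ?_
    rwa [norm_neg]
  -- The approximant `a` need not lie in the preimage of `P`, but its image modulo `P` is small, so
  -- it can be corrected to some `b` that does.
  obtain ⟨b, hb, hab⟩ := hP.quotRep.exists_mem_kerIdeal h1
  refine ⟨toDR T n m b, ?_, ?_⟩
  · refine Submodule.le_topologicalClosure _ (Submodule.subset_span ?_)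
    exact Set.mem_iUnion₂.2 ⟨n, m, b, hb, rfl⟩
  · rw [dist_eq_norm]
    calc ‖spec k x - toDR T n m b‖ = ‖(spec k x - toDR T n m a) + toDR T n m (a - b)‖ := by
          rw [map_sub]; congr 1; abel
      _ ≤ ‖spec k x - toDR T n m a‖ + ‖a - b‖ :=
          (norm_add_le _ _).trans (add_le_add_right (norm_toDR_le _) _)
      _ < ε := by linarith

theorem spanDR_preimage : hP.preimage.spanDR = P := by
  refine le_antisymm ?_ hP.le_spanDR
  refine Submodule.topologicalClosure_minimal _ (Submodule.span_le.2 ?_) hP.isClosed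
  intro x hx
  obtain ⟨n, m, a, ha, rfl⟩ := Set.mem_iUnion₂.1 hx
  exact hP.mem_preimage.1 ha

end IsGaugeInvariantIdeal
end spectral
-- Universality of `DR(T)`, gauge actions, and the correspondence of ideals.
noncomputable section correspondence
variable {T : RightTensorCStarPrecategory.{u}} {B : Type v} [NonUnitalCStarAlgebra B]

/-- A coisometric representation of the improper ideal, as a representation of `T`. -/
def CoisometricRep.ofFamily {π : RepFamily (⊤ : T.Ideal) B} (hπ : π.IsRightTensorRep)
    (hc : π.IsCoisometricOn ⊤) : CoisometricRep T B where
  map n m := π n m ∘ₗ (LinearMap.id.codRestrict _ fun _ => trivial)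
  map_adj a := (hπ.star_apply ⟨a, trivial⟩).symm
  map_comp a b := (hπ.mul_apply ⟨a, trivial⟩ ⟨b, trivial⟩).symm
  map_tensor a := (hc a trivial trivial trivial).symm

theorem CoisometricRep.map_stableMatrix (ρ : CoisometricRep T B) {m n : ℕ} (a : T.Hom m n)
    {i j : ℕ} (hi : n ≤ i) (hj : i + m = j + n) : ρ.map i j (stableMatrix a i j) = ρ.map n m a := by
  rw [← ρ.lift_toDR, ← ρ.lift_toDR, toDR_stableMatrix a hi hj]

/-- A representation of `T` as a family of maps on the improper ideal. -/
def CoisometricRep.family (ρ : CoisometricRep T B) : RepFamily (⊤ : T.Ideal) B :=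
  fun n m => ρ.map n m ∘ₗ Submodule.subtype _

theorem CoisometricRep.isRightTensorRep_family (ρ : CoisometricRep T B) :
    ρ.family.IsRightTensorRep where
  star_apply a := (ρ.map_adj a.1).symm
  mul_apply a b := (ρ.map_comp a.1 b.1).symm
  mul_tensor_apply {k l m n} a b := by
    change ρ.map n m a.1 * ρ.map (m + k) l b.1 = ρ.map (n + k) l (T.comp (T.tensorPow k a.1) b.1)
    rw [ρ.map_comp, ← stableMatrix_add, ρ.map_stableMatrix _ (by omega) (by omega)]

theorem CoisometricRep.isCoisometricOn_family (ρ : CoisometricRep T B) :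
    ρ.family.IsCoisometricOn ⊤ := fun a _ _ _ => (ρ.map_tensor a).symm

theorem RepFamily.mem_generatedAlgebra {K : T.Ideal} (π : RepFamily K B) {n m : ℕ}
    (a : K.carrier m n) : π n m a ∈ π.generatedAlgebra :=
  NonUnitalStarSubalgebra.le_topologicalClosure _ (NonUnitalStarAlgebra.subset_adjoin ℂ _
    (Set.mem_iUnion₂.2 ⟨n, m, a, rfl⟩))

theorem RepFamily.isClosed_generatedAlgebra {K : T.Ideal} (π : RepFamily K B) :
    IsClosed (π.generatedAlgebra : Set B) :=
  NonUnitalStarSubalgebra.isClosed_topologicalClosure _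

theorem DR.apply_mem {f : DR T →⋆ₙₐ[ℂ] B} (S : Submodule ℂ B) (hS : IsClosed (S : Set B))
    (h : ∀ (n m : ℕ) (a : T.Hom m n), f (toDR T n m a) ∈ S) (x : DR T) : f x ∈ S := by
  have h1 := DR.eq_top_of_toDR_mem (S.comap (f : DR T →ₗ[ℂ] B))
    (hS.preimage (continuous_starHom f)) h
  exact (h1 ▸ Submodule.mem_top : x ∈ S.comap (f : DR T →ₗ[ℂ] B))

theorem isUniversal_universalRep : (universalRep T).IsUniversal.{u, u, v} ⊤ where
  isRightTensorRep := (CoisometricRep.univ T).isRightTensorRep_family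
  isCoisometricOn := (CoisometricRep.univ T).isCoisometricOn_family
  generates := by
    rw [eq_top_iff]
    intro x _
    exact DR.apply_mem (f := NonUnitalStarAlgHom.id ℂ (DR T))
      (universalRep T).generatedAlgebra.toSubmodule (universalRep T).isClosed_generatedAlgebra
      (fun n m a => (universalRep T).mem_generatedAlgebra ⟨a, trivial⟩) x
  exists_lift C _ π hπ hc :=
    ⟨(CoisometricRep.ofFamily hπ hc).lift, fun n m a => CoisometricRep.lift_toDR _ a.1⟩

/-- The kernel of a `*`-homomorphism on `DR(T)`, as a subspace. -/
def kerDR (f : DR T →⋆ₙₐ[ℂ] B) : Submodule ℂ (DR T) := LinearMap.ker (f : DR T →ₗ[ℂ] B)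

theorem mem_kerDR {f : DR T →⋆ₙₐ[ℂ] B} {x : DR T} : x ∈ kerDR f ↔ f x = 0 := Iff.rfl

theorem isClosed_kerDR (f : DR T →⋆ₙₐ[ℂ] B) : IsClosed (kerDR f : Set (DR T)) :=
  isClosed_singleton.preimage (continuous_starHom f)

theorem isGaugeInvariantIdeal_kerDR {f : DR T →⋆ₙₐ[ℂ] B}
    (h : ∀ (z : Circle) (x : DR T), f x = 0 → f (gauge T z x) = 0) :
    IsGaugeInvariantIdeal (kerDR f) where
  isClosed := isClosed_kerDR f
  mul_mem_left x y hy := by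
    rw [mem_kerDR] at hy ⊢
    rw [map_mul, hy, mul_zero]
  mul_mem_right y hx := by
    rw [mem_kerDR] at hx ⊢
    rw [map_mul, hx, zero_mul]
  gauge_mem z x hx := h z x hx

theorem isGaugeInvariantIdeal_kerDR_of_comm {T' : RightTensorCStarPrecategory.{w}}
    {f : DR T →⋆ₙₐ[ℂ] DR T'}
    (h : ∀ (z : Circle) (n m : ℕ) (a : T.Hom m n),
      f (gauge T z (toDR T n m a)) = gauge T' z (f (toDR T n m a))) :
    IsGaugeInvariantIdeal (kerDR f) := by
  refine isGaugeInvariantIdeal_kerDR fun z x hx => ?_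
  have : f.comp (gauge T z) = (gauge T' z).comp f := DR.hom_ext fun n m a => h z n m a
  have h2 := congrFun (congrArg DFunLike.coe this) x
  refine h2.trans ?_
  change gauge T' z (f x) = 0
  rw [hx, map_zero]

theorem Ideal.toDR_mem_spanDR (N : T.Ideal) {m n : ℕ} {a : T.Hom m n} (ha : a ∈ N.carrier m n) :
    toDR T n m a ∈ N.spanDR :=
  Submodule.le_topologicalClosure _ (Submodule.subset_span
    (Set.mem_iUnion₂.2 ⟨n, m, a, ha, rfl⟩))

theorem Ideal.isClosed_spanDR (N : T.Ideal) : IsClosed (N.spanDR : Set (DR T)) :=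
  Submodule.isClosed_topologicalClosure _

theorem Ideal.spanDR_le (N : T.Ideal) {S : Submodule ℂ (DR T)} (hS : IsClosed (S : Set (DR T)))
    (h : ∀ (m n : ℕ) (a : T.Hom m n), a ∈ N.carrier m n → toDR T n m a ∈ S) : N.spanDR ≤ S := by
  refine Submodule.topologicalClosure_minimal _ (Submodule.span_le.2 ?_) hS
  intro x hx
  obtain ⟨n, m, a, ha, rfl⟩ := Set.mem_iUnion₂.1 hx
  exact h m n a ha

theorem Ideal.gauge_mem_spanDR (N : T.Ideal) (z : Circle) {x : DR T} (hx : x ∈ N.spanDR) :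
    gauge T z x ∈ N.spanDR := by
  refine N.spanDR_le (S := N.spanDR.comap (gauge T z : DR T →ₗ[ℂ] DR T))
    (N.isClosed_spanDR.preimage (continuous_starHom (gauge T z))) (fun m n a ha => ?_) hx
  change gauge T z (toDR T n m a) ∈ N.spanDR
  rw [gauge_toDR]
  exact Submodule.smul_mem _ _ (N.toDR_mem_spanDR ha)

/-- The kernel of a gauge invariant `*`-homomorphism is spanned by its trace on `T`. -/
theorem kerDR_eq_spanDR {f : DR T →⋆ₙₐ[ℂ] B} (hf : IsGaugeInvariantIdeal (kerDR f)) {N : T.Ideal}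
    (hN : ∀ (m n : ℕ) (a : T.Hom m n), a ∈ N.carrier m n ↔ f (toDR T n m a) = 0) :
    kerDR f = N.spanDR := by
  have : hf.preimage = N := by
    apply Ideal.ext
    funext m n
    ext a
    rw [hf.mem_preimage, hN]
    rfl
  rw [← this, hf.spanDR_preimage]

section gaugeAction
variable {π : RepFamily (⊤ : T.Ideal) B} {Ψ : DR T →⋆ₙₐ[ℂ] B}

theorem RepFamily.apply_toDR
    (hΨ : ∀ (n m : ℕ) (a), Ψ (universalRep T n m a) = π n m a) {m n : ℕ} (a : T.Hom m n) :
    Ψ (toDR T n m a) = π n m ⟨a, trivial⟩ := hΨ n m ⟨a, trivial⟩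

theorem RepFamily.apply_mem_generatedAlgebra
    (hΨ : ∀ (n m : ℕ) (a), Ψ (universalRep T n m a) = π n m a) (x : DR T) :
    Ψ x ∈ π.generatedAlgebra := by
  refine DR.apply_mem π.generatedAlgebra.toSubmodule π.isClosed_generatedAlgebra
    (fun n m a => ?_) x
  rw [RepFamily.apply_toDR hΨ]
  exact π.mem_generatedAlgebra _

/-- The range contains the generators and is closed, because ranges of `*`-homomorphisms are closed.
Surjectivity onto `C*(π)` is what allows `β_z` to be defined on all of it. -/
theorem RepFamily.range_eq_generatedAlgebra
    (hΨ : ∀ (n m : ℕ) (a), Ψ (universalRep T n m a) = π n m a) :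
    Set.range Ψ = (π.generatedAlgebra : Set B) := by
  refine Set.Subset.antisymm ?_ ?_
  · rintro _ ⟨x, rfl⟩
    exact RepFamily.apply_mem_generatedAlgebra hΨ x
  · have h1 : (NonUnitalStarAlgebra.adjoin ℂ (⋃ (n : ℕ) (m : ℕ), Set.range (π n m))) ≤
        NonUnitalStarAlgHom.range Ψ := by
      refine NonUnitalStarAlgebra.adjoin_le ?_
      intro x hx
      obtain ⟨n, m, a, rfl⟩ := Set.mem_iUnion₂.1 hx
      exact ⟨universalRep T n m a, hΨ n m a⟩
    exact closure_minimal h1 (isClosed_range_starHom Ψ)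

/-- The exponents `n - m` for `β` and `m - n` for `gauge` have opposite signs, so it is `β` at `z⁻¹`
that is intertwined with `gauge T z` by `Ψ`. -/
theorem RepFamily.isGaugeInvariantIdeal_of_admitsGaugeAction
    (hΨ : ∀ (n m : ℕ) (a), Ψ (universalRep T n m a) = π n m a) (h : π.AdmitsGaugeAction) :
    IsGaugeInvariantIdeal (kerDR Ψ) := by
  refine isGaugeInvariantIdeal_kerDR fun z x hx => ?_
  obtain ⟨β, hβ⟩ := h z⁻¹
  have := π.isClosed_generatedAlgebra
  let Ψ' : DR T →⋆ₙₐ[ℂ] π.generatedAlgebra :=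
    NonUnitalStarAlgHom.codRestrict Ψ π.generatedAlgebra (RepFamily.apply_mem_generatedAlgebra hΨ)
  have e : β.comp Ψ' = Ψ'.comp (gauge T z) := by
    refine DR.hom_ext fun n m a => Subtype.ext ?_
    change (β (Ψ' (toDR T n m a)) : B) = Ψ (gauge T z (toDR T n m a))
    rw [hβ n m ⟨a, trivial⟩ (Ψ' (toDR T n m a)) (RepFamily.apply_toDR hΨ a), gauge_toDR, map_smul,
      RepFamily.apply_toDR hΨ, Circle.coe_inv, inv_zpow', neg_sub]
  have h0 : Ψ' x = 0 := Subtype.ext hx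
  have h1 := congrFun (congrArg DFunLike.coe e) x
  have h2 : (β (Ψ' x) : B) = Ψ (gauge T z x) := congrArg Subtype.val h1
  rw [← h2, h0, map_zero]
  rfl

/-- The gauge action of `DR(T)`, at `z⁻¹`, descends to the quotient by an invariant kernel, and `Ψ`
identifies this quotient with `C*(π)`. -/
theorem RepFamily.admitsGaugeAction_of_isGaugeInvariantIdeal
    (hΨ : ∀ (n m : ℕ) (a), Ψ (universalRep T n m a) = π n m a)
    (h : IsGaugeInvariantIdeal (kerDR Ψ)) : π.AdmitsGaugeAction := by
  intro z
  have hs : ∀ b : π.generatedAlgebra, ∃ x, Ψ x = b := fun b => by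
    have := b.2
    rwa [← SetLike.mem_coe, ← RepFamily.range_eq_generatedAlgebra hΨ] at this
  choose s hs using hs
  -- Independence of the chosen preimages `s b`; all algebraic properties of `β` follow from it.
  have hw : ∀ x y, Ψ x = Ψ y → Ψ (gauge T z⁻¹ x) = Ψ (gauge T z⁻¹ y) := fun x y hxy => by
    have h1 : x - y ∈ kerDR Ψ := by rw [mem_kerDR, map_sub, hxy, sub_self]
    have h2 := mem_kerDR.1 (h.gauge_mem z⁻¹ h1)
    rwa [map_sub, map_sub, sub_eq_zero] at h2
  refine ⟨{ toFun := fun b => ⟨Ψ (gauge T z⁻¹ (s b)), RepFamily.apply_mem_generatedAlgebra hΨ _⟩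
            map_smul' := fun c b => Subtype.ext ?_
            map_zero' := Subtype.ext ?_
            map_add' := fun b c => Subtype.ext ?_
            map_mul' := fun b c => Subtype.ext ?_
            map_star' := fun b => Subtype.ext ?_ }, fun n m a b hb => ?_⟩
  · change Ψ (gauge T z⁻¹ (s (c • b))) = c • Ψ (gauge T z⁻¹ (s b))
    rw [← map_smul, ← map_smul]
    apply hw
    rw [hs, map_smul, hs]
    rfl
  · change Ψ (gauge T z⁻¹ (s 0)) = 0
    rw [hw (s 0) 0 (by rw [hs, map_zero]; rfl), map_zero, map_zero]
  · change Ψ (gauge T z⁻¹ (s (b + c))) = Ψ (gauge T z⁻¹ (s b)) + Ψ (gauge T z⁻¹ (s c))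
    rw [← map_add, ← map_add]
    apply hw
    rw [hs, map_add, hs, hs]
    rfl
  · change Ψ (gauge T z⁻¹ (s (b * c))) = Ψ (gauge T z⁻¹ (s b)) * Ψ (gauge T z⁻¹ (s c))
    rw [← map_mul, ← map_mul]
    apply hw
    rw [hs, map_mul, hs, hs]
    rfl
  · change Ψ (gauge T z⁻¹ (s (star b))) = star (Ψ (gauge T z⁻¹ (s b)))
    rw [← map_star, ← map_star]
    apply hw
    rw [hs, map_star, hs]
    rfl
  · change Ψ (gauge T z⁻¹ (s b)) = _
    have e : Ψ (s b) = Ψ (toDR T n m (a : T.Hom m n)) := by rw [hs, hb]; exact (hΨ n m a).symm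
    rw [hw _ _ e, gauge_toDR, map_smul, Circle.coe_inv, inv_zpow', neg_sub]
    congr 1
    exact hΨ n m a

theorem RepFamily.spanDR_le_kerDR
    (hΨ : ∀ (n m : ℕ) (a), Ψ (universalRep T n m a) = π n m a) {N : T.Ideal}
    (hN : π.HasKernel N) : N.spanDR ≤ kerDR Ψ :=
  N.spanDR_le (isClosed_kerDR Ψ) fun m n a ha => by
    obtain ⟨h, h0⟩ := (hN m n a).1 ha
    rw [mem_kerDR, RepFamily.apply_toDR hΨ]
    exact h0

theorem RepFamily.admitsGaugeAction_iff
    (hΨ : ∀ (n m : ℕ) (a), Ψ (universalRep T n m a) = π n m a) {N : T.Ideal} (hN : π.HasKernel N) :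
    π.AdmitsGaugeAction ↔ ∀ x, Ψ x = 0 ↔ x ∈ N.spanDR := by
  constructor
  · intro h x
    rw [← kerDR_eq_spanDR (RepFamily.isGaugeInvariantIdeal_of_admitsGaugeAction hΨ h) (N := N)
      fun m n a => ?_]
    · rfl
    · rw [hN, RepFamily.apply_toDR hΨ]
      exact ⟨fun ⟨_, h⟩ => h, fun h => ⟨_, h⟩⟩
  · intro h
    refine RepFamily.admitsGaugeAction_of_isGaugeInvariantIdeal hΨ
      (isGaugeInvariantIdeal_kerDR fun z x hx => ?_)
    rw [h] at hx ⊢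
    exact N.gauge_mem_spanDR z hx

end gaugeAction

/-- On `T(m, m)` tensoring is an injective `*`-homomorphism, hence isometric; the `C*`-identity
extends this to `T(m, n)`. -/
theorem norm_tensor_of_injective
    (h : ∀ {m n : ℕ} (a : T.Hom m n), T.tensor a = 0 → a = 0) {m n : ℕ} (a : T.Hom m n) :
    ‖T.tensor a‖ = ‖a‖ := by
  let _ := T.endCStarAlgebra m
  let _ := T.endCStarAlgebra (m + 1)
  let φ : T.Hom m m →⋆ₙₐ[ℂ] T.Hom (m + 1) (m + 1) :=
    { toFun := T.tensor
      map_smul' := fun _ _ => map_smul _ _ _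
      map_zero' := map_zero _
      map_add' := map_add _
      map_mul' := fun x y => T.tensor_comp x y
      map_star' := fun x => T.tensor_adj x }
  have h1 := NonUnitalStarAlgHom.norm_map φ
    ((injective_iff_map_eq_zero φ).2 fun a ha => h a ha) (T.comp (T.adj a) a)
  refine (sq_eq_sq₀ (norm_nonneg _) (norm_nonneg _)).1 ?_
  rw [← T.norm_adj_comp_self, ← T.norm_adj_comp_self a, ← T.tensor_adj, ← T.tensor_comp]
  exact h1

/-- All the `a ⊗ 1ᵏ` have the same norm as `a`, while some of them are arbitrarily small when
`i_{(n,m)}(a) = 0`. -/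
theorem eq_zero_of_toDR_eq_zero (h : ∀ {m n : ℕ} (a : T.Hom m n), T.tensor a = 0 → a = 0)
    {m n : ℕ} {a : T.Hom m n} (ha : toDR T n m a = 0) : a = 0 := by
  have h1 : ∀ k, ‖T.tensorPow k a‖ = ‖a‖ := fun k => by
    induction k with
    | zero => rfl
    | succ k ih => exact (norm_tensor_of_injective h _).trans ih
  rw [← norm_le_zero_iff]
  refine le_of_forall_pos_le_add fun ε hε => ?_
  obtain ⟨k, hk⟩ := exists_norm_tensorPow_le a (ε := ε) (by rwa [ha, norm_zero])
  rwa [zero_add, ← h1 k]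

namespace Ideal
variable (N : T.Ideal) (hN : N.Invariant)

/-- The representation of `T` in `DR(T / N)`. -/
def quotientRep : CoisometricRep T (DR (N.quotient hN)) where
  map n m := toDR (N.quotient hN) n m ∘ₗ (N.carrier m n).mkQ
  map_adj a := (toDR_star (T := N.quotient hN) (Submodule.Quotient.mk a)).symm
  map_comp a b := (toDR_mul (T := N.quotient hN) (Submodule.Quotient.mk a)
    (Submodule.Quotient.mk b)).symm
  map_tensor a := toDR_tensor (T := N.quotient hN) (Submodule.Quotient.mk a)

/-- Saturation says exactly that `⊗ 1` is injective on `T / N`, so nothing of `T / N` is lost in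
`DR(T / N)`. -/
theorem quotientRep_eq_zero (hs : N.Saturated ⊤) {m n : ℕ}
    {a : T.Hom m n} :
    (N.quotientRep hN).map n m a = 0 ↔ a ∈ N.carrier m n := by
  constructor
  · intro h
    rw [← Submodule.Quotient.mk_eq_zero]
    refine eq_zero_of_toDR_eq_zero (T := N.quotient hN) (fun a ha => ?_) h
    induction a using Submodule.Quotient.induction_on with
    | H a =>
      exact (Submodule.Quotient.mk_eq_zero _).2 (hs trivial ((Submodule.Quotient.mk_eq_zero _).1 ha))
  · intro h
    change toDR (N.quotient hN) n m (Submodule.Quotient.mk a) = 0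
    rw [(Submodule.Quotient.mk_eq_zero (N.carrier m n)).2 h]
    exact map_zero _

theorem gauge_quotientRep : IsGaugeInvariantIdeal (kerDR (N.quotientRep hN).lift) := by
  refine isGaugeInvariantIdeal_kerDR_of_comm fun z n m a => ?_
  rw [gauge_toDR, map_smul, CoisometricRep.lift_toDR]
  exact (gauge_toDR (T := N.quotient hN) z (Submodule.Quotient.mk a)).symm

theorem kerDR_quotientRep (hs : N.Saturated ⊤) : kerDR (N.quotientRep hN).lift = N.spanDR :=
  kerDR_eq_spanDR (N.gauge_quotientRep hN) fun m n a => by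
    rw [CoisometricRep.lift_toDR, N.quotientRep_eq_zero hN hs]

theorem isGaugeInvariantIdeal_spanDR (N : T.Ideal) (hN : N.Invariant) (hs : N.Saturated ⊤) :
    IsGaugeInvariantIdeal N.spanDR :=
  N.kerDR_quotientRep hN hs ▸ N.gauge_quotientRep hN

theorem toDR_mem_spanDR_iff (N : T.Ideal) (hN : N.Invariant) (hs : N.Saturated ⊤) {m n : ℕ}
    {a : T.Hom m n} :
    toDR T n m a ∈ N.spanDR ↔ a ∈ N.carrier m n := by
  rw [← N.kerDR_quotientRep hN hs, mem_kerDR, CoisometricRep.lift_toDR,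
    N.quotientRep_eq_zero hN hs]

theorem hasKernel_quotientRep (hs : N.Saturated ⊤) : (N.quotientRep hN).family.HasKernel N :=
  fun _ _ _ => ⟨fun h => ⟨trivial, (N.quotientRep_eq_zero hN hs).2 h⟩,
    fun ⟨_, h⟩ => (N.quotientRep_eq_zero hN hs).1 h⟩

theorem admitsGaugeAction_quotientRep : (N.quotientRep hN).family.AdmitsGaugeAction :=
  RepFamily.admitsGaugeAction_of_isGaugeInvariantIdeal
    (fun _ _ a => CoisometricRep.lift_toDR (N.quotientRep hN) a.1) (N.gauge_quotientRep hN)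

/-- The representation of an invariant ideal in `DR(T)`. -/
def inclRep : CoisometricRep (N.toPrecategory hN) (DR T) where
  map n m := toDR T n m ∘ₗ (N.carrier m n).subtype
  map_adj a := (toDR_star (a.1 : T.Hom _ _)).symm
  map_comp a b := (toDR_mul (a.1 : T.Hom _ _) b.1).symm
  map_tensor a := toDR_tensor (a.1 : T.Hom _ _)

/-- The inclusion of an invariant ideal. -/
def incl {m n : ℕ} : (N.toPrecategory hN).Hom m n →ₗ[ℂ] T.Hom m n := (N.carrier m n).subtype

theorem incl_tensorPow {m n : ℕ} (a : (N.toPrecategory hN).Hom m n) (k : ℕ) :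
    N.incl hN ((N.toPrecategory hN).tensorPow k a) = T.tensorPow k (N.incl hN a) := by
  induction k with
  | zero => rfl
  | succ k ih => exact congrArg T.tensor ih

/-- The norms of `a ⊗ 1ᵏ` are the same in `N` and in `T`. Small values in `T` therefore bound the
norm of `a` in `DR(N)`, although `N` need not be saturated. -/
theorem toDR_toPrecategory_eq_zero {m n : ℕ} {a : (N.toPrecategory hN).Hom m n}
    (ha : toDR T n m (N.incl hN a) = 0) : toDR (N.toPrecategory hN) n m a = 0 := by
  rw [← norm_le_zero_iff]
  refine le_of_forall_pos_le_add fun ε hε => ?_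
  obtain ⟨k, hk⟩ := exists_norm_tensorPow_le (N.incl hN a) (ε := ε) (by rwa [ha, norm_zero])
  rw [zero_add, ← toDR_stableMatrix a (i := n + k) (j := m + k) (by omega) (by omega),
    stableMatrix_add]
  refine (norm_toDR_le _).trans ?_
  rwa [← incl_tensorPow] at hk

/-- The kernel is a gauge-invariant ideal of `DR(N)`, hence generated by the elements `i_{(n,m)}(a)`
that it contains, and these vanish already in `DR(N)`. -/
theorem injective_inclRep : Function.Injective (N.inclRep hN).lift := by
  have h1 : IsGaugeInvariantIdeal (kerDR (N.inclRep hN).lift) := by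
    refine isGaugeInvariantIdeal_kerDR_of_comm fun z n m a => ?_
    rw [gauge_toDR, map_smul, CoisometricRep.lift_toDR]
    exact (gauge_toDR z a.1).symm
  have h2 : kerDR (N.inclRep hN).lift ≤ ⊥ := by
    rw [← h1.spanDR_preimage]
    refine Ideal.spanDR_le _ isClosed_singleton fun m n a ha => ?_
    have h3 : (N.inclRep hN).lift (toDR _ n m a) = 0 := h1.mem_preimage.1 ha
    rw [CoisometricRep.lift_toDR] at h3
    exact N.toDR_toPrecategory_eq_zero hN h3
  exact (injective_iff_map_eq_zero _).2 fun x hx => h2 hx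

theorem range_inclRep : Set.range (N.inclRep hN).lift = N.spanDR := by
  refine Set.Subset.antisymm ?_ ?_
  · rintro _ ⟨x, rfl⟩
    refine DR.apply_mem N.spanDR N.isClosed_spanDR (fun n m a => ?_) x
    rw [CoisometricRep.lift_toDR]
    exact N.toDR_mem_spanDR a.2
  · intro x hx
    refine N.spanDR_le
      (S := LinearMap.range ((N.inclRep hN).lift : DR (N.toPrecategory hN) →ₗ[ℂ] DR T))
      (isClosed_range_starHom (N.inclRep hN).lift) (fun m n a ha => ?_) hx
    exact ⟨toDR (N.toPrecategory hN) n m ⟨a, ha⟩,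
      CoisometricRep.lift_toDR _ _⟩

end Ideal

variable (T) in
/-- The correspondence between invariant saturated ideals of `T` and gauge invariant ideals of
`DR(T)`. -/
def gaugeInvariantIdealEquiv : InvariantSaturatedIdeal T ≃o GaugeInvariantIdeal T where
  toFun N := ⟨N.1.spanDR, N.1.isGaugeInvariantIdeal_spanDR N.2.1 N.2.2⟩
  invFun P := ⟨P.2.preimage, P.2.quotRep.kerIdeal_invariant, P.2.quotRep.kerIdeal_saturated⟩
  left_inv N := by
    apply Subtype.ext
    apply Ideal.ext
    funext m n
    ext a
    exact (IsGaugeInvariantIdeal.mem_preimage _).trans (N.1.toDR_mem_spanDR_iff N.2.1 N.2.2)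
  right_inv P := Subtype.ext P.2.spanDR_preimage
  map_rel_iff' {N N'} := by
    constructor
    · intro h m n a ha
      exact (N'.1.toDR_mem_spanDR_iff N'.2.1 N'.2.2).1 (h (N.1.toDR_mem_spanDR ha))
    · intro h
      exact N.1.spanDR_le N'.1.isClosed_spanDR fun m n a ha => N'.1.toDR_mem_spanDR (h m n ha)

theorem IsGaugeInvariantIdeal.sInf {S : Set (Submodule ℂ (DR T))}
    (h : ∀ P ∈ S, IsGaugeInvariantIdeal P) : IsGaugeInvariantIdeal (sInf S) where
  isClosed := by
    rw [Submodule.coe_sInf]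
    exact isClosed_biInter fun P hP => (h P hP).isClosed
  mul_mem_left x y hy := by
    rw [Submodule.mem_sInf] at hy ⊢
    exact fun P hP => (h P hP).mul_mem_left x (hy P hP)
  mul_mem_right y hx := by
    rw [Submodule.mem_sInf] at hx ⊢
    exact fun P hP => (h P hP).mul_mem_right y (hx P hP)
  gauge_mem z x hx := by
    rw [Submodule.mem_sInf] at hx ⊢
    exact fun P hP => (h P hP).gauge_mem z (hx P hP)

theorem GaugeInvariantIdeal.exists_isGLB (S : Set (GaugeInvariantIdeal T)) : ∃ Q, IsGLB S Q := by
  refine ⟨⟨sInf (Subtype.val '' S), IsGaugeInvariantIdeal.sInf ?_⟩, ?_, ?_⟩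
  · rintro _ ⟨P, -, rfl⟩
    exact P.2
  · exact fun P hP => _root_.sInf_le (a := P.1) (Set.mem_image_of_mem Subtype.val hP)
  · intro Q hQ
    change Q.1 ≤ sInf (Subtype.val '' S)
    refine _root_.le_sInf ?_
    rintro _ ⟨P, hP, rfl⟩
    exact hQ hP

/-- Arbitrary infima exist as intersections, so a supremum is the infimum of the upper bounds. No
closure of a sum of ideals is needed. -/
theorem GaugeInvariantIdeal.exists_isLUB (S : Set (GaugeInvariantIdeal T)) : ∃ Q, IsLUB S Q := by
  obtain ⟨Q, hQ⟩ := GaugeInvariantIdeal.exists_isGLB (upperBounds S)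
  exact ⟨Q, isGLB_upperBounds.1 hQ⟩

theorem InvariantSaturatedIdeal.exists_isLUB (S : Set (InvariantSaturatedIdeal T)) :
    ∃ M, IsLUB S M := by
  obtain ⟨Q, hQ⟩ := GaugeInvariantIdeal.exists_isLUB (gaugeInvariantIdealEquiv T '' S)
  exact ⟨_, (gaugeInvariantIdealEquiv T).isLUB_image.1 hQ⟩

theorem InvariantSaturatedIdeal.exists_isGLB (S : Set (InvariantSaturatedIdeal T)) :
    ∃ M, IsGLB S M := by
  obtain ⟨Q, hQ⟩ := GaugeInvariantIdeal.exists_isGLB (gaugeInvariantIdealEquiv T '' S)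
  exact ⟨_, (gaugeInvariantIdealEquiv T).isGLB_image.1 hQ⟩

end correspondence
-- The universal property of `O_T(K, J) = DR(K_J)`.
noncomputable section relative
variable {T : RightTensorCStarPrecategory.{u}}

theorem stableMatrix_of_tensor {m n : ℕ} (a : T.Hom m n) {i j : ℕ} (hi : n + 1 ≤ i) :
    stableMatrix (T.tensor a) i j = stableMatrix a i j := by
  by_cases h : i + m = j + n
  · obtain ⟨k, rfl⟩ := Nat.exists_eq_add_of_le hi
    obtain rfl : j = m + 1 + k := by omega
    induction k with
    | zero =>
      exact (stableMatrix_self _).trans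
        ((congrArg T.tensor (stableMatrix_self a).symm).trans (stableMatrix_tensor a le_rfl).symm)
    | succ k ih =>
      change stableMatrix (T.tensor a) (n + 1 + k + 1) (m + 1 + k + 1) =
        stableMatrix a (n + 1 + k + 1) (m + 1 + k + 1)
      rw [stableMatrix_tensor _ (by omega), stableMatrix_tensor _ (by omega),
        ih (by omega) (by omega)]
  · rw [stableMatrix_of_ne _ h, stableMatrix_of_ne _ (by omega)]

variable (T) in
/-- The entry of a matrix, as a linear map. -/
def entry (i j : ℕ) : (∀ i j : ℕ, T.Hom j i) →ₗ[ℂ] T.Hom j i :=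
  LinearMap.proj (φ := fun j => T.Hom j i) j ∘ₗ LinearMap.proj (φ := fun i => ∀ j, T.Hom j i) i

variable (T) in
/-- The entries of the matrix `a` with partial sums `b = ∑ₖ Λᵏ(a)`. -/
def diagDiff : ∀ i j : ℕ, (∀ i j : ℕ, T.Hom j i) →ₗ[ℂ] T.Hom j i
  | 0, j => entry T 0 j
  | i + 1, 0 => entry T (i + 1) 0
  | i + 1, j + 1 => entry T (i + 1) (j + 1) - T.tensor ∘ₗ entry T i j

theorem diagDiff_matAdj (b : ∀ i j : ℕ, T.Hom j i) (i j : ℕ) :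
    diagDiff T i j (matAdj b) = T.adj (diagDiff T j i b) := by
  cases i with
  | zero => cases j <;> rfl
  | succ i =>
    cases j with
    | zero => rfl
    | succ j =>
      change T.adj (b (j + 1) (i + 1)) - T.tensor (T.adj (b j i)) =
        T.adj (b (j + 1) (i + 1) - T.tensor (b j i))
      rw [map_sub, T.tensor_adj]

/-- The matrices of partial sums of matrices with entries in `K`. -/
def partialSums (K : T.Ideal) : Submodule ℂ (∀ i j : ℕ, T.Hom j i) where
  carrier := {b | ∀ i j, diagDiff T i j b ∈ K.carrier j i}
  add_mem' hb hc i j := by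
    rw [map_add]
    exact add_mem (hb i j) (hc i j)
  zero_mem' i j := by
    rw [map_zero]
    exact zero_mem _
  smul_mem' c b hb i j := by
    rw [map_smul]
    exact Submodule.smul_mem _ _ (hb i j)

variable {K J : T.Ideal}

theorem partialSums_sub_mem (b : partialSums K) (n m : ℕ) :
    b.1 (n + 1) (m + 1) - T.tensor (b.1 n m) ∈ K.carrier (m + 1) (n + 1) :=
  b.2 (n + 1) (m + 1)

variable {B : Type v} [NonUnitalCStarAlgebra B] (π : RepFamily K B)

namespace RepFamily

/-- The value of a representation at an entry. -/
def entryMap (i j : ℕ) : partialSums K →ₗ[ℂ] B :=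
  π i j ∘ₗ (diagDiff T i j ∘ₗ (partialSums K).subtype).codRestrict _ fun b => b.2 i j

/-- The sum of the values of a representation along the diagonal ending at `(n, m)`. -/
def diagRep : ∀ _ _ : ℕ, partialSums K →ₗ[ℂ] B
  | 0, m => π.entryMap 0 m
  | n + 1, 0 => π.entryMap (n + 1) 0
  | n + 1, m + 1 => π.entryMap (n + 1) (m + 1) + diagRep n m

variable {π}

theorem map_congr {n m : ℕ} {x y : T.Hom m n} (h : x = y) {hx : x ∈ K.carrier m n} :
    π n m ⟨x, hx⟩ = π n m ⟨y, h ▸ hx⟩ := by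
  subst h
  rfl

theorem IsRightTensorRep.mul_stableMatrix (hπ : π.IsRightTensorRep) {m n p q l : ℕ}
    {a : T.Hom m n} (ha : a ∈ K.carrier m n) {b : T.Hom l p} (hb : b ∈ K.carrier l p) (hp : m ≤ p)
    (hq : q + m = p + n) : π n m ⟨a, ha⟩ * π p l ⟨b, hb⟩ =
      π q l ⟨T.comp (stableMatrix a q p) b, K.comp_left _ hb⟩ := by
  obtain ⟨k, rfl⟩ := Nat.exists_eq_add_of_le hp
  obtain rfl : q = n + k := by omega
  refine (hπ.mul_tensor_apply ⟨a, ha⟩ ⟨b, hb⟩).trans ?_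
  congr 1
  exact Subtype.ext (by rw [stableMatrix_add])

/-- The mirror image of `mul_stableMatrix`, obtained by taking adjoints. -/
theorem IsRightTensorRep.stableMatrix_mul (hπ : π.IsRightTensorRep) {m n p q l : ℕ}
    {a : T.Hom p l} (ha : a ∈ K.carrier p l) {c : T.Hom m n} (hc : c ∈ K.carrier m n) (hp : n ≤ p)
    (hq : p + m = q + n) : π l p ⟨a, ha⟩ * π n m ⟨c, hc⟩ =
      π l q ⟨T.comp a (stableMatrix c p q), K.comp_right _ ha⟩ := by
  apply star_injective
  rw [star_mul, hπ.star_apply, hπ.star_apply, hπ.star_apply,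
    hπ.mul_stableMatrix (K.adj_mem hc) (K.adj_mem ha) hp hq.symm]
  congr 1
  exact Subtype.ext ((congrArg (fun x => T.comp x (T.adj a)) (stableMatrix_adj c q p)).trans
    (T.adj_comp a (stableMatrix c p q)).symm)

theorem diagRep_succ (n m : ℕ) (b : partialSums K) :
    π.diagRep (n + 1) (m + 1) b = π (n + 1) (m + 1)
      ⟨b.1 (n + 1) (m + 1) - T.tensor (b.1 n m), partialSums_sub_mem b n m⟩ + π.diagRep n m b := rfl

/-- If a representation is coisometric at the earlier entries, then the sum along the diagonal is the
value at the last one. -/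
theorem diagRep_eq (n m : ℕ) (b : partialSums K)
    (h : ∀ i j, i < n → i + m = j + n → ∃ (h₁ : b.1 i j ∈ K.carrier j i)
      (h₂ : T.tensor (b.1 i j) ∈ K.carrier (j + 1) (i + 1)),
        π i j ⟨b.1 i j, h₁⟩ = π (i + 1) (j + 1) ⟨T.tensor (b.1 i j), h₂⟩) :
    ∃ h' : b.1 n m ∈ K.carrier m n, π.diagRep n m b = π n m ⟨b.1 n m, h'⟩ := by
  induction n generalizing m with
  | zero => exact ⟨b.2 0 m, rfl⟩
  | succ n ih =>
    cases m with
    | zero => exact ⟨b.2 (n + 1) 0, rfl⟩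
    | succ m =>
      obtain ⟨h₁, h₂, he⟩ := h n m (Nat.lt_succ_self n) (by omega)
      obtain ⟨h', hn⟩ := ih m fun i j hi hj => h i j (by omega) (by omega)
      refine ⟨by simpa using add_mem (partialSums_sub_mem b n m) h₂, ?_⟩
      -- The sum telescopes: coisometry at `(n, m)` replaces the previous partial sum by its tensor,
      -- and adding the last entry gives the next partial sum.
      rw [diagRep_succ, hn, he, ← map_add]
      congr 1
      exact Subtype.ext (sub_add_cancel _ _)

theorem diagRep_eq_of_eq_zero (n m : ℕ) (b : partialSums K)
    (h : ∀ i j, i < n → i + m = j + n → b.1 i j = 0) :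
    ∃ h' : b.1 n m ∈ K.carrier m n, π.diagRep n m b = π n m ⟨b.1 n m, h'⟩ := by
  refine diagRep_eq n m b fun i j hi hj => ?_
  have h1 := h i j hi hj
  have h2 : T.tensor (b.1 i j) = 0 := by rw [h1, map_zero]
  refine ⟨h1 ▸ zero_mem _, h2 ▸ zero_mem _, ?_⟩
  rw [map_congr h1, map_congr h2]
  exact (map_zero (π i j)).trans (map_zero (π (i + 1) (j + 1))).symm

theorem diagRep_eq_map (n m : ℕ) (b : partialSums K) {x : T.Hom m n} (hx : x ∈ K.carrier m n)
    (h : b.1 n m = x) (h0 : ∀ i j, i < n → i + m = j + n → b.1 i j = 0) :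
    π.diagRep n m b = π n m ⟨x, hx⟩ := by
  obtain ⟨h', he⟩ := diagRep_eq_of_eq_zero (π := π) n m b h0
  rw [he, map_congr h]

/-- Multiplied by an element further along, every entry on the diagonal may be tensored up to the
same position, where the entries add up to the partial sum `b n m`. This telescoping uses only the
axioms of a right tensor representation, no coisometry. -/
theorem IsRightTensorRep.diagRep_mul (hπ : π.IsRightTensorRep) (n m : ℕ) (b : partialSums K)
    {p q l : ℕ} {a : T.Hom l p} (ha : a ∈ K.carrier l p) (hp : m ≤ p) (hq : q + m = p + n) :
    π.diagRep n m b * π p l ⟨a, ha⟩ =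
      π q l ⟨T.comp (stableMatrix (b.1 n m) q p) a, K.comp_left _ ha⟩ := by
  induction n generalizing m with
  | zero => exact hπ.mul_stableMatrix (b.2 0 m) ha hp hq
  | succ n ih =>
    cases m with
    | zero => exact hπ.mul_stableMatrix (b.2 (n + 1) 0) ha hp hq
    | succ m =>
      rw [diagRep_succ, add_mul, hπ.mul_stableMatrix (partialSums_sub_mem b n m) ha hp hq,
        ih m (by omega) (by omega),
        ← map_add]
      congr 1
      refine Subtype.ext ?_
      change T.comp (stableMatrix (b.1 (n + 1) (m + 1) - T.tensor (b.1 n m)) q p) a +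
        T.comp (stableMatrix (b.1 n m) q p) a = T.comp (stableMatrix (b.1 (n + 1) (m + 1)) q p) a
      rw [map_sub, Pi.sub_apply, Pi.sub_apply, stableMatrix_of_tensor _ (by omega), map_sub,
        LinearMap.sub_apply, sub_add_cancel]

theorem IsRightTensorRep.mul_diagRep (hπ : π.IsRightTensorRep) (n m : ℕ) (c : partialSums K)
    {p q l : ℕ} {a : T.Hom p l} (ha : a ∈ K.carrier p l) (hp : n ≤ p) (hq : p + m = q + n) :
    π l p ⟨a, ha⟩ * π.diagRep n m c =
      π l q ⟨T.comp a (stableMatrix (c.1 n m) p q), K.comp_right _ ha⟩ := by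
  induction n generalizing m with
  | zero => exact hπ.stableMatrix_mul ha (c.2 0 m) hp hq
  | succ n ih =>
    cases m with
    | zero => exact hπ.stableMatrix_mul ha (c.2 (n + 1) 0) hp hq
    | succ m =>
      rw [diagRep_succ, mul_add, hπ.stableMatrix_mul ha (partialSums_sub_mem c n m) hp hq,
        ih m (by omega) (by omega),
        ← map_add]
      congr 1
      refine Subtype.ext ?_
      change T.comp a (stableMatrix (c.1 (n + 1) (m + 1) - T.tensor (c.1 n m)) p q) +
        T.comp a (stableMatrix (c.1 n m) p q) = T.comp a (stableMatrix (c.1 (n + 1) (m + 1)) p q)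
      rw [map_sub, Pi.sub_apply, Pi.sub_apply, stableMatrix_of_tensor _ (by omega), map_sub,
        sub_add_cancel]

/-- Multiplicativity of the extension to `M(m, n)`. The matrix `e` plays the role of the product,
and its values are needed only on the relevant diagonal. Splitting off the last entries of `b` and
`c` reduces to shorter diagonals; `h2` treats positions whose middle index would be negative. -/
theorem IsRightTensorRep.diagRep_mul_diagRep (hπ : π.IsRightTensorRep) (n m l : ℕ)
    (b c e : partialSums K)
    (h1 : ∀ i p j, i + m = p + n → p + l = j + m → e.1 i j = T.comp (b.1 i p) (c.1 p j))
    (h2 : ∀ i j, i + l = j + n → i + m < n → e.1 i j = 0) :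
    π.diagRep n m b * π.diagRep m l c = π.diagRep n l e := by
  induction n generalizing m l with
  | zero =>
    rw [diagRep_eq_map 0 l e (x := T.comp (b.1 0 m) (c.1 m l)) (K.comp_right _ (b.2 0 m))
      (h1 0 m l (by omega) (by omega)) (fun i j hi => absurd hi (Nat.not_lt_zero i))]
    refine (hπ.mul_diagRep m l c (b.2 0 m) le_rfl (q := l) (by omega)).trans ?_
    congr 1
    refine Subtype.ext ?_
    change T.comp (b.1 0 m) (stableMatrix (c.1 m l) m l) = _
    rw [stableMatrix_self]
  | succ n ih =>
    cases l with
    | zero =>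
      have hc : ∃ hc : c.1 m 0 ∈ K.carrier 0 m, π.diagRep m 0 c = π m 0 ⟨c.1 m 0, hc⟩ :=
        diagRep_eq_of_eq_zero m 0 c fun i j hi hj => by omega
      obtain ⟨hc, hce⟩ := hc
      rw [diagRep_eq_map (n + 1) 0 e (x := T.comp (b.1 (n + 1) m) (c.1 m 0)) (K.comp_left _ hc)
        (h1 _ m _ (by omega) (by omega)) (fun i j hi hj => by omega), hce,
        hπ.diagRep_mul (n + 1) m b hc le_rfl (q := n + 1) (by omega)]
      congr 1
      exact Subtype.ext (by rw [stableMatrix_self])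
    | succ l =>
      cases m with
      | zero =>
        rw [diagRep_eq_map (n + 1) (l + 1) e (x := T.comp (b.1 (n + 1) 0) (c.1 0 (l + 1)))
          (K.comp_right _ (b.2 (n + 1) 0)) (h1 _ 0 _ (by omega) (by omega))
          (fun i j hi hj => h2 i j hj (by omega))]
        exact hπ.mul_apply ⟨_, b.2 (n + 1) 0⟩ ⟨_, c.2 0 (l + 1)⟩
      | succ m =>
        have ih' := ih m l (fun i p j hi hj => h1 i p j (by omega) (by omega))
          (fun i j hi hj => h2 i j (by omega) (by omega))
        rw [diagRep_succ m l c, mul_add,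
          hπ.diagRep_mul (n + 1) (m + 1) b (partialSums_sub_mem c m l) le_rfl (q := n + 1) (by omega),
          diagRep_succ n m b, add_mul, ih',
          hπ.mul_diagRep m l c (partialSums_sub_mem b n m) (by omega) (q := l + 1) (by omega),
          diagRep_succ n l e, ← add_assoc, ← map_add]
        congr 2
        refine Subtype.ext ?_
        -- With `b'`, `c'` the last partial sums and `b`, `c` the previous ones, this is `b' (c' - c
        -- ⊗ 1) + (b' - b ⊗ 1) (c ⊗ 1) = b' c' - (b c) ⊗ 1`.
        change T.comp (stableMatrix (b.1 (n + 1) (m + 1)) (n + 1) (m + 1))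
            (c.1 (m + 1) (l + 1) - T.tensor (c.1 m l)) +
          T.comp (b.1 (n + 1) (m + 1) - T.tensor (b.1 n m))
            (stableMatrix (c.1 m l) (m + 1) (l + 1)) = e.1 (n + 1) (l + 1) - T.tensor (e.1 n l)
        rw [stableMatrix_self, stableMatrix_tensor _ le_rfl, stableMatrix_self,
          h1 (n + 1) (m + 1) (l + 1) (by omega) (by omega), h1 n m l (by omega) (by omega),
          T.tensor_comp, map_sub, map_sub, LinearMap.sub_apply]
        abel

theorem IsRightTensorRep.star_diagRep (hπ : π.IsRightTensorRep) (n m : ℕ) (b c : partialSums K)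
    (h : c.1 = matAdj b.1) : star (π.diagRep n m b) = π.diagRep m n c := by
  have key : ∀ i j, star (π.entryMap i j b) = π.entryMap j i c := fun i j => by
    refine (hπ.star_apply _).trans ?_
    refine congrArg (π j i) (Subtype.ext ?_)
    change T.adj (diagDiff T i j b.1) = diagDiff T j i c.1
    rw [h, diagDiff_matAdj]
  induction n generalizing m with
  | zero => cases m <;> exact key _ _
  | succ n ih =>
    cases m with
    | zero => exact key _ _
    | succ m =>
      change star (π.entryMap _ _ b + π.diagRep n m b) = π.entryMap _ _ c + π.diagRep m n c
      rw [star_add, key, ih]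

end RepFamily

/-- The matrix of an element of `M(m, n)`. -/
def diagMatrices.toPartialSums {m n : ℕ} : diagMatrices K m n →ₗ[ℂ] partialSums K where
  toFun b := ⟨fun i j => b.1 (i, j), fun i j => by
    cases i with
    | zero => exact b.2.2.1 j
    | succ i =>
      cases j with
      | zero => exact b.2.2.2.1 (i + 1)
      | succ j => exact b.2.2.2.2.1 i j⟩
  map_add' _ _ := rfl
  map_smul' _ _ := rfl

open diagMatrices

/-- Viewed in `M(m + 1, n + 1)`, an element of `M(m, n)` has zero entry at the new end of the
diagonal. Hence the induced representation is coisometric. -/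
theorem RepFamily.diagRep_toPartialSums_succ {n m : ℕ} (b : diagMatrices K m n)
    (c : diagMatrices K (m + 1) (n + 1)) (h : ∀ i j, c.1 (i, j) = b.1 (i, j)) :
    π.diagRep (n + 1) (m + 1) (toPartialSums c) = π.diagRep n m (toPartialSums b) := by
  have e : (toPartialSums c).1 = (toPartialSums b).1 := by
    funext i j
    exact h i j
  rw [diagRep_succ, map_congr (show (toPartialSums c).1 (n + 1) (m + 1) -
    T.tensor ((toPartialSums c).1 n m) = 0 by
      rw [e]
      exact sub_eq_zero.2 (b.2.2.2.2.2 n m le_rfl))]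
  refine (congrArg (· + _) (map_zero (π (n + 1) (m + 1)))).trans ((zero_add _).trans ?_)
  exact congrArg (π.diagRep n m) (Subtype.ext e)

/-- The representation of `K_J` induced by a representation of `K` that is coisometric on `J`. -/
def relRep {π : RepFamily K B} (hπ : π.IsRightTensorRep) (hc : π.IsCoisometricOn J)
    (hJ : J ≤ K.tensorIdeal) : CoisometricRep (relPrecategory K J) B where
  map n m := ((nullIdeal K J).carrier m n).liftQ (π.diagRep n m ∘ₗ toPartialSums) fun b hb => by
    rw [LinearMap.mem_ker]
    -- On the null ideal all earlier partial sums lie in `J`, so coisometry on `J` collapses the sum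
    -- to the value at the last partial sum, which is zero.
    obtain ⟨h', he⟩ := RepFamily.diagRep_eq (π := π) n m (toPartialSums b) fun i j hi _ =>
      ⟨(hJ j i (hb.1 i j hi)).1, (hJ j i (hb.1 i j hi)).2, hc _ (hb.1 i j hi) _ _⟩
    refine he.trans ?_
    rw [RepFamily.map_congr (show (toPartialSums b).1 n m = 0 from hb.2 n m le_rfl)]
    exact map_zero (π n m)
  map_adj a := by
    induction a using Submodule.Quotient.induction_on with
    | H a => exact (hπ.star_diagRep _ _ (toPartialSums a) (toPartialSums (diagAdj K a)) rfl).symm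
  map_comp {l m n} a b := by
    induction a using Submodule.Quotient.induction_on with
    | H a =>
      induction b using Submodule.Quotient.induction_on with
      | H b =>
        exact (hπ.diagRep_mul_diagRep n m l (toPartialSums a) (toPartialSums b)
          (toPartialSums (diagMul K a b)) (fun i p j hi _ => diagMul_apply' K a b hi j)
          fun i j _ hi => diagMul_apply_zero K a b hi j).symm
  map_tensor {m n} a := by
    induction a using Submodule.Quotient.induction_on with
    | H a =>
      exact RepFamily.diagRep_toPartialSums_succ π a
        ((matrixPrecategory K).tensor (m := m) (n := n) a) fun _ _ => rfl

theorem relRep_toRel {π : RepFamily K B} (hπ : π.IsRightTensorRep) (hc : π.IsCoisometricOn J)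
    (hJ : J ≤ K.tensorIdeal) {m n : ℕ} (a : K.carrier m n) :
    (relRep hπ hc hJ).map n m (toRel K J m n a) = π n m a := by
  obtain ⟨h', he⟩ := RepFamily.diagRep_eq_of_eq_zero (π := π) n m (toPartialSums (toMatrices K m n a))
    fun i j hi _ => stableMatrix_of_lt (a : T.Hom m n) hi
  refine he.trans ?_
  exact congrArg (π n m) (Subtype.ext (stableMatrix_self (a : T.Hom m n)))

/-- The class in `K_J(m, n)` of an element of `M(m, n)`. -/
def toRelHom (J : T.Ideal) {m n : ℕ} : diagMatrices K m n →ₗ[ℂ] (relPrecategory K J).Hom m n :=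
  ((nullIdeal K J).carrier m n).mkQ

theorem tensorPow_toRelHom {m n : ℕ} (b : diagMatrices K m n) (k : ℕ) :
    ∃ c : diagMatrices K (m + k) (n + k), c.1 = b.1 ∧
      (relPrecategory K J).tensorPow k (toRelHom J b) = toRelHom J c := by
  induction k with
  | zero => exact ⟨b, rfl, rfl⟩
  | succ k ih =>
    obtain ⟨c, hc, he⟩ := ih
    exact ⟨(matrixPrecategory K).tensor (m := m + k) (n := n + k) c, hc,
      congrArg (relPrecategory K J).tensor he⟩

/-- Tensoring in `K_J` leaves the matrix of `a` unchanged, and this matrix already contains all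
powers `a ⊗ 1ᵏ` as partial sums. -/
theorem toRelHom_toMatrices_mul {k l m n : ℕ} (a : K.carrier m n) (b : K.carrier l (m + k)) :
    (relPrecategory K J).comp ((relPrecategory K J).tensorPow k (toRel K J m n a))
      (toRel K J l (m + k) b) = toRel K J l (n + k)
        ⟨T.comp (T.tensorPow k (a : T.Hom m n)) (b : T.Hom l (m + k)), K.comp_left _ b.2⟩ := by
  obtain ⟨c, hc, he⟩ := tensorPow_toRelHom (J := J) (toMatrices K m n a) k
  refine (congrArg (fun x => (relPrecategory K J).comp x (toRel K J l (m + k) b)) he).trans ?_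
  change toRelHom J (diagMul K c (toMatrices K l (m + k) b)) = toRelHom J (toMatrices K l (n + k) _)
  refine congrArg (toRelHom J) (diagMatrices_ext fun i j _ => ?_)
  change _ = stableMatrix (T.comp (T.tensorPow k (a : T.Hom m n)) (b : T.Hom l (m + k))) i j
  rcases lt_or_ge (i + (m + k)) (n + k) with h | h
  · rw [diagMul_apply_zero K c _ h, stableMatrix_of_lt _ (by omega)]
  · obtain ⟨p, hp⟩ : ∃ p, i + (m + k) = p + (n + k) := ⟨i + (m + k) - (n + k), by omega⟩
    rw [diagMul_apply' K c _ hp, hc]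
    change T.comp (stableMatrix (a : T.Hom m n) i p) (stableMatrix (b : T.Hom l (m + k)) p j) = _
    rw [stableMatrix_comp (a : T.Hom m n) (b : T.Hom l (m + k)) (q := n + k) (by omega) (by omega)
      (by omega), stableMatrix_add]

theorem relUniversalRep_isRightTensorRep : (relUniversalRep K J).IsRightTensorRep where
  star_apply {m n} a := by
    refine (toDR_star (T := relPrecategory K J) (toRel K J m n a)).trans ?_
    refine congrArg (toDR (relPrecategory K J) m n) ?_
    change toRelHom J (diagAdj K (toMatrices K m n a)) = toRelHom J (toMatrices K n m _)
    exact congrArg (toRelHom J) (diagMatrices_ext fun i j _ =>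
      (stableMatrix_adj (a : T.Hom m n) i j).symm)
  mul_apply a b := by
    refine (toDR_mul (T := relPrecategory K J) _ _).trans ?_
    exact congrArg (toDR (relPrecategory K J) _ _) (toRelHom_toMatrices_mul (k := 0) a b)
  mul_tensor_apply {k l m n} a b := by
    refine (toDR_mul_tensor (T := relPrecategory K J) (q := n + k) _ _ (by omega)
      (by omega)).trans ?_
    rw [stableMatrix_add]
    exact congrArg (toDR (relPrecategory K J) _ _) (toRelHom_toMatrices_mul a b)

/-- The single-entry matrices of `a` and `a ⊗ 1` have the same partial sums from row `n + 1` on. In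
earlier rows their difference is at most the partial sum `a ∈ J` at `(n, m)`, so it belongs to the
null ideal. -/
theorem relUniversalRep_isCoisometricOn : (relUniversalRep K J).IsCoisometricOn J := by
  intro m n a haJ ha ha'
  refine (toDR_tensor (T := relPrecategory K J) (toRel K J m n ⟨a, ha⟩)).symm.trans ?_
  refine congrArg (toDR (relPrecategory K J) (n + 1) (m + 1)) ?_
  let b : diagMatrices K (m + 1) (n + 1) :=
    (matrixPrecategory K).tensor (m := m) (n := n) (toMatrices K m n ⟨a, ha⟩)
  change toRelHom J b = toRelHom J (toMatrices K (m + 1) (n + 1) ⟨T.tensor a, ha'⟩)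
  refine (Submodule.Quotient.eq _).2 ⟨fun i j hi => ?_, fun i j hi => ?_⟩
  · change stableMatrix a i j - stableMatrix (T.tensor a) i j ∈ J.carrier j i
    rw [stableMatrix_of_lt _ hi, sub_zero]
    rcases Nat.lt_succ_iff_lt_or_eq.1 hi with h | rfl
    · rw [stableMatrix_of_lt _ h]
      exact zero_mem _
    · by_cases hj : j = m
      · subst hj
        rwa [stableMatrix_self]
      · rw [stableMatrix_of_ne _ (by omega)]
        exact zero_mem _
  · change stableMatrix a i j - stableMatrix (T.tensor a) i j = 0
    rw [stableMatrix_of_tensor a hi, sub_self]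

theorem diagMatrices.eq_toMatrices {m n : ℕ} (b : diagMatrices K m n)
    (h0 : ∀ i j, i < n → i + m = j + n → b.1 (i, j) = 0) (h : b.1 (n, m) ∈ K.carrier m n) :
    b = toMatrices K m n ⟨b.1 (n, m), h⟩ := by
  refine diagMatrices_ext fun i j hij => ?_
  change _ = stableMatrix (b.1 (n, m)) i j
  rcases lt_or_ge i n with hi | hi
  · rw [h0 i j hi hij, stableMatrix_of_lt _ hi]
  · induction i, hi using Nat.le_induction generalizing j with
    | base =>
      obtain rfl : j = m := by omega
      rw [stableMatrix_self]
    | succ i hi ih =>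
      cases j with
      | zero => omega
      | succ j => rw [b.2.2.2.2.2 i j hi, ih j (by omega), stableMatrix_tensor _ hi]

/-- An element of `M(m, n)` is a finite sum of single-entry matrices. The last entry is split off,
and the rest comes from `M` with both indices lowered, with the same image in `DR(K_J)`. -/
theorem toDR_toRelHom_mem (S : Submodule ℂ (DR (relPrecategory K J)))
    (hS : ∀ (n m : ℕ) (a : K.carrier m n), relUniversalRep K J n m a ∈ S) (n m : ℕ)
    (b : diagMatrices K m n) : toDR (relPrecategory K J) n m (toRelHom J b) ∈ S := by
  have key : ∀ {n m : ℕ} (b : diagMatrices K m n),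
      (∀ i j, i < n → i + m = j + n → b.1 (i, j) = 0) → b.1 (n, m) ∈ K.carrier m n →
      toDR (relPrecategory K J) n m (toRelHom J b) ∈ S := fun b h0 h => by
    rw [diagMatrices.eq_toMatrices b h0 h]
    exact hS _ _ _
  induction n generalizing m with
  | zero => exact key b (fun i j hi => absurd hi (Nat.not_lt_zero i)) (b.2.2.1 m)
  | succ n ih =>
    cases m with
    | zero => exact key b (fun i j hi hj => by omega) (b.2.2.2.1 (n + 1))
    | succ m =>
      let a : K.carrier (m + 1) (n + 1) :=
        ⟨b.1 (n + 1, m + 1) - T.tensor (b.1 (n, m)), b.2.2.2.2.1 n m⟩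
      let c : diagMatrices K (m + 1) (n + 1) := b - toMatrices K (m + 1) (n + 1) a
      have hc : ∀ i j, c.1 (i, j) = b.1 (i, j) - stableMatrix (a : T.Hom (m + 1) (n + 1)) i j :=
        fun i j => rfl
      -- Without its last entry the matrix is stationary already from row `n`, so it belongs to
      -- `M(m, n)`.
      let c' : diagMatrices K m n := ⟨c.1, fun i j h => c.2.1 i j (by omega), c.2.2.1, c.2.2.2.1,
        c.2.2.2.2.1, fun i j hi => by
          rcases eq_or_lt_of_le hi with rfl | hi
          · by_cases hj : j = m
            · subst hj
              rw [hc, hc, stableMatrix_self, stableMatrix_of_lt _ (Nat.lt_succ_self n), sub_zero]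
              exact sub_sub_cancel _ _
            · rw [c.2.1 _ _ (by omega), c.2.1 _ _ (by omega), map_zero]
          · exact c.2.2.2.2.2 i j hi⟩
      have e1 : toRelHom J b = toRel K J (m + 1) (n + 1) a +
          (relPrecategory K J).tensor (toRelHom J c') := by
        change toRelHom J b = toRelHom J (toMatrices K (m + 1) (n + 1) a) + toRelHom J c
        rw [← map_add, add_sub_cancel]
      rw [e1, map_add, toDR_tensor]
      exact add_mem (hS _ _ _) (ih m c')

theorem relUniversalRep_generatedAlgebra : (relUniversalRep K J).generatedAlgebra = ⊤ := by
  rw [eq_top_iff]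
  intro x _
  refine DR.apply_mem (f := NonUnitalStarAlgHom.id ℂ (DR (relPrecategory K J)))
    (relUniversalRep K J).generatedAlgebra.toSubmodule
    (relUniversalRep K J).isClosed_generatedAlgebra (fun n m a => ?_) x
  induction a using Submodule.Quotient.induction_on with
  | H a =>
    exact toDR_toRelHom_mem (relUniversalRep K J).generatedAlgebra.toSubmodule
      (fun n m a => (relUniversalRep K J).mem_generatedAlgebra a) n m a

theorem isUniversal_relUniversalRep (hJ : J ≤ K.tensorIdeal) :
    (relUniversalRep K J).IsUniversal.{u, u, v} J where
  isRightTensorRep := relUniversalRep_isRightTensorRep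
  isCoisometricOn := relUniversalRep_isCoisometricOn
  generates := relUniversalRep_generatedAlgebra
  exists_lift _ _ _ hπ hc := ⟨(relRep hπ hc hJ).lift, fun _ _ a =>
    ((relRep hπ hc hJ).lift_toDR _).trans (relRep_toRel hπ hc hJ a)⟩

end relative
end RightTensorCStarPrecategory

/-! ### The theorem, by specialization to `K_J`. -/

theorem mainTheorem5 (T : RightTensorCStarPrecategory.{u}) (K J : T.Ideal) (hJ : J ≤ K.tensorIdeal) :
    (relUniversalRep K J).IsUniversal.{u, u, v} J ∧
    (universalRep (relPrecategory K J)).IsUniversal.{u, u, v} ⊤ ∧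
    (∀ (B : Type v) [NonUnitalCStarAlgebra B]
      (π : RepFamily (⊤ : (relPrecategory K J).Ideal) B),
      π.IsRightTensorRep → π.IsCoisometricOn ⊤ →
        (∃ N : InvariantSaturatedIdeal (relPrecategory K J), π.HasKernel N.1) ∧
        ∃! Ψ : DR (relPrecategory K J) →⋆ₙₐ[ℂ] B,
          ∀ (n m : ℕ) (a), Ψ (universalRep (relPrecategory K J) n m a) = π n m a) ∧
    (∀ (B : Type v) [NonUnitalCStarAlgebra B]
      (π : RepFamily (⊤ : (relPrecategory K J).Ideal) B) (N : (relPrecategory K J).Ideal)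
      (Ψ : DR (relPrecategory K J) →⋆ₙₐ[ℂ] B),
      π.IsRightTensorRep → π.IsCoisometricOn ⊤ → π.HasKernel N →
      (∀ (n m : ℕ) (a), Ψ (universalRep (relPrecategory K J) n m a) = π n m a) →
        (∀ x ∈ N.spanDR, Ψ x = 0) ∧
        (π.AdmitsGaugeAction ↔ ∀ x, Ψ x = 0 ↔ x ∈ N.spanDR)) ∧
    (∀ N : InvariantSaturatedIdeal (relPrecategory K J),
      ∃ (B : Type u) (_ : NonUnitalCStarAlgebra B)
        (π : RepFamily (⊤ : (relPrecategory K J).Ideal) B),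
        π.IsRightTensorRep ∧ π.IsCoisometricOn ⊤ ∧ π.HasKernel N.1 ∧ π.AdmitsGaugeAction) ∧
    (∃ e : InvariantSaturatedIdeal (relPrecategory K J) ≃o
        GaugeInvariantIdeal (relPrecategory K J),
      (∀ N, (e N).1 = N.1.spanDR) ∧
      (∀ (P) (m n : ℕ) (a : (relPrecategory K J).Hom m n),
        a ∈ (e.symm P).1.carrier m n ↔ toDR (relPrecategory K J) n m a ∈ P.1) ∧
      ∀ N, ∃ φ : DR (N.1.toPrecategory N.2.1) →⋆ₙₐ[ℂ] DR (relPrecategory K J),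
        Function.Injective φ ∧ Set.range φ = ((e N).1 : Set (DR (relPrecategory K J))) ∧
        ∀ (m n : ℕ) (a : N.1.carrier m n),
          φ (toDR (N.1.toPrecategory N.2.1) n m a) = toDR (relPrecategory K J) n m a) ∧
    (∀ N N' : InvariantSaturatedIdeal (relPrecategory K J),
      (∃ M, IsLUB {N, N'} M) ∧ ∃ M, IsGLB {N, N'} M) ∧
    (∀ P P' : GaugeInvariantIdeal (relPrecategory K J),
      (∃ Q, IsLUB {P, P'} Q) ∧ ∃ Q, IsGLB {P, P'} Q) := by
  refine ⟨isUniversal_relUniversalRep hJ, isUniversal_universalRep, fun B _ π hπ hc => ?_,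
    fun B _ π N Ψ hπ hc hN hΨ => ?_, fun N => ?_, ?_, fun N N' => ?_, fun P P' => ?_⟩
  · let ρ := CoisometricRep.ofFamily hπ hc
    refine ⟨⟨⟨ρ.kerIdeal, ρ.kerIdeal_invariant, ρ.kerIdeal_saturated⟩,
      fun m n a => ⟨fun h => ⟨trivial, h⟩, fun ⟨_, h⟩ => h⟩⟩, ρ.lift,
      fun n m a => ρ.lift_toDR a.1, fun Ψ hΨ => DR.hom_ext fun n m a => ?_⟩
    rw [ρ.lift_toDR]
    exact hΨ n m ⟨a, trivial⟩
  · exact ⟨fun x hx => RepFamily.spanDR_le_kerDR hΨ hN hx, RepFamily.admitsGaugeAction_iff hΨ hN⟩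
  -- The representation with kernel `N` and a gauge action is the canonical one in the
  -- Doplicher-Roberts algebra of the quotient by `N`.
  · exact ⟨_, _, (N.1.quotientRep N.2.1).family, CoisometricRep.isRightTensorRep_family _,
      CoisometricRep.isCoisometricOn_family _, N.1.hasKernel_quotientRep N.2.1 N.2.2,
      N.1.admitsGaugeAction_quotientRep N.2.1⟩
  · exact ⟨gaugeInvariantIdealEquiv _, fun N => rfl, fun P m n a => P.2.mem_preimage, fun N =>
      ⟨(N.1.inclRep N.2.1).lift, N.1.injective_inclRep N.2.1, N.1.range_inclRep N.2.1,
        fun m n a => CoisometricRep.lift_toDR _ _⟩⟩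
  · exact ⟨InvariantSaturatedIdeal.exists_isLUB _, InvariantSaturatedIdeal.exists_isGLB _⟩
  · exact ⟨GaugeInvariantIdeal.exists_isLUB _, GaugeInvariantIdeal.exists_isGLB _⟩
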